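/- Let $\operatorname{Im}\tau>0$, $\Lambda=\mathbb Z+\mathbb Z\tau$, $\omega_1=1$, $\omega_2=\tau$, $\omega_3=1+\tau$, let $\wp,\zeta$ be the Weierstrass functions of $\Lambda$ and $e_k=\wp(\omega_k/2)$ for $k=1,2,3$. Let $p\in\mathbb C$ with $2p\notin\Lambda$, and let $T\in\mathbb C$. Consider the generalized Lamé-type equation $(*)$: $y''=q(z;T)\,y$, where $$q(z;T)=2\wp(z)+\tfrac34\bigl(\wp(z+p)+\wp(z-p)\bigr)+T\bigl(\zeta(z+p)+\zeta(z-p)-2\zeta(z)\bigr)-\frac{\wp''(p)}{4\wp'(p)}\bigl(\zeta(z+p)-\zeta(z-p)\bigr)+B,$$ $$B=T^2+\frac{\wp''(p)}{2\wp'(p)}\zeta(p)-\tfrac12\wp(p),$$ and put $S=\Lambda\cup(p+\Lambda)\cup(-p+\Lambda)$, $$\Phi_e(z)=\wp(z)-T\bigl(\zeta(z+p)+\zeta(z-p)-2\zeta(z)\bigr)-\frac{\wp''(p)}{2\wp'(p)}\bigl(\zeta(z+p)-\zeta(z-p)\bigr)+2T^2+\frac{\wp''(p)}{\wp'(p)}\zeta(p)-\wp(p),$$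 $$Q(T)=-4\prod_{k=1}^{3}\bigl(T^2-2\wp(p)-e_k\bigr).$$ Let $z_0$ be a base point such that the lines $z_0+\mathbb R$ and $z_0+\tau\mathbb R$ do not meet $S$. For a fundamental system $Y=(y_1,y_2)^{\mathsf T}$ of solutions of $(*)$ near $z_0$, the monodromy matrices $M_1,M_2$ are defined by $Y(z+\omega_j)=M_jY(z)$, where $Y$ is continued analytically along the segment from $z_0$ to $z_0+\omega_j$. The equation $(*)$ is called completely reducible if for some fundamental system $M_1=\operatorname{diag}(e^{-2\pi is},e^{2\pi is})$ and $M_2=\operatorname{diag}(e^{2\pi ir},e^{-2\pi ir})$ with some $r,s\in\mathbb C$. For $P=(T,C)$ with $C^2=Q(T)$, put $\phi(P;z)=\bigl(iC+\tfrac12\Phi_e'(z)\bigr)/\Phi_e(z)$. A pair $(r,s)\in\mathbb C^2$ is called monodromy data $(r(P),s(P))$ of $P$ if $$\exp\int_{\gamma_1}\phi(P;\xi)\,d\xi=e^{-2\pi is},\qquad \exp\int_{\gamma_2}\phi(P;\xi)\,d\xi=e^{2\pi ir}$$ for some $C^1$ paths $\gamma_j$ ($j=1,2$) from a point $z_j$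 to $z_j+\omega_j$ which avoid $S$ and the zeros of $\Phi_e$. Then: (a) $\Phi_e$ is a nontrivial elliptic solution of $\Phi'''-4q\,\Phi'-2q'\,\Phi=0$, and every elliptic (meromorphic, $\Lambda$-periodic) solution of this equation is a constant multiple of $\Phi_e$. (b) $\tfrac12\Phi_e\Phi_e''-\tfrac14(\Phi_e')^2-q\,\Phi_e^2=Q(T)$ on $\mathbb C\setminus S$. (c) For every base point $z_0$ as above, $(*)$ is completely reducible if and only if $Q(T)\neq0$. (d) For every $C$ with $C^2=Q(T)$, the point $P=(T,C)$ has monodromy data, and for all monodromy data $(r(P),s(P))$ of $P$: $Q(T)\neq0$ if and only if $(r(P),s(P))\notin\tfrac12\mathbb Z^2$; that is, $(*)$ is completely reducible (with respect to any base point $z_0$ as above) if and only if $(r(P),s(P))\notin\tfrac12\mathbb Z^2$. -/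

import Mathlib

open Filter Topology UpperHalfPlane unitInterval
open scoped Matrix

noncomputable section

namespace LameType

/-- The periods `ω₁ = 1`, `ω₂ = τ`; the lattice `ℤ + ℤ τ` is `(periods τ).lattice`. -/
def periods (τ : ℍ) : PeriodPair where
  ω₁ := 1
  ω₂ := (τ : ℂ)
  indep := by
    rw [LinearIndependent.pair_iff]
    intro s t h
    have him := congrArg Complex.im h
    have hre := congrArg Complex.re h
    have ht : t = 0 := by
      have : t * τ.im = 0 := by simpa using him
      exact (mul_eq_zero.mp this).resolve_right τ.im_pos.ne'
    subst ht
    exact ⟨by simpa using hre, rfl⟩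

/-- The Weierstrass function `℘(z; τ)`. -/
def wp (τ : ℍ) : ℂ → ℂ := (periods τ).weierstrassP

/-- The Weierstrass zeta function
`ζ(z) = 1/z + ∑_{l ≠ 0} (1/(z - l) + 1/l + z/l²)`, i.e. the odd primitive of `-℘`.
The term `l = 0` of the sum below is `1/z`, because `1/0 = 0`. -/
def zeta (τ : ℍ) (z : ℂ) : ℂ :=
  ∑' l : (periods τ).lattice, (1 / (z - (l : ℂ)) + 1 / (l : ℂ) + z / (l : ℂ) ^ 2)

/-- `℘''(p) / ℘'(p)`. -/
def wpRatio (τ : ℍ) (p : ℂ) : ℂ := deriv (deriv (wp τ)) p / deriv (wp τ) p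

/-- The accessory parameter `B = T² + (℘''(p) / (2 ℘'(p))) ζ(p) - ℘(p) / 2`. -/
def paramB (τ : ℍ) (p T : ℂ) : ℂ :=
  T ^ 2 + wpRatio τ p / 2 * zeta τ p - wp τ p / 2

/-- The potential `q(z; T)` of the equation `y'' = q(z; T) y`. -/
def potential (τ : ℍ) (p T z : ℂ) : ℂ :=
  2 * wp τ z + 3 / 4 * (wp τ (z + p) + wp τ (z - p))
    + T * (zeta τ (z + p) + zeta τ (z - p) - 2 * zeta τ z)
    - wpRatio τ p / 4 * (zeta τ (z + p) - zeta τ (z - p))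
    + paramB τ p T

/-- The preimage in `ℂ` of the singular points `0, p, -p` of the torus. -/
def singularSet (τ : ℍ) (p : ℂ) : Set ℂ :=
  {z | z ∈ (periods τ).lattice ∨ z - p ∈ (periods τ).lattice ∨ z + p ∈ (periods τ).lattice}

/-- The function `Φ_e(z; T)`. -/
def Phi (τ : ℍ) (p T z : ℂ) : ℂ :=
  wp τ z - T * (zeta τ (z + p) + zeta τ (z - p) - 2 * zeta τ z)
    - wpRatio τ p / 2 * (zeta τ (z + p) - zeta τ (z - p))
    + (2 * T ^ 2 + wpRatio τ p * zeta τ p - wp τ p)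

/-- `Ψ` is an elliptic function (meromorphic on `ℂ`, with periods `1` and `τ`) which solves the
second symmetric product equation `Ψ''' - 4 q Ψ' - 2 q' Ψ = 0`. Identities between meromorphic
functions are required outside a closed discrete set, as usual. -/
def IsEllipticSymSqSolution (τ : ℍ) (p T : ℂ) (Ψ : ℂ → ℂ) : Prop :=
  Meromorphic Ψ ∧
  (∀ l ∈ (periods τ).lattice, (fun z => Ψ (z + l)) =ᶠ[codiscrete ℂ] Ψ) ∧
  ∀ᶠ z in codiscrete ℂ,
    deriv (deriv (deriv Ψ)) z - 4 * potential τ p T z * deriv Ψ z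
      - 2 * deriv (potential τ p T) z * Ψ z = 0

/-- The value `e_k = ℘(ω_k / 2)`, with `ω_1 = 1`, `ω_2 = τ`, `ω_3 = 1 + τ`
(indexed by `0, 1, 2`). -/
def halfPeriodValue (τ : ℍ) : Fin 3 → ℂ :=
  ![wp τ (1 / 2), wp τ ((τ : ℂ) / 2), wp τ ((1 + (τ : ℂ)) / 2)]

/-- The spectral polynomial `Q(T) = -4 ∏ₖ (T² - 2 ℘(p) - e_k)`. -/
def spectralQ (τ : ℍ) (p T : ℂ) : ℂ :=
  -4 * ∏ k : Fin 3, (T ^ 2 - 2 * wp τ p - halfPeriodValue τ k)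

/-- `g` is the germ at `b` obtained from the germ of `f` at `a` by analytic continuation along the
straight segment from `a` to `b`. -/
def IsContinuation (a b : ℂ) (f g : ℂ → ℂ) : Prop :=
  ∃ F : ℂ → ℂ, AnalyticOnNhd ℂ F (segment ℝ a b) ∧ F =ᶠ[𝓝 a] f ∧ F =ᶠ[𝓝 b] g

/-- `y 0, y 1` is a fundamental system of holomorphic solutions of `y'' = q y` near `z₀`. -/
def IsFundamentalSystem (q : ℂ → ℂ) (z₀ : ℂ) (y : Fin 2 → ℂ → ℂ) : Prop :=
  (∀ i, AnalyticAt ℂ (y i) z₀) ∧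
  (∀ i, ∀ᶠ z in 𝓝 z₀, deriv (deriv (y i)) z = q z * y i z) ∧
  ∀ c : Fin 2 → ℂ, (∀ᶠ z in 𝓝 z₀, ∑ i, c i * y i z = 0) → c = 0

/-- `M` is the monodromy matrix of the system `y` (given near `z₀`) for the period `ω`:
continuing `y` along the segment from `z₀` to `z₀ + ω` one has `y(z + ω) = M y(z)` near `z₀`. -/
def IsMonodromyMatrix (z₀ ω : ℂ) (y : Fin 2 → ℂ → ℂ) (M : Matrix (Fin 2) (Fin 2) ℂ) : Prop :=
  ∃ Y : Fin 2 → ℂ → ℂ,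
    (∀ i, IsContinuation z₀ (z₀ + ω) (y i) (Y i)) ∧
    ∀ᶠ z in 𝓝 z₀, (fun i => Y i (z + ω)) = M *ᵥ (fun i => y i z)

/-- Admissible base points: neither of the lines `z₀ + ℝ`, `z₀ + τ ℝ` meets the singular set. -/
def IsBasePoint (τ : ℍ) (p z₀ : ℂ) : Prop :=
  ∀ t : ℝ, z₀ + t ∉ singularSet τ p ∧ z₀ + t * (τ : ℂ) ∉ singularSet τ p

/-- The equation `y'' = q(z; T) y` is completely reducible: in a suitable fundamental system at
the base point `z₀`, the monodromy matrices for the periods `1` and `τ` are both diagonal, of the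
form `diag(e^{-2πis}, e^{2πis})` and `diag(e^{2πir}, e^{-2πir})`. -/
def CompletelyReducible (τ : ℍ) (p T z₀ : ℂ) : Prop :=
  ∃ (y : Fin 2 → ℂ → ℂ) (r s : ℂ),
    IsFundamentalSystem (potential τ p T) z₀ y ∧
    IsMonodromyMatrix z₀ 1 y
      !![Complex.exp (-(2 * Real.pi * Complex.I * s)), 0;
         0, Complex.exp (2 * Real.pi * Complex.I * s)] ∧
    IsMonodromyMatrix z₀ (τ : ℂ) y
      !![Complex.exp (2 * Real.pi * Complex.I * r), 0;
         0, Complex.exp (-(2 * Real.pi * Complex.I * r))]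

/-- The meromorphic function `φ(P; z) = (i C + Φ_e'(z) / 2) / Φ_e(z)`, `P = (T, C)`. -/
def phi (τ : ℍ) (p T C z : ℂ) : ℂ :=
  (Complex.I * C + deriv (Phi τ p T) z / 2) / Phi τ p T z

/-- `γ` is a `C¹` path avoiding the singular points and the zeros of `Φ_e`. -/
def IsAdmissiblePath (τ : ℍ) (p T : ℂ) {a b : ℂ} (γ : Path a b) : Prop :=
  ContDiffOn ℝ 1 γ.extend I ∧ ∀ t, γ t ∉ singularSet τ p ∧ Phi τ p T (γ t) ≠ 0

/-- The multiplier `exp ∫_γ φ(P; ξ) dξ` of the Baker–Akhiezer function along `γ`. -/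
def multiplier (τ : ℍ) (p T C : ℂ) {a b : ℂ} (γ : Path a b) : ℂ :=
  Complex.exp (curveIntegral (fun z => ContinuousLinearMap.toSpanSingleton ℂ (phi τ p T C z)) γ)

/-- `(r, s)` is monodromy data of the point `P = (T, C)`: `λ₁(P) = e^{-2πis}` and
`λ₂(P) = e^{2πir}`, where `λ_j(P)` is computed along admissible paths `γ₁` from some `z₁` to
`z₁ + 1` and `γ₂` from some `z₂` to `z₂ + τ`. -/
def IsMonodromyData (τ : ℍ) (p T C r s : ℂ) : Prop :=
  ∃ (z₁ z₂ : ℂ) (γ₁ : Path z₁ (z₁ + 1)) (γ₂ : Path z₂ (z₂ + (τ : ℂ))),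
    IsAdmissiblePath τ p T γ₁ ∧ IsAdmissiblePath τ p T γ₂ ∧
    multiplier τ p T C γ₁ = Complex.exp (-(2 * Real.pi * Complex.I * s)) ∧
    multiplier τ p T C γ₂ = Complex.exp (2 * Real.pi * Complex.I * r)

/-- `(r, s) ∈ ½ ℤ²`. -/
def IsHalfIntegral (r s : ℂ) : Prop :=
  ∃ m n : ℤ, r = (m : ℂ) / 2 ∧ s = (n : ℂ) / 2

end LameType

end

noncomputable section

namespace LameType

/-! ### The Weierstrass zeta function -/

/-! Away from `S` all functions involved are rational in X = ℘(z) - ℘(p) and Y = ℘'(z)/X, subject to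
a relation giving Y² in terms of X (`algY_sq`). The addition formulas that achieve this
(`wp_sub_mul_zeta`, `zeta_add_zeta`, `wp_add_wp`) rest on the fact that an elliptic function without
poles is constant. In these coordinates the quadratic first integral (b) is an algebraic identity
(`Phi_spectral`), and differentiating it shows that Φ_e solves the third order equation.

Uniqueness comes from the indicial equation. An elliptic solution has order -2, 1 or 4 at lattice
points, order at least -1 at ±p, and no poles elsewhere. Subtracting a multiple of Φ_e removes order
-2 at 0. Then X times the difference has at most a simple pole modulo Λ, so it is constant; the
constant is 0 because order 2 is not allowed at 0 (`eq_zero`, `exists_eq_mul_Phi`).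

By (b), φ satisfies the Riccati equation φ' + φ² = q, so solutions of F' = φF solve the original
equation. Off `S` the residues of φ are 0 or 1, so such F are holomorphic there. If Q ≠ 0, the signs
±C give independent solutions whose product is a multiple of the periodic function Φ_e; they
diagonalize both monodromies with mutually inverse entries.

If Q = 0, the two solutions coincide and a second one is Fχ with χ' = 1/Φ_e. This χ is single-valued
because 1/Φ_e has no residues, which at ±p uses that the singularity is apparent. Diagonal
monodromies would make χ periodic; then χΦ_e would be an elliptic solution not proportional to Φ_e,
against (a).

For (d), 2φ has integer residues when Q ≠ 0, so F' = 2φF has a global meromorphic solution whose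
period factors are the squared multipliers. If both squares were 1, F would be an elliptic solution
of the third order equation, hence a multiple of Φ_e, and 2φ = Φ_e'/Φ_e would force C = 0. When Q =
0, Φ_e itself is such a solution, so both squares are 1 (`multiplier_sq_eq_one_iff`). -/

/-- The Weierstrass zeta function without its term `1 / z`. -/
def zetaReg (τ : ℍ) (z : ℂ) : ℂ :=
  ∑' l : (periods τ).lattice,
    if (l : ℂ) = 0 then 0 else (1 / (z - (l : ℂ)) + 1 / (l : ℂ) + z / (l : ℂ) ^ 2)

/-- Over a common denominator the summand collapses to s²/(l²(s - l)). This is of size |l|⁻³, which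
is summable over a lattice of rank 2. -/
lemma norm_zeta_summand_le (r : ℝ) (s : ℂ) (hs : ‖s‖ < r) (l : ℂ) (hl0 : l ≠ 0)
    (h : 2 * r ≤ ‖l‖) :
    ‖1 / (s - l) + 1 / l + s / l ^ 2‖ ≤ 2 * r ^ 2 * ‖l‖ ^ (-3 : ℝ) := by
  have hr : 0 ≤ r := (norm_nonneg s).trans hs.le
  have hl : 0 < ‖l‖ := norm_pos_iff.mpr hl0
  have hsl : s - l ≠ 0 := by
    intro h0
    rw [sub_eq_zero] at h0
    subst h0
    linarith
  have h1 : 1 / (s - l) + 1 / l + s / l ^ 2 = s ^ 2 / (l ^ 2 * (s - l)) := by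
    field_simp
    ring
  have h2 : ‖l‖ / 2 ≤ ‖s - l‖ := by
    have := norm_sub_norm_le l s
    rw [norm_sub_rev] at this
    linarith
  rw [h1, norm_div, norm_mul, norm_pow, norm_pow, Real.rpow_neg hl.le,
    ← div_eq_mul_inv]
  norm_cast
  calc ‖s‖ ^ 2 / (‖l‖ ^ 2 * ‖s - l‖) ≤ r ^ 2 / (‖l‖ ^ 2 * (‖l‖ / 2)) := by
        gcongr
    _ = 2 * r ^ 2 / ‖l‖ ^ 3 := by field_simp

lemma hasSumLocallyUniformly_zetaReg (τ : ℍ) :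
    HasSumLocallyUniformly
      (fun (l : (periods τ).lattice) (z : ℂ) =>
        if (l : ℂ) = 0 then 0 else (1 / (z - (l : ℂ)) + 1 / (l : ℂ) + z / (l : ℂ) ^ 2))
      (zetaReg τ) := by
  refine (periods τ).hasSumLocallyUniformly_aux
    (u := fun r l => 2 * r ^ 2 * ‖l‖ ^ (-3 : ℝ)) _
    (fun _ _ ↦ (ZLattice.summable_norm_rpow _ _ (by simp; norm_num)).mul_left _) fun r hr ↦
    Filter.eventually_atTop.mpr ⟨2 * r, ?_⟩
  rintro _ h s hs l rfl
  split_ifs with h0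
  · rw [norm_zero]; positivity
  · exact norm_zeta_summand_le r s hs l h0 h

lemma differentiableOn_zetaReg_partial (τ : ℍ) (s : Finset (periods τ).lattice) :
    DifferentiableOn ℂ (fun z => ∑ l ∈ s, if (l : ℂ) = 0 then 0 else
      (1 / (z - (l : ℂ)) + 1 / (l : ℂ) + z / (l : ℂ) ^ 2))
      (((periods τ).lattice : Set ℂ) \ {0})ᶜ := by
  refine .fun_sum fun i hi ↦ ?_
  split_ifs with h0
  · simp
  · refine .add (.add (.div (by fun_prop) (by fun_prop) fun x hx h => hx ?_) (by fun_prop))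
      (by fun_prop)
    rw [sub_eq_zero] at h
    subst h
    exact ⟨i.2, h0⟩

lemma differentiableOn_zetaReg (τ : ℍ) :
    DifferentiableOn ℂ (zetaReg τ) (((periods τ).lattice : Set ℂ) \ {0})ᶜ :=
  (hasSumLocallyUniformly_zetaReg τ).hasSumLocallyUniformlyOn.differentiableOn
    (.of_forall fun s ↦ by
      convert differentiableOn_zetaReg_partial τ s using 1) (periods τ).isOpen_compl_lattice_sdiff

/-- Locally uniform convergence allows termwise differentiation, and each term differentiates to the
negative of the corresponding term of ℘. -/
lemma deriv_zetaReg (τ : ℍ) :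
    Set.EqOn (deriv (zetaReg τ)) (fun z => -(periods τ).weierstrassPExcept 0 z)
      (((periods τ).lattice : Set ℂ) \ {0})ᶜ := by
  refine ((hasSumLocallyUniformly_zetaReg τ).tendstoLocallyUniformlyOn.deriv
    (.of_forall fun s ↦ ?_) (periods τ).isOpen_compl_lattice_sdiff).unique ?_
  · convert differentiableOn_zetaReg_partial τ s using 1
  · have := ((periods τ).hasSumLocallyUniformly_weierstrassPExcept 0).tendstoLocallyUniformlyOn
      (s := (((periods τ).lattice : Set ℂ) \ {0})ᶜ)
    refine TendstoLocallyUniformlyOn.congr (F := fun (s : Finset (periods τ).lattice) (z : ℂ) =>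
      - ∑ l ∈ s, if (l : ℂ) = 0 then 0 else (1 / (z - (l : ℂ)) ^ 2 - 1 / (l : ℂ) ^ 2)) ?_ ?_
    · exact this.neg
    · intro s z hz
      simp only [Function.comp_apply]
      rw [← Finset.sum_neg_distrib, deriv_fun_sum]
      · congr with l
        split_ifs with h0
        · simp
        · have h1 : z - l ≠ 0 := fun h => hz (by
            rw [sub_eq_zero] at h; subst h; exact ⟨l.2, h0⟩)
          have h2 : HasDerivAt (fun z : ℂ => 1 / (z - (l : ℂ)) + 1 / (l : ℂ) + z / (l : ℂ) ^ 2)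
              (-1 / (z - l) ^ 2 + 1 / (l : ℂ) ^ 2) z := by
            have := ((hasDerivAt_id z).sub_const (l : ℂ)).fun_inv h1
            simpa [one_div] using (this.add_const (1 / (l : ℂ))).fun_add
              ((hasDerivAt_id z).div_const ((l : ℂ) ^ 2))
          rw [h2.deriv]
          ring
      · intro l hl
        have := (differentiableOn_zetaReg_partial τ {l}).differentiableAt
          ((periods τ).isOpen_compl_lattice_sdiff.mem_nhds hz)
        simpa using this

lemma zetaReg_add (τ : ℍ) (z : ℂ) : zetaReg τ z + 1 / z = zeta τ z := by
  trans zetaReg τ z + ∑' l : (periods τ).lattice, if (l : ℂ) = 0 then 1 / z else 0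
  · congr 1
    rw [tsum_eq_single 0]
    · simp
    · intro l hl
      rw [if_neg (by simpa using hl)]
  · rw [zeta, zetaReg, ← Summable.tsum_add]
    · congr with l
      split_ifs with h
      · simp [h]
      · simp
    · exact ⟨_, (hasSumLocallyUniformly_zetaReg τ).hasSum⟩
    · refine summable_of_hasFiniteSupport ((Set.finite_singleton 0).subset fun l hl => ?_)
      simp only [Function.mem_support, ne_eq, ite_eq_right_iff, not_forall] at hl
      simpa using hl.1

lemma zeta_neg (τ : ℍ) (z : ℂ) : zeta τ (-z) = -zeta τ z := by
  simp only [zeta]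
  rw [← (Equiv.neg (periods τ).lattice).tsum_eq, ← tsum_neg]
  congr with l
  simp only [Equiv.neg_apply, NegMemClass.coe_neg]
  rw [show -z - -(l : ℂ) = -(z - l) by ring]
  simp only [div_neg, neg_div, neg_sq]
  ring

lemma isOpen_compl_lattice (τ : ℍ) : IsOpen ((periods τ).lattice : Set ℂ)ᶜ :=
  (periods τ).isClosed_lattice.isOpen_compl

lemma analyticAt_zetaReg_zero (τ : ℍ) : AnalyticAt ℂ (zetaReg τ) 0 :=
  (differentiableOn_zetaReg τ).analyticAt
    ((periods τ).isOpen_compl_lattice_sdiff.mem_nhds (by simp))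

lemma hasDerivAt_zeta (τ : ℍ) {z : ℂ} (hz : z ∉ (periods τ).lattice) :
    HasDerivAt (zeta τ) (-wp τ z) z := by
  have hz0 : z ≠ 0 := by rintro rfl; exact hz (zero_mem _)
  have hm : z ∈ (((periods τ).lattice : Set ℂ) \ {0})ᶜ := fun h => hz h.1
  have h1 : HasDerivAt (zetaReg τ) (-(periods τ).weierstrassPExcept 0 z) z := by
    rw [show -(periods τ).weierstrassPExcept 0 z = deriv (zetaReg τ) z from
      (deriv_zetaReg τ hm).symm]
    exact ((differentiableOn_zetaReg τ).differentiableAt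
      ((periods τ).isOpen_compl_lattice_sdiff.mem_nhds hm)).hasDerivAt
  have h2 := h1.add ((hasDerivAt_id z).inv hz0)
  have h3 : zeta τ = zetaReg τ + id⁻¹ := by
    ext z
    simp [← zetaReg_add]
  rw [h3]
  refine h2.congr_deriv ?_
  have := (periods τ).weierstrassPExcept_add 0 z
  simp only [ZeroMemClass.coe_zero, sub_zero] at this
  simp only [wp, ← this, id]
  field_simp
  ring

lemma analyticAt_zeta (τ : ℍ) {z : ℂ} (hz : z ∉ (periods τ).lattice) :
    AnalyticAt ℂ (zeta τ) z := by
  have : DifferentiableOn ℂ (zeta τ) ((periods τ).lattice : Set ℂ)ᶜ :=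
    fun w hw => (hasDerivAt_zeta τ hw).differentiableAt.differentiableWithinAt
  exact this.analyticAt ((isOpen_compl_lattice τ).mem_nhds hz)

/-- The zeta function is quasi-periodic. -/
lemma exists_zeta_add (τ : ℍ) {l : ℂ} (hl : l ∈ (periods τ).lattice) :
    ∃ η : ℂ, ∀ z, z ∉ (periods τ).lattice → zeta τ (z + l) = zeta τ z + η := by
  have hmem : ∀ z, z ∉ (periods τ).lattice → z + l ∉ (periods τ).lattice := fun z hz h =>
    hz (by simpa using sub_mem h hl)
  have hd : ∀ z, z ∉ (periods τ).lattice →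
      HasDerivAt (fun z => zeta τ (z + l) - zeta τ z) 0 z := by
    intro z hz
    have h1 := (hasDerivAt_zeta τ (hmem z hz)).comp_add_const z l
    have h2 := h1.sub (hasDerivAt_zeta τ hz)
    refine h2.congr_deriv ?_
    have := (periods τ).weierstrassP_add_coe z ⟨l, hl⟩
    simp only [wp] at *
    rw [this]
    ring
  -- The two sides have equal derivatives, so it remains to know that the complement of a countable
  -- set in the plane is connected.
  have hconn : IsPreconnected ((periods τ).lattice : Set ℂ)ᶜ := by
    refine (Set.Countable.isConnected_compl_of_one_lt_rank (by simp) ?_).isPreconnected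
    exact countable_of_Lindelof_of_discrete (X := (periods τ).lattice)
  have hw := (periods τ).ω₁_div_two_notMem_lattice
  refine ⟨zeta τ ((periods τ).ω₁ / 2 + l) - zeta τ ((periods τ).ω₁ / 2), fun z hz => ?_⟩
  have := (isOpen_compl_lattice τ).is_const_of_deriv_eq_zero hconn
    (fun z hz => (hd z hz).differentiableAt.differentiableWithinAt)
    (fun z hz => (hd z hz).deriv) hz hw
  linear_combination this

/-! ### Meromorphic functions up to discrete sets -/

lemma eventually_codiscrete_iff {P : ℂ → Prop} :
    (∀ᶠ z in codiscrete ℂ, P z) ↔ ∀ w, ∀ᶠ z in 𝓝[≠] w, P z := by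
  rw [Filter.Eventually, codiscrete, mem_codiscreteWithin_iff_forall_mem_nhdsNE]
  simp [Filter.Eventually]

lemma eventually_codiscrete_eventually_nhds {P : ℂ → Prop}
    (h : ∀ᶠ z in codiscrete ℂ, P z) : ∀ᶠ z in codiscrete ℂ, ∀ᶠ y in 𝓝 z, P y := by
  rw [eventually_codiscrete_iff] at *
  exact fun w => eventually_nhdsNE_eventually_nhds_iff.mpr (h w)

lemma eventually_nhdsNE_add {P : ℂ → Prop} {w : ℂ} (l : ℂ)
    (h : ∀ᶠ z in 𝓝[≠] (w + l), P z) : ∀ᶠ z in 𝓝[≠] w, P (z + l) := by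
  have : Tendsto (fun z : ℂ => z + l) (𝓝[≠] w) (𝓝[≠] (w + l)) :=
    tendsto_nhdsWithin_of_tendsto_nhds_of_eventually_within _
      ((continuous_add_const l).tendsto w |>.mono_left nhdsWithin_le_nhds)
      (eventually_mem_nhdsWithin.mono fun z hz h => hz (by simpa using h))
  exact this.eventually h

lemma eventually_codiscrete_add {P : ℂ → Prop} (l : ℂ)
    (h : ∀ᶠ z in codiscrete ℂ, P z) : ∀ᶠ z in codiscrete ℂ, P (z + l) := by
  rw [eventually_codiscrete_iff] at *
  exact fun w => eventually_nhdsNE_add l (h (w + l))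

lemma eventually_codiscrete_analyticAt {f : ℂ → ℂ} (hf : Meromorphic f) :
    ∀ᶠ z in codiscrete ℂ, AnalyticAt ℂ f z :=
  eventually_codiscrete_iff.mpr fun w => (hf w).eventually_analyticAt

lemma eq_of_eventuallyEq_nhdsNE {f g : ℂ → ℂ} {w : ℂ} (hf : ContinuousAt f w)
    (hg : ContinuousAt g w) (h : f =ᶠ[𝓝[≠] w] g) : f w = g w :=
  tendsto_nhds_unique_of_eventuallyEq (hf.tendsto.mono_left nhdsWithin_le_nhds)
    (hg.tendsto.mono_left nhdsWithin_le_nhds) h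

lemma eventuallyEq_nhds_of_nhdsNE {f g : ℂ → ℂ} {w : ℂ} (hf : ContinuousAt f w)
    (hg : ContinuousAt g w) (h : f =ᶠ[𝓝[≠] w] g) : f =ᶠ[𝓝 w] g :=
  (hf.eventuallyEq_nhds_iff_eventuallyEq_nhdsNE hg).mp h

lemma nhdsNE_of_codiscrete {f g : ℂ → ℂ} (h : f =ᶠ[codiscrete ℂ] g) (w : ℂ) :
    f =ᶠ[𝓝[≠] w] g := eventually_codiscrete_iff.mp h w

lemma deriv_eventuallyEq_codiscrete {f g : ℂ → ℂ} (h : f =ᶠ[codiscrete ℂ] g) :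
    deriv f =ᶠ[codiscrete ℂ] deriv g :=
  eventually_codiscrete_iff.mpr fun w => (nhdsNE_of_codiscrete h w).nhdsNE_deriv

lemma order_ne_top_of_meromorphic {f : ℂ → ℂ} (hf : Meromorphic f) {w : ℂ}
    (hw : meromorphicOrderAt f w ≠ ⊤) (z : ℂ) : meromorphicOrderAt f z ≠ ⊤ :=
  MeromorphicOn.meromorphicOrderAt_ne_top_of_isPreconnected (U := Set.univ)
    (fun x _ => hf x) isPreconnected_univ trivial trivial hw

lemma eventually_codiscrete_ne_zero {f : ℂ → ℂ} (hf : Meromorphic f)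
    (h : ∀ z, meromorphicOrderAt f z ≠ ⊤) : ∀ᶠ z in codiscrete ℂ, f z ≠ 0 :=
  eventually_codiscrete_iff.mpr fun w =>
    (meromorphicOrderAt_ne_top_iff_eventually_ne_zero (hf w)).mp (h w)

/-- Identity theorem: infinite order of f - g at one point propagates to every point. -/
lemma eventuallyEq_codiscrete_of_nhdsNE {f g : ℂ → ℂ} (hf : Meromorphic f) (hg : Meromorphic g)
    {w : ℂ} (h : f =ᶠ[𝓝[≠] w] g) : f =ᶠ[codiscrete ℂ] g := by
  rw [Filter.EventuallyEq, eventually_codiscrete_iff]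
  intro z
  by_contra hz
  have hz' : meromorphicOrderAt (f - g) z ≠ ⊤ := by
    rw [Ne, meromorphicOrderAt_eq_top_iff]
    simpa [sub_eq_zero] using hz
  refine order_ne_top_of_meromorphic (hf.sub hg) hz' w (meromorphicOrderAt_eq_top_iff.mpr ?_)
  filter_upwards [h] with y hy
  simp [hy]

/-- The canonical representative of a meromorphic function on `ℂ`. -/
lemma exists_meromorphicNF {f : ℂ → ℂ} (hf : Meromorphic f) :
    ∃ g : ℂ → ℂ, (∀ z, MeromorphicNFAt g z) ∧ g =ᶠ[codiscrete ℂ] f := by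
  have hf' : MeromorphicOn f Set.univ := fun z _ => hf z
  exact ⟨toMeromorphicNFOn f Set.univ, fun z => meromorphicNFOn_toMeromorphicNFOn f _ trivial,
    eventually_codiscrete_iff.mpr fun w =>
      MeromorphicOn.toMeromorphicNFOn_eq_self_on_nhdsNE hf' trivial⟩

lemma meromorphicOrderAt_congr_codiscrete {f g : ℂ → ℂ} (h : f =ᶠ[codiscrete ℂ] g) (z : ℂ) :
    meromorphicOrderAt f z = meromorphicOrderAt g z :=
  meromorphicOrderAt_congr (eventually_codiscrete_iff.mp h z)

/-- A meromorphic function without poles agrees with an entire function. -/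
lemma exists_entire_of_order_nonneg {f : ℂ → ℂ} (hf : Meromorphic f)
    (hord : ∀ z, 0 ≤ meromorphicOrderAt f z) :
    ∃ g : ℂ → ℂ, Differentiable ℂ g ∧ g =ᶠ[codiscrete ℂ] f := by
  obtain ⟨g, hg, hgf⟩ := exists_meromorphicNF hf
  refine ⟨g, fun z => ?_, hgf⟩
  refine AnalyticAt.differentiableAt ?_
  rw [← (hg z).meromorphicOrderAt_nonneg_iff_analyticAt, meromorphicOrderAt_congr_codiscrete hgf]
  exact hord z

/-- A meromorphic function with vanishing derivative is locally constant. -/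
lemma exists_eventuallyEq_const_of_deriv {f : ℂ → ℂ} {w : ℂ} (hf : MeromorphicAt f w)
    (h : ∀ᶠ z in 𝓝[≠] w, deriv f z = 0) : ∃ c, f =ᶠ[𝓝[≠] w] fun _ => c := by
  -- A pole of order n < 0 would give the derivative the finite order n - 1, but the derivative
  -- vanishes identically near w.
  have hord : 0 ≤ meromorphicOrderAt f w := by
    by_contra hneg
    have htop : meromorphicOrderAt f w ≠ ⊤ := fun h => by simp [h] at hneg
    lift meromorphicOrderAt f w to ℤ using htop with n hn
    have hn0 : (n : ℂ) ≠ 0 := by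
      intro h0
      have : n = 0 := by exact_mod_cast h0
      simp [this] at hneg
    have := meromorphicOrderAt_deriv_eq_sub_one hn0 hn.symm
    rw [meromorphicOrderAt_eq_top_iff.mpr h] at this
    exact WithTop.top_ne_coe this
  obtain ⟨g, hg, hfg⟩ := hf.meromorphicOrderAt_nonneg_iff.mp hord
  have hg' : deriv g =ᶠ[𝓝[≠] w] fun _ => 0 := hfg.nhdsNE_deriv.symm.trans h
  have hg'' : deriv g =ᶠ[𝓝 w] fun _ => 0 :=
    eventuallyEq_nhds_of_nhdsNE hg.deriv.continuousAt continuousAt_const hg'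
  obtain ⟨r, hr, hball⟩ := Metric.eventually_nhds_iff_ball.mp
    (hg''.and hg.eventually_analyticAt)
  refine ⟨g w, hfg.trans ?_⟩
  refine Filter.Eventually.filter_mono nhdsWithin_le_nhds ?_
  filter_upwards [Metric.ball_mem_nhds w hr] with z hz
  exact Metric.isOpen_ball.is_const_of_deriv_eq_zero (convex_ball w r).isPreconnected
    (fun y hy => (hball y hy).2.differentiableAt.differentiableWithinAt)
    (fun y hy => (hball y hy).1) hz (Metric.mem_ball_self hr)

lemma exists_eventuallyEq_const_of_deriv_codiscrete {f : ℂ → ℂ} (hf : Meromorphic f)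
    (h : ∀ᶠ z in codiscrete ℂ, deriv f z = 0) : ∃ c, f =ᶠ[codiscrete ℂ] fun _ => c := by
  obtain ⟨c, hc⟩ := exists_eventuallyEq_const_of_deriv (hf 0) (eventually_codiscrete_iff.mp h 0)
  exact ⟨c, eventuallyEq_codiscrete_of_nhdsNE hf (Meromorphic.const c) hc⟩

/-! ### Elliptic functions -/

/-- Periodicity with respect to the lattice, up to a discrete set. -/
def IsPeriodic (τ : ℍ) (f : ℂ → ℂ) : Prop :=
  ∀ l ∈ (periods τ).lattice, (fun z => f (z + l)) =ᶠ[codiscrete ℂ] f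

lemma IsPeriodic.order {τ : ℍ} {f : ℂ → ℂ} (h : IsPeriodic τ f) {l : ℂ}
    (hl : l ∈ (periods τ).lattice) (z : ℂ) :
    meromorphicOrderAt f (z + l) = meromorphicOrderAt f z := by
  rw [← meromorphicOrderAt_congr_codiscrete (h l hl) z]
  exact (meromorphicOrderAt_comp_add_const_eq_meromorphicOrderAt (c := l) (f := f)).symm

lemma IsPeriodic.comp₂ {τ : ℍ} {f g : ℂ → ℂ} (hf : IsPeriodic τ f) (hg : IsPeriodic τ g)
    (F : ℂ → ℂ → ℂ) : IsPeriodic τ (fun z => F (f z) (g z)) := by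
  intro l hl
  filter_upwards [hf l hl, hg l hl] with z h1 h2
  rw [h1, h2]

lemma IsPeriodic.comp {τ : ℍ} {f : ℂ → ℂ} (hf : IsPeriodic τ f)
    (F : ℂ → ℂ) : IsPeriodic τ (fun z => F (f z)) := hf.comp₂ hf fun x _ => F x

lemma IsPeriodic.congr {τ : ℍ} {f g : ℂ → ℂ} (hf : IsPeriodic τ f)
    (h : f =ᶠ[codiscrete ℂ] g) : IsPeriodic τ g := by
  intro l hl
  filter_upwards [hf l hl, h, eventually_codiscrete_add l h] with z h1 h2 h3
  rw [← h3, h1, h2]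

lemma IsPeriodic.deriv {τ : ℍ} {f : ℂ → ℂ} (hf : IsPeriodic τ f) : IsPeriodic τ (deriv f) := by
  intro l hl
  filter_upwards [deriv_eventuallyEq_codiscrete (hf l hl)] with z hz
  rw [← hz, deriv_comp_add_const]

lemma isPeriodic_of_generators {τ : ℍ} {f : ℂ → ℂ}
    (h1 : (fun z => f (z + 1)) =ᶠ[codiscrete ℂ] f)
    (h2 : (fun z => f (z + τ)) =ᶠ[codiscrete ℂ] f) : IsPeriodic τ f := by
  let A : AddSubgroup ℂ :=
    { carrier := {l | (fun z => f (z + l)) =ᶠ[codiscrete ℂ] f}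
      add_mem' := by
        intro a b ha hb
        simp only [Set.mem_ofPred_eq] at *
        filter_upwards [ha, eventually_codiscrete_add a hb] with z h1 h2
        rw [← h1, ← h2, add_assoc]
      zero_mem' := by simp
      neg_mem' := by
        intro a ha
        simp only [Set.mem_ofPred_eq] at *
        filter_upwards [eventually_codiscrete_add (-a) ha] with z h1
        rw [← h1]
        simp }
  have : (periods τ).lattice ≤ A.toIntSubmodule := by
    rw [PeriodPair.lattice, Submodule.span_le]
    rintro _ (rfl | rfl)
    · exact h1
    · exact h2
  exact fun l hl => this hl

/-- An elliptic function without poles is constant. -/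
lemma exists_const_of_order_nonneg {τ : ℍ} {f : ℂ → ℂ} (hf : Meromorphic f)
    (hper : IsPeriodic τ f) (hord : ∀ z, 0 ≤ meromorphicOrderAt f z) :
    ∃ c, f =ᶠ[codiscrete ℂ] fun _ => c := by
  obtain ⟨g, hg, hgf⟩ := exists_entire_of_order_nonneg hf hord
  have hgper : ∀ z w, w ∈ (periods τ).lattice → g (z + w) = g z := by
    intro z w hw
    refine eq_of_eventuallyEq_nhdsNE (f := fun z => g (z + w)) ?_ hg.continuous.continuousAt ?_
    · exact (hg.continuous.comp (continuous_add_const w)).continuousAt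
    · exact eventually_codiscrete_iff.mp (hper.congr hgf.symm w hw) z
  refine ⟨g 0, hgf.symm.trans (Eventually.of_forall fun z => ?_)⟩
  exact hg.apply_eq_apply_of_bounded (IsZLattice.isCompact_range_of_periodic
    (periods τ).lattice _ hg.continuous hgper).isBounded z 0

/-! ### First order Taylor expansions -/

/-- The witness is `dslope`. The equation holds for every z, so it can be iterated to read off
further Taylor coefficients without shrinking neighbourhoods. -/
lemma exists_eq_add_mul {v : ℂ → ℂ} {w : ℂ} (hv : AnalyticAt ℂ v w) :
    ∃ k : ℂ → ℂ, AnalyticAt ℂ k w ∧ k w = deriv v w ∧ ∀ z, v z = v w + (z - w) * k z := by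
  obtain ⟨p, hp⟩ := hv
  refine ⟨dslope v w, ⟨_, hp.has_fpower_series_dslope_fslope⟩, dslope_same v w, fun z => ?_⟩
  have := sub_smul_dslope v w z
  rw [smul_eq_mul] at this
  rw [this]
  ring

/-! ### The Weierstrass functions and their addition formulas -/

lemma analyticAt_wp (τ : ℍ) {z : ℂ} (hz : z ∉ (periods τ).lattice) : AnalyticAt ℂ (wp τ) z :=
  (periods τ).analyticOnNhd_weierstrassP z hz

lemma wp_neg (τ : ℍ) (z : ℂ) : wp τ (-z) = wp τ z := (periods τ).weierstrassP_neg z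

lemma wp_add (τ : ℍ) (z : ℂ) {l : ℂ} (hl : l ∈ (periods τ).lattice) : wp τ (z + l) = wp τ z :=
  (periods τ).weierstrassP_add_coe z ⟨l, hl⟩

lemma deriv_wp_neg (τ : ℍ) (z : ℂ) : deriv (wp τ) (-z) = -deriv (wp τ) z := by
  rw [wp, (periods τ).deriv_weierstrassP]
  exact (periods τ).derivWeierstrassP_neg z

lemma deriv_wp_add (τ : ℍ) (z : ℂ) {l : ℂ} (hl : l ∈ (periods τ).lattice) :
    deriv (wp τ) (z + l) = deriv (wp τ) z := by
  rw [wp, (periods τ).deriv_weierstrassP]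
  exact (periods τ).derivWeierstrassP_add_coe z ⟨l, hl⟩

lemma deriv_wp_sq (τ : ℍ) {z : ℂ} (hz : z ∉ (periods τ).lattice) :
    deriv (wp τ) z ^ 2 = 4 * wp τ z ^ 3 - (periods τ).g₂ * wp τ z - (periods τ).g₃ := by
  rw [wp, (periods τ).deriv_weierstrassP]
  exact (periods τ).derivWeierstrassP_sq z hz

lemma meromorphic_wp (τ : ℍ) : Meromorphic (wp τ) := (periods τ).meromorphic_weierstrassP

lemma isPeriodic_wp (τ : ℍ) : IsPeriodic τ (wp τ) :=
  fun _ hl => Eventually.of_forall fun z => wp_add τ z hl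

lemma order_wp_sub_const (τ : ℍ) {l : ℂ} (hl : l ∈ (periods τ).lattice) (c : ℂ) :
    meromorphicOrderAt (fun z => wp τ z - c) l = -2 := by
  have h := (periods τ).order_weierstrassP l hl
  rw [← h]
  have : (fun z => wp τ z - c) = (periods τ).weierstrassP + fun _ => -c := by
    ext z; simp [wp, sub_eq_add_neg]
  rw [this]
  refine meromorphicOrderAt_add_eq_left_of_lt (MeromorphicAt.const _ _) ?_
  rw [h]
  refine lt_of_lt_of_le ?_ analyticAt_const.meromorphicOrderAt_nonneg
  decide

lemma order_wp_sub_const_ne_top (τ : ℍ) (c z : ℂ) :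
    meromorphicOrderAt (fun z => wp τ z - c) z ≠ ⊤ := by
  refine order_ne_top_of_meromorphic ((meromorphic_wp τ).fun_sub (Meromorphic.const c))
    (w := 0) ?_ z
  rw [order_wp_sub_const τ (zero_mem _)]
  decide

lemma eventually_nhds_notMem_lattice (τ : ℍ) {z : ℂ} (hz : z ∉ (periods τ).lattice) :
    ∀ᶠ y in 𝓝 z, y ∉ (periods τ).lattice :=
  (isOpen_compl_lattice τ).mem_nhds hz

lemma eventually_codiscrete_notMem_lattice (τ : ℍ) :
    ∀ᶠ y in codiscrete ℂ, y ∉ (periods τ).lattice := by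
  rw [eventually_codiscrete_iff]
  intro w
  rw [eventually_nhdsWithin_iff]
  filter_upwards [(periods τ).compl_lattice_sdiff_singleton_mem_nhds w] with y hy hyw hyl
  exact hy ⟨hyl, hyw⟩

/-- Near the origin `℘(z) = 1/z² + R(z)` with `R` analytic. -/
lemma exists_wp_eq (τ : ℍ) : ∃ R : ℂ → ℂ, AnalyticAt ℂ R 0 ∧ ∀ z, wp τ z = 1 / z ^ 2 + R z := by
  refine ⟨(periods τ).weierstrassPExcept 0, (periods τ).analyticAt_weierstrassPExcept 0,
    fun z => ?_⟩
  have := (periods τ).weierstrassPExcept_add 0 z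
  simp only [ZeroMemClass.coe_zero, sub_zero] at this
  rw [wp, ← this]
  simp
  ring

/-- Differentiate the Weierstrass cubic relation and cancel ℘', which is nonzero off a discrete set;
the remaining points follow by continuity. -/
lemma deriv_deriv_wp (τ : ℍ) {z : ℂ} (hz : z ∉ (periods τ).lattice) :
    deriv (deriv (wp τ)) z = 6 * wp τ z ^ 2 - (periods τ).g₂ / 2 := by
  have hne : ∀ w, meromorphicOrderAt (deriv (wp τ)) w ≠ ⊤ := by
    intro w htop
    have h1 : ∀ᶠ z in 𝓝[≠] w, deriv (wp τ) z = 0 := meromorphicOrderAt_eq_top_iff.mp htop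
    obtain ⟨c, hc⟩ := exists_eventuallyEq_const_of_deriv (meromorphic_wp τ w) h1
    refine order_wp_sub_const_ne_top τ c w (meromorphicOrderAt_eq_top_iff.mpr ?_)
    filter_upwards [hc] with z hz
    rw [hz, sub_self]
  have key : deriv (deriv (wp τ)) =ᶠ[codiscrete ℂ]
      fun z => 6 * wp τ z ^ 2 - (periods τ).g₂ / 2 := by
    filter_upwards [eventually_codiscrete_ne_zero (meromorphic_wp τ).deriv hne,
      eventually_codiscrete_notMem_lattice τ] with z hz0 hz
    have hx := (analyticAt_wp τ hz).differentiableAt.hasDerivAt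
    have hy := (analyticAt_wp τ hz).deriv.differentiableAt.hasDerivAt
    have h1 := hy.fun_pow 2
    have h2 : HasDerivAt (fun z => 4 * wp τ z ^ 3 - (periods τ).g₂ * wp τ z - (periods τ).g₃)
        (4 * (3 * wp τ z ^ 2 * deriv (wp τ) z) - (periods τ).g₂ * deriv (wp τ) z) z := by
      simpa using! (((hx.fun_pow 3).const_mul 4).fun_sub (hx.const_mul (periods τ).g₂)).sub_const
        (periods τ).g₃
    have h3 := h1.unique (h2.congr_of_eventuallyEq
      ((eventually_nhds_notMem_lattice τ hz).mono fun y hy => deriv_wp_sq τ hy))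
    refine mul_left_cancel₀ (mul_ne_zero two_ne_zero hz0) ?_
    push_cast at h3
    linear_combination h3
  refine eq_of_eventuallyEq_nhdsNE (analyticAt_wp τ hz).deriv.deriv.continuousAt ?_
    (nhdsNE_of_codiscrete key z)
  have := (analyticAt_wp τ hz).continuousAt
  fun_prop

lemma meromorphic_zeta (τ : ℍ) : Meromorphic (zeta τ) := by
  intro w
  by_cases hw : w ∈ (periods τ).lattice
  · obtain ⟨η, hη⟩ := exists_zeta_add τ hw
    have h1 : MeromorphicAt (fun z => zetaReg τ (z - w) + 1 / (z - w) + η) w := by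
      have : AnalyticAt ℂ (fun z => zetaReg τ (z - w)) w :=
        AnalyticAt.fun_comp (g := zetaReg τ) (by simpa using analyticAt_zetaReg_zero τ)
          (by fun_prop)
      have := this.meromorphicAt
      fun_prop
    refine h1.congr ?_
    filter_upwards [nhdsNE_of_codiscrete (f := fun z => zeta τ z) (g := fun z => zeta τ z)
      EventuallyEq.rfl w, eventually_codiscrete_iff.mp (eventually_codiscrete_notMem_lattice τ) w]
      with z _ hz
    have := hη (z - w) (fun h => hz (by simpa using add_mem h hw))
    rw [zetaReg_add, ← this]
    simp
  · exact (analyticAt_zeta τ hw).meromorphicAt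

lemma meromorphic_zeta_add (τ : ℍ) (p : ℂ) : Meromorphic (fun z => zeta τ (z + p)) :=
  Meromorphic.meromorphic_fun_comp_add_const_iff_meromorphic.mpr (meromorphic_zeta τ)

lemma meromorphic_zeta_sub (τ : ℍ) (p : ℂ) : Meromorphic (fun z => zeta τ (z - p)) :=
  Meromorphic.meromorphic_fun_comp_sub_const_iff_meromorphic.mpr (meromorphic_zeta τ)

lemma isOpen_compl_singularSet (τ : ℍ) (p : ℂ) : IsOpen (singularSet τ p)ᶜ := by
  have h : (singularSet τ p)ᶜ = ((periods τ).lattice : Set ℂ)ᶜ ∩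
      ((fun z => z - p) ⁻¹' ((periods τ).lattice : Set ℂ)ᶜ ∩
        (fun z => z + p) ⁻¹' ((periods τ).lattice : Set ℂ)ᶜ) := by
    ext z
    simp [singularSet]
  rw [h]
  have := isOpen_compl_lattice τ
  exact this.inter ((this.preimage (by fun_prop)).inter (this.preimage (by fun_prop)))

lemma notMem_singularSet {τ : ℍ} {p z : ℂ} : z ∉ singularSet τ p ↔
    z ∉ (periods τ).lattice ∧ z - p ∉ (periods τ).lattice ∧ z + p ∉ (periods τ).lattice := by
  simp [singularSet]

lemma eventually_nhds_notMem_singularSet {τ : ℍ} {p z : ℂ} (hz : z ∉ singularSet τ p) :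
    ∀ᶠ y in 𝓝 z, y ∉ singularSet τ p :=
  (isOpen_compl_singularSet τ p).mem_nhds hz

lemma eventually_codiscrete_notMem_singularSet (τ : ℍ) (p : ℂ) :
    ∀ᶠ z in codiscrete ℂ, z ∉ singularSet τ p := by
  have h := eventually_codiscrete_notMem_lattice τ
  filter_upwards [h, eventually_codiscrete_add (-p) h, eventually_codiscrete_add p h]
    with z h1 h2 h3
  exact notMem_singularSet.mpr ⟨h1, by simpa [sub_eq_add_neg] using h2, h3⟩

lemma isPeriodic_zeta_sub_sub (τ : ℍ) (p c : ℂ) :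
    IsPeriodic τ (fun z => zeta τ (z - p) - zeta τ (z + p) + c) := by
  intro l hl
  obtain ⟨η, hη⟩ := exists_zeta_add τ hl
  filter_upwards [eventually_codiscrete_notMem_singularSet τ p] with z hz
  obtain ⟨-, h1, h2⟩ := notMem_singularSet.mp hz
  rw [show z + l - p = z - p + l by ring, show z + l + p = z + p + l by ring, hη _ h1, hη _ h2]
  ring

lemma analyticAt_zeta_sub (τ : ℍ) {p z : ℂ} (h : z - p ∉ (periods τ).lattice) :
    AnalyticAt ℂ (fun z => zeta τ (z - p)) z :=
  AnalyticAt.fun_comp (analyticAt_zeta τ h) (by fun_prop)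

lemma analyticAt_zeta_add (τ : ℍ) {p z : ℂ} (h : z + p ∉ (periods τ).lattice) :
    AnalyticAt ℂ (fun z => zeta τ (z + p)) z :=
  AnalyticAt.fun_comp (analyticAt_zeta τ h) (by fun_prop)

lemma notMem_lattice_of_two_mul {τ : ℍ} {p : ℂ} (hp : 2 * p ∉ (periods τ).lattice) :
    p ∉ (periods τ).lattice := fun h => hp (by rw [two_mul]; exact add_mem h h)

lemma neg_notMem_lattice {τ : ℍ} {p : ℂ} (hp : p ∉ (periods τ).lattice) :
    -p ∉ (periods τ).lattice := fun h => hp (by simpa using neg_mem h)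

/-- The addition formula `(℘(z) - ℘(p)) (ζ(z - p) - ζ(z + p) + 2 ζ(p)) = ℘'(p)`. -/
lemma wp_sub_mul_zeta (τ : ℍ) {p z : ℂ} (hp : 2 * p ∉ (periods τ).lattice)
    (hz : z ∉ singularSet τ p) :
    (wp τ z - wp τ p) * (zeta τ (z - p) - zeta τ (z + p) + 2 * zeta τ p) = deriv (wp τ) p := by
  have hp1 := notMem_lattice_of_two_mul hp
  set f : ℂ → ℂ := fun z =>
    (wp τ z - wp τ p) * (zeta τ (z - p) - zeta τ (z + p) + 2 * zeta τ p) with hf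
  have hmer : Meromorphic f := by
    have h1 := meromorphic_wp τ
    have h2 := meromorphic_zeta_add τ p
    have h3 := meromorphic_zeta_sub τ p
    fun_prop
  have hper : IsPeriodic τ f := ((isPeriodic_wp τ).comp (fun x => x - wp τ p)).comp₂
    (isPeriodic_zeta_sub_sub τ p (2 * zeta τ p)) (fun x y => x * y)
  have han : ∀ z, z ∉ singularSet τ p → AnalyticAt ℂ f z := by
    intro z hz
    obtain ⟨h1, h2, h3⟩ := notMem_singularSet.mp hz
    have := analyticAt_wp τ h1
    have := analyticAt_zeta_sub τ h2
    have := analyticAt_zeta_add τ h3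
    fun_prop
  -- At 0 the zeta factor vanishes to second order: its value cancels because ζ is odd, its
  -- derivative because ℘ is even. This absorbs the double pole of ℘.
  have hzero : ∃ g : ℂ → ℂ, AnalyticAt ℂ g 0 ∧ f =ᶠ[𝓝[≠] 0] g := by
    obtain ⟨R, hR, hwp⟩ := exists_wp_eq τ
    have hm : (0 : ℂ) - p ∉ (periods τ).lattice := by simpa using neg_notMem_lattice hp1
    have hm' : (0 : ℂ) + p ∉ (periods τ).lattice := by simpa using hp1
    set Z : ℂ → ℂ := fun z => zeta τ (z - p) - zeta τ (z + p) + 2 * zeta τ p with hZ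
    have hZan : AnalyticAt ℂ Z 0 := by
      have := analyticAt_zeta_sub τ hm
      have := analyticAt_zeta_add τ hm'
      fun_prop
    have hZ0 : Z 0 = 0 := by
      simp only [hZ, zero_sub, zero_add, zeta_neg]
      ring
    have hZ1 : deriv Z 0 = 0 := by
      have h1 := (hasDerivAt_zeta τ hm).comp_sub_const 0 p
      have h2 := (hasDerivAt_zeta τ hm').comp_add_const 0 p
      rw [((h1.fun_sub h2).add_const _).deriv]
      simp [wp_neg]
    obtain ⟨k, hk, hk0, hZk⟩ := exists_eq_add_mul hZan
    obtain ⟨m, hm, -, hkm⟩ := exists_eq_add_mul hk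
    refine ⟨fun z => (1 + z ^ 2 * (R z - wp τ p)) * m z, by fun_prop, ?_⟩
    filter_upwards [self_mem_nhdsWithin] with z hz
    have hz : z ≠ 0 := hz
    change (wp τ z - wp τ p) * Z z = _
    rw [hZk, hkm, hk0, hZ1, hZ0, hwp]
    field_simp
    ring
  -- At p the zero of ℘(z) - ℘(p) absorbs the simple pole 1/(z - p). The resulting value ℘'(p)
  -- identifies the constant.
  have hpp : ∃ g : ℂ → ℂ, AnalyticAt ℂ g p ∧ f =ᶠ[𝓝[≠] p] g ∧ g p = deriv (wp τ) p := by
    obtain ⟨k, hk, hk0, hwk⟩ := exists_eq_add_mul (analyticAt_wp τ hp1)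
    have h1 : AnalyticAt ℂ (fun z => zetaReg τ (z - p)) p :=
      AnalyticAt.fun_comp (g := zetaReg τ) (by simpa using analyticAt_zetaReg_zero τ) (by fun_prop)
    have h2 := analyticAt_zeta_add τ (p := p) (z := p) (by simpa [two_mul] using hp)
    refine ⟨fun z => k z * (1 + (z - p) * (zetaReg τ (z - p) - zeta τ (z + p) + 2 * zeta τ p)),
      by fun_prop, ?_, by simp [hk0]⟩
    filter_upwards [self_mem_nhdsWithin] with z hz
    have hz : z - p ≠ 0 := sub_ne_zero.mpr hz
    simp only [hf]
    rw [← zetaReg_add τ (z - p), hwk]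
    field_simp
    ring
  have hpm : ∃ g : ℂ → ℂ, AnalyticAt ℂ g (-p) ∧ f =ᶠ[𝓝[≠] (-p)] g := by
    obtain ⟨k, hk, hk0, hwk⟩ := exists_eq_add_mul (analyticAt_wp τ (neg_notMem_lattice hp1))
    have h1 : AnalyticAt ℂ (fun z => zetaReg τ (z + p)) (-p) :=
      AnalyticAt.fun_comp (g := zetaReg τ) (by simpa using analyticAt_zetaReg_zero τ) (by fun_prop)
    have h2 := analyticAt_zeta_sub τ (p := p) (z := -p) (by
      have := neg_notMem_lattice hp
      rwa [show -p - p = -(2 * p) by ring])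
    refine ⟨fun z => k z * ((z + p) * (zeta τ (z - p) - zetaReg τ (z + p) + 2 * zeta τ p) - 1),
      by fun_prop, ?_⟩
    filter_upwards [self_mem_nhdsWithin] with z hz
    have hz : z + p ≠ 0 := fun h => hz (eq_neg_of_add_eq_zero_left h)
    simp only [hf]
    rw [← zetaReg_add τ (z + p), hwk, wp_neg]
    field_simp
    ring
  have hord : ∀ w, 0 ≤ meromorphicOrderAt f w := by
    intro w
    by_cases hw : w ∈ singularSet τ p
    · rcases hw with hw | hw | hw
      · rw [← zero_add w, hper.order hw]
        exact (hmer 0).meromorphicOrderAt_nonneg_iff.mpr hzero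
      · rw [show w = p + (w - p) by ring, hper.order hw]
        obtain ⟨g, hg, hfg, -⟩ := hpp
        exact (hmer p).meromorphicOrderAt_nonneg_iff.mpr ⟨g, hg, hfg⟩
      · rw [show w = -p + (w + p) by ring, hper.order hw]
        exact (hmer (-p)).meromorphicOrderAt_nonneg_iff.mpr hpm
    · exact (han w hw).meromorphicOrderAt_nonneg
  obtain ⟨c, hc⟩ := exists_const_of_order_nonneg hmer hper hord
  obtain ⟨g, hg, hfg, hgp⟩ := hpp
  have h1 : g p = c := eq_of_eventuallyEq_nhdsNE hg.continuousAt continuousAt_const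
    (hfg.symm.trans (nhdsNE_of_codiscrete hc p))
  have h2 : f z = c := eq_of_eventuallyEq_nhdsNE (han z hz).continuousAt continuousAt_const
    (nhdsNE_of_codiscrete hc z)
  rw [← hgp, h1, ← h2]

/-- If ℘'(p) = 0, the addition formula makes the zeta factor vanish identically near p, although it
has a pole there with residue 1. -/
lemma deriv_wp_ne_zero (τ : ℍ) {p : ℂ} (hp : 2 * p ∉ (periods τ).lattice) :
    deriv (wp τ) p ≠ 0 := by
  intro h0
  have hp1 := notMem_lattice_of_two_mul hp
  have h1 : ∀ᶠ z in 𝓝[≠] p, zeta τ (z - p) - zeta τ (z + p) + 2 * zeta τ p = 0 := by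
    filter_upwards [eventually_codiscrete_iff.mp (eventually_codiscrete_notMem_singularSet τ p) p,
      (meromorphicOrderAt_ne_top_iff_eventually_ne_zero
        ((meromorphic_wp τ).fun_sub (Meromorphic.const (wp τ p)) p)).mp
        (order_wp_sub_const_ne_top τ (wp τ p) p)] with z hz hne
    have := wp_sub_mul_zeta τ hp hz
    rw [h0] at this
    exact (mul_eq_zero.mp this).resolve_left hne
  have h2 : AnalyticAt ℂ (fun z => zetaReg τ (z - p)) p :=
    AnalyticAt.fun_comp (g := zetaReg τ) (by simpa using analyticAt_zetaReg_zero τ) (by fun_prop)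
  have h3 := analyticAt_zeta_add τ (p := p) (z := p) (by simpa [two_mul] using hp)
  have h4 : ((fun z => 1 + (z - p) * (zetaReg τ (z - p) - zeta τ (z + p) + 2 * zeta τ p)) p : ℂ)
      = 0 := by
    refine eq_of_eventuallyEq_nhdsNE (f := fun z => 1 + (z - p) *
      (zetaReg τ (z - p) - zeta τ (z + p) + 2 * zeta τ p)) (g := fun _ => 0) (w := p) ?_
      continuousAt_const ?_
    · have := h2.continuousAt
      have := h3.continuousAt
      fun_prop
    · filter_upwards [h1, self_mem_nhdsWithin] with z hz hzp
      have hzp : z - p ≠ 0 := sub_ne_zero.mpr hzp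
      rw [← zetaReg_add τ (z - p)] at hz
      field_simp at hz
      linear_combination hz
  simp at h4

lemma wp_ne_wp (τ : ℍ) {p z : ℂ} (hp : 2 * p ∉ (periods τ).lattice) (hz : z ∉ singularSet τ p) :
    wp τ z - wp τ p ≠ 0 := fun h => deriv_wp_ne_zero τ hp (by
  rw [← wp_sub_mul_zeta τ hp hz, h, zero_mul])

/-- The addition formula `ζ(z + p) + ζ(z - p) - 2 ζ(z) = ℘'(z) / (℘(z) - ℘(p))`. -/
lemma zeta_add_zeta (τ : ℍ) {p z : ℂ} (hp : 2 * p ∉ (periods τ).lattice)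
    (hz : z ∉ singularSet τ p) :
    zeta τ (z + p) + zeta τ (z - p) - 2 * zeta τ z = deriv (wp τ) z / (wp τ z - wp τ p) := by
  have key : ∀ᶠ z in codiscrete ℂ,
      zeta τ (z + p) + zeta τ (z - p) - 2 * zeta τ z = deriv (wp τ) z / (wp τ z - wp τ p) := by
    -- The previous addition formula is applied with z and p exchanged. This needs 2z outside the
    -- lattice, a generic condition that is removed at the end by continuity.
    have hdouble : ∀ᶠ z in codiscrete ℂ, 2 * z ∉ (periods τ).lattice := by
      rw [eventually_codiscrete_iff]
      intro w
      have : Tendsto (fun z : ℂ => 2 * z) (𝓝[≠] w) (𝓝[≠] (2 * w)) :=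
        tendsto_nhdsWithin_of_tendsto_nhds_of_eventually_within _
          ((continuous_const_mul 2).tendsto w |>.mono_left nhdsWithin_le_nhds)
          (eventually_mem_nhdsWithin.mono fun z hz h => hz (by simpa using h))
      exact this.eventually
        (eventually_codiscrete_iff.mp (eventually_codiscrete_notMem_lattice τ) (2 * w))
    filter_upwards [hdouble, eventually_codiscrete_notMem_singularSet τ p] with z h2z hz
    obtain ⟨h1, h2, h3⟩ := notMem_singularSet.mp hz
    have hz' : p ∉ singularSet τ z := notMem_singularSet.mpr
      ⟨notMem_lattice_of_two_mul hp, fun h => h2 (by simpa using neg_mem h),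
        by rwa [add_comm]⟩
    have h4 := wp_sub_mul_zeta τ h2z hz'
    have h5 := wp_ne_wp τ hp hz
    rw [eq_div_iff h5, ← h4, ← neg_sub z p, zeta_neg, add_comm p z]
    ring
  obtain ⟨h1, h2, h3⟩ := notMem_singularSet.mp hz
  have a1 := analyticAt_wp τ h1
  have a2 := a1.deriv
  have a3 := analyticAt_zeta_sub τ h2
  have a4 := analyticAt_zeta_add τ h3
  have a5 := analyticAt_zeta τ h1
  refine eq_of_eventuallyEq_nhdsNE
    (f := fun z => zeta τ (z + p) + zeta τ (z - p) - 2 * zeta τ z)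
    (g := fun z => deriv (wp τ) z / (wp τ z - wp τ p)) ?_ ?_ (eventually_codiscrete_iff.mp key z)
  · exact AnalyticAt.continuousAt (by fun_prop)
  · exact AnalyticAt.continuousAt (a2.fun_div (by fun_prop) (wp_ne_wp τ hp hz))

lemma zeta_sub_zeta (τ : ℍ) {p z : ℂ} (hp : 2 * p ∉ (periods τ).lattice)
    (hz : z ∉ singularSet τ p) :
    zeta τ (z + p) - zeta τ (z - p) =
      2 * zeta τ p - deriv (wp τ) p / (wp τ z - wp τ p) := by
  have h1 := wp_sub_mul_zeta τ hp hz
  have h2 := wp_ne_wp τ hp hz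
  field_simp
  linear_combination -h1

/-- The addition formula for `℘(z + p) + ℘(z - p)`. -/
lemma wp_add_wp (τ : ℍ) {p z : ℂ} (hp : 2 * p ∉ (periods τ).lattice)
    (hz : z ∉ singularSet τ p) :
    wp τ (z + p) + wp τ (z - p) = 2 * wp τ z -
      (deriv (deriv (wp τ)) z * (wp τ z - wp τ p) - deriv (wp τ) z ^ 2) /
        (wp τ z - wp τ p) ^ 2 := by
  obtain ⟨h1, h2, h3⟩ := notMem_singularSet.mp hz
  have hx := (analyticAt_wp τ h1).differentiableAt.hasDerivAt
  have hy := (analyticAt_wp τ h1).deriv.differentiableAt.hasDerivAt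
  -- The formula is the derivative of `zeta_add_zeta`.
  have hd1 := (((hasDerivAt_zeta τ h3).comp_add_const z p).fun_add
    ((hasDerivAt_zeta τ h2).comp_sub_const z p)).fun_sub ((hasDerivAt_zeta τ h1).const_mul 2)
  have hd2 := hy.fun_div (hx.sub_const (wp τ p)) (wp_ne_wp τ hp hz)
  have := hd1.unique (hd2.congr_of_eventuallyEq
    ((eventually_nhds_notMem_singularSet hz).mono
      fun y hy => zeta_add_zeta τ hp hy))
  rw [show deriv (wp τ) z ^ 2 = deriv (wp τ) z * deriv (wp τ) z by ring, ← this]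
  ring

/-! ### The values at the half periods -/

lemma deriv_wp_half (τ : ℍ) {h : ℂ} (h2 : 2 * h ∈ (periods τ).lattice) :
    deriv (wp τ) h = 0 := by
  have h1 := deriv_wp_add τ (-h) h2
  rw [show -h + 2 * h = h by ring, deriv_wp_neg] at h1
  exact CharZero.eq_neg_self_iff.mp h1

lemma exists_wp_sub_eq_sq_mul (τ : ℍ) {h : ℂ} (h1 : h ∉ (periods τ).lattice)
    (h2 : 2 * h ∈ (periods τ).lattice) :
    ∃ m : ℂ → ℂ, AnalyticAt ℂ m h ∧ ∀ z, wp τ z - wp τ h = (z - h) ^ 2 * m z := by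
  obtain ⟨k, hk, hk0, hwk⟩ := exists_eq_add_mul (analyticAt_wp τ h1)
  obtain ⟨m, hm, -, hkm⟩ := exists_eq_add_mul hk
  refine ⟨m, hm, fun z => ?_⟩
  rw [hwk, hkm, hk0, deriv_wp_half τ h2]
  ring

/-- Put e = ℘(h). In (℘(z) - e)(℘(z - h) - e) each double pole meets a double zero of the other
factor, because ℘' vanishes at half periods. The product is therefore a nonzero constant, yet it
would vanish at h' if ℘(h') = e. -/
lemma wp_half_ne (τ : ℍ) {h h' : ℂ} (h1 : h ∉ (periods τ).lattice)
    (h2 : 2 * h ∈ (periods τ).lattice) (h3 : h' ∉ (periods τ).lattice)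
    (h4 : h' - h ∉ (periods τ).lattice) : wp τ h' ≠ wp τ h := by
  set e := wp τ h with he
  set f : ℂ → ℂ := fun z => (wp τ z - e) * (wp τ (z - h) - e) with hf
  have hmsub : Meromorphic (fun z => wp τ (z - h)) :=
    Meromorphic.meromorphic_fun_comp_sub_const_iff_meromorphic.mpr (meromorphic_wp τ)
  have hmer : Meromorphic f := by
    have h1 := meromorphic_wp τ
    fun_prop
  have hper : IsPeriodic τ f := fun l hl => Eventually.of_forall fun z => by
    simp only [hf]
    rw [wp_add τ z hl, show z + l - h = z - h + l by ring, wp_add τ _ hl]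
  have han : ∀ z, z ∉ (periods τ).lattice → z - h ∉ (periods τ).lattice → AnalyticAt ℂ f z := by
    intro z hz hzh
    have a1 := analyticAt_wp τ hz
    have a2 : AnalyticAt ℂ (fun z => wp τ (z - h)) z :=
      AnalyticAt.fun_comp (analyticAt_wp τ hzh) (by fun_prop)
    fun_prop
  obtain ⟨R, hR, hwR⟩ := exists_wp_eq τ
  obtain ⟨m, hm, hwm⟩ := exists_wp_sub_eq_sq_mul τ h1 h2
  obtain ⟨m', hm', hwm'⟩ := exists_wp_sub_eq_sq_mul τ (neg_notMem_lattice h1)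
    (by rw [mul_neg]; exact neg_mem h2)
  have hord : ∀ w, 0 ≤ meromorphicOrderAt f w := by
    intro w
    by_cases hw : w ∈ (periods τ).lattice
    · rw [← zero_add w, hper.order hw]
      refine (hmer 0).meromorphicOrderAt_nonneg_iff.mpr
        ⟨fun z => (1 + z ^ 2 * (R z - e)) * m' (z - h), ?_, ?_⟩
      · refine AnalyticAt.fun_mul (by fun_prop) ?_
        exact AnalyticAt.fun_comp (g := m') (by simpa using hm') (by fun_prop)
      · filter_upwards [self_mem_nhdsWithin] with z hz
        have hz : z ≠ 0 := hz
        have := hwm' (z - h)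
        rw [wp_neg, ← he] at this
        simp only [hf, this, hwR z]
        field_simp
        ring
    · by_cases hwh : w - h ∈ (periods τ).lattice
      · rw [show w = h + (w - h) by ring, hper.order hwh]
        refine (hmer h).meromorphicOrderAt_nonneg_iff.mpr
          ⟨fun z => m z * (1 + (z - h) ^ 2 * (R (z - h) - e)), ?_, ?_⟩
        · have : AnalyticAt ℂ (fun z => R (z - h)) h :=
            AnalyticAt.fun_comp (g := R) (by simpa using hR) (by fun_prop)
          exact hm.fun_mul (analyticAt_const.fun_add
            (AnalyticAt.fun_mul (by fun_prop) (this.fun_sub analyticAt_const)))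
        · filter_upwards [self_mem_nhdsWithin] with z hz
          have hz : z - h ≠ 0 := sub_ne_zero.mpr hz
          have h0 := hwm z
          rw [← he] at h0
          simp only [hf, h0, hwR (z - h)]
          field_simp
          ring
      · exact (han w hw hwh).meromorphicOrderAt_nonneg
  obtain ⟨c, hc⟩ := exists_const_of_order_nonneg hmer hper hord
  have hc0 : c ≠ 0 := by
    rintro rfl
    have h5 := eventually_codiscrete_ne_zero ((meromorphic_wp τ).fun_sub (Meromorphic.const e))
      (order_wp_sub_const_ne_top τ e)
    have h6 := eventually_codiscrete_add (-h) h5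
    obtain ⟨z, hz1, hz2, hz3⟩ :=
      ((eventually_codiscrete_iff.mp (hc.and (h5.and h6)) 0)).exists
    exact mul_ne_zero hz2 (by simpa [sub_eq_add_neg] using hz3) hz1
  have h5 : f h' = c := eq_of_eventuallyEq_nhdsNE (han h' h3 h4).continuousAt continuousAt_const
    (nhdsNE_of_codiscrete hc h')
  intro h6
  apply hc0
  rw [← h5]
  simp [hf, h6]

lemma one_half_notMem (τ : ℍ) : (1 / 2 : ℂ) ∉ (periods τ).lattice :=
  (periods τ).ω₁_div_two_notMem_lattice

lemma tau_half_notMem (τ : ℍ) : (τ : ℂ) / 2 ∉ (periods τ).lattice :=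
  (periods τ).ω₂_div_two_notMem_lattice

lemma one_mem (τ : ℍ) : (1 : ℂ) ∈ (periods τ).lattice := (periods τ).ω₁_mem_lattice

lemma tau_mem (τ : ℍ) : (τ : ℂ) ∈ (periods τ).lattice := (periods τ).ω₂_mem_lattice

lemma one_add_tau_half_notMem (τ : ℍ) : (1 + (τ : ℂ)) / 2 ∉ (periods τ).lattice := by
  have := (periods τ).mul_ω₁_add_mul_ω₂_mem_lattice (α := 1 / 2) (β := 1 / 2)
  intro h
  rw [show (1 + (τ : ℂ)) / 2 = ((1 / 2 : ℚ) : ℂ) * (periods τ).ω₁ +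
    ((1 / 2 : ℚ) : ℂ) * (periods τ).ω₂ by simp [periods]; ring, this] at h
  norm_num at h

lemma halfPeriodValue_injective (τ : ℍ) :
    halfPeriodValue τ 0 ≠ halfPeriodValue τ 1 ∧ halfPeriodValue τ 0 ≠ halfPeriodValue τ 2 ∧
      halfPeriodValue τ 1 ≠ halfPeriodValue τ 2 := by
  have m1 : 2 * (1 / 2 : ℂ) ∈ (periods τ).lattice := by
    rw [mul_one_div_cancel two_ne_zero]; exact one_mem τ
  have m2 : 2 * ((τ : ℂ) / 2) ∈ (periods τ).lattice := by
    rw [mul_div_cancel₀ _ two_ne_zero]; exact tau_mem τ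
  simp only [halfPeriodValue, Matrix.cons_val_zero, Matrix.cons_val_one, Matrix.cons_val]
  refine ⟨(wp_half_ne τ (one_half_notMem τ) m1 (tau_half_notMem τ) fun h => ?_).symm,
    (wp_half_ne τ (one_half_notMem τ) m1 (one_add_tau_half_notMem τ) fun h => ?_).symm,
    (wp_half_ne τ (tau_half_notMem τ) m2 (one_add_tau_half_notMem τ) fun h => ?_).symm⟩
  · refine one_add_tau_half_notMem τ ?_
    rw [show (1 + (τ : ℂ)) / 2 = (τ / 2 - 1 / 2) + 1 by ring]
    exact add_mem h (one_mem τ)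
  · exact tau_half_notMem τ (by convert h using 1; ring)
  · exact one_half_notMem τ (by convert h using 1; ring)

lemma wp_half_cubic (τ : ℍ) {h : ℂ} (h1 : h ∉ (periods τ).lattice)
    (h2 : 2 * h ∈ (periods τ).lattice) :
    4 * wp τ h ^ 3 - (periods τ).g₂ * wp τ h - (periods τ).g₃ = 0 := by
  rw [← deriv_wp_sq τ h1, deriv_wp_half τ h2]
  ring

/-- The three half-period values are distinct roots of the Weierstrass cubic. Dividing differences
of the root equations by differences of roots yields Vieta's relations. -/
lemma prod_sub_halfPeriodValue (τ : ℍ) (u : ℂ) :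
    4 * ∏ k : Fin 3, (u - halfPeriodValue τ k) =
      4 * u ^ 3 - (periods τ).g₂ * u - (periods τ).g₃ := by
  obtain ⟨d1, d2, d3⟩ := halfPeriodValue_injective τ
  have c1 := wp_half_cubic τ (one_half_notMem τ)
    (by rw [mul_one_div_cancel two_ne_zero]; exact one_mem τ)
  have c2 := wp_half_cubic τ (tau_half_notMem τ)
    (by rw [mul_div_cancel₀ _ two_ne_zero]; exact tau_mem τ)
  have c3 := wp_half_cubic τ (one_add_tau_half_notMem τ)
    (by rw [mul_div_cancel₀ _ two_ne_zero]; exact add_mem (one_mem τ) (tau_mem τ))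
  rw [Fin.prod_univ_three]
  simp only [halfPeriodValue, Matrix.cons_val_zero, Matrix.cons_val_one, Matrix.cons_val] at *
  generalize wp τ (1 / 2) = e1 at *
  generalize wp τ (τ / 2) = e2 at *
  generalize wp τ ((1 + τ) / 2) = e3 at *
  generalize (periods τ).g₂ = g at *
  generalize (periods τ).g₃ = g' at *
  have h1 : 4 * (e1 ^ 2 + e1 * e2 + e2 ^ 2) = g :=
    mul_left_cancel₀ (sub_ne_zero.mpr d1) (by linear_combination c1 - c2)
  have h2 : 4 * (e1 ^ 2 + e1 * e3 + e3 ^ 2) = g :=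
    mul_left_cancel₀ (sub_ne_zero.mpr d2) (by linear_combination c1 - c3)
  have h3 : e1 + e2 + e3 = 0 :=
    mul_left_cancel₀ (sub_ne_zero.mpr d3) (by linear_combination (h1 - h2) / 4)
  obtain rfl : e3 = -e1 - e2 := by linear_combination h3
  subst h1
  linear_combination -c1

/-! ### The equation in algebraic coordinates -/

/-- The function `℘(z) - ℘(p)`. -/
def algX (τ : ℍ) (p z : ℂ) : ℂ := wp τ z - wp τ p

/-- The function `℘'(z) / (℘(z) - ℘(p))`. -/
def algY (τ : ℍ) (p z : ℂ) : ℂ := deriv (wp τ) z / algX τ p z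

lemma algX_ne_zero {τ : ℍ} {p z : ℂ} (hp : 2 * p ∉ (periods τ).lattice)
    (hz : z ∉ singularSet τ p) : algX τ p z ≠ 0 := wp_ne_wp τ hp hz

/-- This is the Weierstrass cubic, Taylor expanded at ℘(p) and divided by X². -/
lemma algY_sq {τ : ℍ} {p z : ℂ} (hp : 2 * p ∉ (periods τ).lattice)
    (hz : z ∉ singularSet τ p) :
    algY τ p z ^ 2 = 4 * algX τ p z + 12 * wp τ p + 2 * deriv (deriv (wp τ)) p / algX τ p z +
      deriv (wp τ) p ^ 2 / algX τ p z ^ 2 := by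
  have hX := algX_ne_zero hp hz
  have h1 := deriv_wp_sq τ (notMem_singularSet.mp hz).1
  have h2 := deriv_wp_sq τ (notMem_lattice_of_two_mul hp)
  have h3 := deriv_deriv_wp τ (notMem_lattice_of_two_mul hp)
  have hx : wp τ z = algX τ p z + wp τ p := by simp [algX]
  rw [algY, div_pow, h1, h2, h3, hx]
  field_simp
  ring

lemma hasDerivAt_algX {τ : ℍ} {p z : ℂ} (hp : 2 * p ∉ (periods τ).lattice)
    (hz : z ∉ singularSet τ p) :
    HasDerivAt (algX τ p) (algX τ p z * algY τ p z) z := by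
  have hx := (analyticAt_wp τ (notMem_singularSet.mp hz).1).differentiableAt.hasDerivAt
  refine (hx.sub_const (wp τ p)).congr_deriv ?_
  rw [algY, mul_div_cancel₀ _ (algX_ne_zero hp hz)]

lemma deriv_algY_eq {τ : ℍ} {p z : ℂ} (hp : 2 * p ∉ (periods τ).lattice)
    (hz : z ∉ singularSet τ p) :
    (deriv (deriv (wp τ)) z * algX τ p z - deriv (wp τ) z ^ 2) / algX τ p z ^ 2 =
      2 * algX τ p z - deriv (deriv (wp τ)) p / algX τ p z -
        deriv (wp τ) p ^ 2 / algX τ p z ^ 2 := by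
  have hX := algX_ne_zero hp hz
  have h1 := deriv_wp_sq τ (notMem_singularSet.mp hz).1
  have h2 := deriv_wp_sq τ (notMem_lattice_of_two_mul hp)
  have h3 := deriv_deriv_wp τ (notMem_lattice_of_two_mul hp)
  have h4 := deriv_deriv_wp τ (notMem_singularSet.mp hz).1
  have hx : wp τ z = algX τ p z + wp τ p := by simp [algX]
  rw [h1, h2, h3, h4, hx]
  field_simp
  ring

lemma hasDerivAt_algY {τ : ℍ} {p z : ℂ} (hp : 2 * p ∉ (periods τ).lattice)
    (hz : z ∉ singularSet τ p) :
    HasDerivAt (algY τ p) (2 * algX τ p z - deriv (deriv (wp τ)) p / algX τ p z -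
        deriv (wp τ) p ^ 2 / algX τ p z ^ 2) z := by
  have hX := algX_ne_zero hp hz
  have hx := (analyticAt_wp τ (notMem_singularSet.mp hz).1).differentiableAt.hasDerivAt
  have hy := (analyticAt_wp τ (notMem_singularSet.mp hz).1).deriv.differentiableAt.hasDerivAt
  refine (hy.fun_div (hx.sub_const (wp τ p)) hX).congr_deriv ?_
  rw [← deriv_algY_eq hp hz]
  simp only [algX]
  ring

/-- The constant in Φ_e is tuned so that ζ(p) cancels and ℘(z) - ℘(p) combines to X. -/
lemma Phi_eq {τ : ℍ} {p z : ℂ} (hp : 2 * p ∉ (periods τ).lattice) (T : ℂ)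
    (hz : z ∉ singularSet τ p) :
    Phi τ p T z = algX τ p z + deriv (deriv (wp τ)) p / 2 / algX τ p z + 2 * T ^ 2 -
      T * algY τ p z := by
  have hb := deriv_wp_ne_zero τ hp
  have hX := algX_ne_zero hp hz
  rw [Phi, zeta_add_zeta τ hp hz, zeta_sub_zeta τ hp hz, algY, wpRatio]
  simp only [algX] at *
  field_simp
  ring

/-- Since ℘(z + p) + ℘(z - p) = 2℘(z) - Y', the derivative of Y supplies the terms in 1/X and 1/X².
The accessory parameter B cancels ζ(p). -/
lemma potential_eq {τ : ℍ} {p z : ℂ} (hp : 2 * p ∉ (periods τ).lattice) (T : ℂ)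
    (hz : z ∉ singularSet τ p) :
    potential τ p T z = 2 * algX τ p z + 3 * wp τ p + deriv (deriv (wp τ)) p / algX τ p z +
      3 / 4 * deriv (wp τ) p ^ 2 / algX τ p z ^ 2 + T * algY τ p z + T ^ 2 := by
  have hb := deriv_wp_ne_zero τ hp
  have hX := algX_ne_zero hp hz
  have h1 := deriv_algY_eq hp hz
  have hx : wp τ z = algX τ p z + wp τ p := by simp [algX]
  rw [potential, zeta_add_zeta τ hp hz, zeta_sub_zeta τ hp hz, wp_add_wp τ hp hz]
  change 2 * wp τ z + 3 / 4 * (2 * wp τ z - (deriv (deriv (wp τ)) z * algX τ p z -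
    deriv (wp τ) z ^ 2) / algX τ p z ^ 2) + T * algY τ p z - wpRatio τ p / 4 *
    (2 * zeta τ p - deriv (wp τ) p / algX τ p z) + paramB τ p T = _
  rw [h1, hx, wpRatio, paramB, wpRatio]
  field_simp
  ring

lemma hasDerivAt_Phi {τ : ℍ} {p z : ℂ} (hp : 2 * p ∉ (periods τ).lattice) (T : ℂ)
    (hz : z ∉ singularSet τ p) :
    HasDerivAt (Phi τ p T) ((algX τ p z - deriv (deriv (wp τ)) p / 2 / algX τ p z) * algY τ p z -
      T * (2 * algX τ p z - deriv (deriv (wp τ)) p / algX τ p z -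
        deriv (wp τ) p ^ 2 / algX τ p z ^ 2)) z := by
  have hX := algX_ne_zero hp hz
  have h1 := hasDerivAt_algX hp hz
  have h2 := hasDerivAt_algY hp hz
  have h3 := (((h1.fun_add ((h1.fun_inv hX).const_mul (deriv (deriv (wp τ)) p / 2))).add_const
    (2 * T ^ 2)).fun_sub (h2.const_mul T))
  refine (h3.congr_of_eventuallyEq ?_).congr_deriv ?_
  · filter_upwards [eventually_nhds_notMem_singularSet hz] with y hy
    rw [Phi_eq hp T hy]
    rfl
  · field_simp
    ring

lemma deriv_deriv_Phi {τ : ℍ} {p z : ℂ} (hp : 2 * p ∉ (periods τ).lattice) (T : ℂ)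
    (hz : z ∉ singularSet τ p) :
    deriv (deriv (Phi τ p T)) z =
      (algX τ p z + deriv (deriv (wp τ)) p / 2 / algX τ p z) * algY τ p z ^ 2 +
      (algX τ p z - deriv (deriv (wp τ)) p / 2 / algX τ p z) *
        (2 * algX τ p z - deriv (deriv (wp τ)) p / algX τ p z -
          deriv (wp τ) p ^ 2 / algX τ p z ^ 2) -
      T * (2 * algX τ p z + deriv (deriv (wp τ)) p / algX τ p z +
        2 * deriv (wp τ) p ^ 2 / algX τ p z ^ 2) * algY τ p z := by
  have hX := algX_ne_zero hp hz
  have h1 := hasDerivAt_algX hp hz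
  have h2 := hasDerivAt_algY hp hz
  have h4 := h1.fun_inv hX
  have h5 := (((h1.fun_sub (h4.const_mul (deriv (deriv (wp τ)) p / 2))).fun_mul h2).fun_sub
    ((((h1.const_mul 2).fun_sub (h4.const_mul (deriv (deriv (wp τ)) p))).fun_sub
      ((h4.fun_pow 2).const_mul (deriv (wp τ) p ^ 2))).const_mul T))
  refine ((h5.congr_of_eventuallyEq ?_).congr_deriv ?_).deriv
  · filter_upwards [eventually_nhds_notMem_singularSet hz] with y hy
    rw [(hasDerivAt_Phi hp T hy).deriv]
    simp only [inv_pow, div_eq_mul_inv]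
  · push_cast
    field_simp
    ring

/-- The spectral polynomial as a differential expression in `Φ_e`. -/
lemma Phi_spectral {τ : ℍ} {p z : ℂ} (hp : 2 * p ∉ (periods τ).lattice) (T : ℂ)
    (hz : z ∉ singularSet τ p) :
    1 / 2 * Phi τ p T z * deriv (deriv (Phi τ p T)) z - 1 / 4 * deriv (Phi τ p T) z ^ 2
      - potential τ p T z * Phi τ p T z ^ 2 = spectralQ τ p T := by
  have hX := algX_ne_zero hp hz
  have hY := algY_sq hp hz
  -- Q(T) is minus the Weierstrass cubic at T² - 2℘(p) = ℘(p) + (T² - 3℘(p)), expanded about ℘(p).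
  have hQ : spectralQ τ p T = -(4 * (T ^ 2 - 3 * wp τ p) ^ 3 +
      12 * wp τ p * (T ^ 2 - 3 * wp τ p) ^ 2 +
      2 * deriv (deriv (wp τ)) p * (T ^ 2 - 3 * wp τ p) + deriv (wp τ) p ^ 2) := by
    have h1 := prod_sub_halfPeriodValue τ (T ^ 2 - 2 * wp τ p)
    have h2 := deriv_wp_sq τ (notMem_lattice_of_two_mul hp)
    have h3 := deriv_deriv_wp τ (notMem_lattice_of_two_mul hp)
    rw [spectralQ, h2, h3]
    linear_combination -h1
  rw [deriv_deriv_Phi hp T hz, (hasDerivAt_Phi hp T hz).deriv, Phi_eq hp T hz,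
    potential_eq hp T hz, hQ]
  generalize algX τ p z = X at *
  generalize algY τ p z = Y at *
  generalize deriv (deriv (wp τ)) p = B at *
  generalize deriv (wp τ) p = b at *
  generalize wp τ p = a at *
  -- R stands for Y² as a function of X. With even powers of Y traded for R, the left side is linear
  -- in Y and becomes a rational identity once R is eliminated; afterwards R is set to Y².
  have key : ∀ R : ℂ, R = 4 * X + 12 * a + 2 * B / X + b ^ 2 / X ^ 2 →
      1 / 2 * (X + B / 2 / X + 2 * T ^ 2 - T * Y) *
        ((X + B / 2 / X) * R + (X - B / 2 / X) * (2 * X - B / X - b ^ 2 / X ^ 2) -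
          T * (2 * X + B / X + 2 * b ^ 2 / X ^ 2) * Y) -
      1 / 4 * ((X - B / 2 / X) ^ 2 * R - 2 * (X - B / 2 / X) * Y *
        (T * (2 * X - B / X - b ^ 2 / X ^ 2)) + (T * (2 * X - B / X - b ^ 2 / X ^ 2)) ^ 2) -
      ((2 * X + 3 * a + B / X + 3 / 4 * b ^ 2 / X ^ 2 + T ^ 2) *
        ((X + B / 2 / X + 2 * T ^ 2) ^ 2 - 2 * (X + B / 2 / X + 2 * T ^ 2) * T * Y + T ^ 2 * R)
        + T * ((X + B / 2 / X + 2 * T ^ 2) ^ 2 * Y -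
          2 * (X + B / 2 / X + 2 * T ^ 2) * T * R + T ^ 2 * R * Y)) -
      1 / 2 * T ^ 2 * (2 * X + B / X + 2 * b ^ 2 / X ^ 2) * (Y ^ 2 - R) = 
      -(4 * (T ^ 2 - 3 * a) ^ 3 + 12 * a * (T ^ 2 - 3 * a) ^ 2 + 2 * B * (T ^ 2 - 3 * a) +
        b ^ 2) := by
    rintro R rfl
    field_simp
    ring
  linear_combination key (Y ^ 2) hY

/-! ### Local analysis of the second symmetric product -/

/-- If `f = (z - w)^n g`, then `f' = (z - w)^(n-1) (factorDeriv w n g)`. -/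
def factorDeriv (w : ℂ) (n : ℤ) (g : ℂ → ℂ) (z : ℂ) : ℂ := n * g z + (z - w) * deriv g z

lemma analyticAt_factorDeriv {w : ℂ} (n : ℤ) {g : ℂ → ℂ} (hg : AnalyticAt ℂ g w) :
    AnalyticAt ℂ (factorDeriv w n g) w := by
  have := hg.deriv
  unfold factorDeriv
  fun_prop

@[simp] lemma factorDeriv_self (w : ℂ) (n : ℤ) (g : ℂ → ℂ) :
    factorDeriv w n g w = n * g w := by simp [factorDeriv]

lemma deriv_zpow_mul {f g : ℂ → ℂ} {w : ℂ} {n : ℤ} (hg : AnalyticAt ℂ g w)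
    (h : f =ᶠ[𝓝[≠] w] fun z => (z - w) ^ n * g z) :
    deriv f =ᶠ[𝓝[≠] w] fun z => (z - w) ^ (n - 1) * factorDeriv w n g z := by
  filter_upwards [h.nhdsNE_deriv, self_mem_nhdsWithin,
    hg.eventually_analyticAt.filter_mono nhdsWithin_le_nhds] with z hz hne hgz
  have hne : z - w ≠ 0 := sub_ne_zero.mpr hne
  have h1 := ((hasDerivAt_zpow n (z - w) (Or.inl hne)).comp_sub_const z w).fun_mul
    hgz.differentiableAt.hasDerivAt
  rw [hz, h1.deriv, factorDeriv, zpow_sub_one₀ hne]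
  field_simp

/-- Exponents of elliptic solutions of the second symmetric product equation at a point where
the potential is `h / (z - w)²`. -/
lemma indicial_equation {Ψ q g h : ℂ → ℂ} {w : ℂ} {n : ℤ} (hg : AnalyticAt ℂ g w)
    (hg0 : g w ≠ 0) (hΨ : Ψ =ᶠ[𝓝[≠] w] fun z => (z - w) ^ n * g z) (hh : AnalyticAt ℂ h w)
    (hq : q =ᶠ[𝓝[≠] w] fun z => (z - w) ^ (-2 : ℤ) * h z)
    (hode : ∀ᶠ z in 𝓝[≠] w,
      deriv (deriv (deriv Ψ)) z - 4 * q z * deriv Ψ z - 2 * deriv q z * Ψ z = 0) :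
    ((n : ℂ) - 1) * (n ^ 2 - 2 * n - 4 * h w) = 0 := by
  have a1 := analyticAt_factorDeriv n hg
  have a2 := analyticAt_factorDeriv (n - 1) a1
  have a3 := analyticAt_factorDeriv (n - 1 - 1) a2
  have d1 := deriv_zpow_mul hg hΨ
  have d2 := deriv_zpow_mul a1 d1
  have d3 := deriv_zpow_mul a2 d2
  have b1 := analyticAt_factorDeriv (-2) hh
  have e1 := deriv_zpow_mul hh hq
  set g1 := factorDeriv w n g with hg1
  set g2 := factorDeriv w (n - 1) g1 with hg2
  set g3 := factorDeriv w (n - 1 - 1) g2 with hg3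
  set h1 := factorDeriv w (-2) h with hh1
  -- Every term of the equation carries the factor (z - w)^(n - 3). Dividing by it and evaluating at
  -- w leaves the indicial polynomial times g(w).
  have key : (fun z => g3 z - 4 * h z * g1 z - 2 * h1 z * g z) =ᶠ[𝓝[≠] w] fun _ => 0 := by
    filter_upwards [hΨ, d1, d3, hq, e1, hode, self_mem_nhdsWithin] with z k0 k1 k3 l0 l1 ho hne
    have hne : z - w ≠ 0 := sub_ne_zero.mpr hne
    rw [k0, k1, k3, l0, l1] at ho
    have hz : (z - w) ^ (n - 3) ≠ 0 := zpow_ne_zero _ hne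
    refine mul_left_cancel₀ hz ?_
    rw [mul_zero, ← ho]
    have m1 : (z - w) ^ (n - 3) = (z - w) ^ (n - 1 - 1 - 1) := by congr 1; ring
    have m2 : (z - w) ^ (n - 3) = (z - w) ^ (-2 : ℤ) * (z - w) ^ (n - 1) := by
      rw [← zpow_add₀ hne]; congr 1; ring
    have m3 : (z - w) ^ (n - 3) = (z - w) ^ (-2 - 1 : ℤ) * (z - w) ^ n := by
      rw [← zpow_add₀ hne]; congr 1; ring
    linear_combination g3 z * m1 - 4 * h z * g1 z * m2 - 2 * h1 z * g z * m3
  have h0 := eq_of_eventuallyEq_nhdsNE (f := fun z => g3 z - 4 * h z * g1 z - 2 * h1 z * g z)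
    (AnalyticAt.continuousAt (by fun_prop)) continuousAt_const key
  simp only [hg3, hg2, hg1, hh1, factorDeriv_self] at h0
  push_cast at h0
  refine mul_left_cancel₀ hg0 ?_
  linear_combination h0

/-- The leading factor of `½ Φ Φ'' - ¼ Φ'² - q Φ²` for `Φ = (z - w)^n g`, `q = h / (z - w)²`. -/
def spectralFactor (w : ℂ) (n : ℤ) (g h : ℂ → ℂ) (z : ℂ) : ℂ :=
  1 / 2 * g z * factorDeriv w (n - 1) (factorDeriv w n g) z - 1 / 4 * factorDeriv w n g z ^ 2
    - h z * g z ^ 2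

lemma analyticAt_spectralFactor {w : ℂ} (n : ℤ) {g h : ℂ → ℂ} (hg : AnalyticAt ℂ g w)
    (hh : AnalyticAt ℂ h w) : AnalyticAt ℂ (spectralFactor w n g h) w := by
  have a1 := analyticAt_factorDeriv n hg
  have a2 := analyticAt_factorDeriv (n - 1) a1
  unfold spectralFactor
  fun_prop

lemma spectralFactor_self (w : ℂ) (n : ℤ) (g h : ℂ → ℂ) :
    spectralFactor w n g h w = g w ^ 2 * ((n : ℂ) ^ 2 / 4 - n / 2 - h w) := by
  simp only [spectralFactor, factorDeriv_self]
  push_cast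
  ring

lemma spectralFactor_eq {Φ q g h : ℂ → ℂ} {w Q : ℂ} {n : ℤ} (hg : AnalyticAt ℂ g w)
    (hΦ : Φ =ᶠ[𝓝[≠] w] fun z => (z - w) ^ n * g z)
    (hq : q =ᶠ[𝓝[≠] w] fun z => (z - w) ^ (-2 : ℤ) * h z)
    (hspec : ∀ᶠ z in 𝓝[≠] w,
      1 / 2 * Φ z * deriv (deriv Φ) z - 1 / 4 * deriv Φ z ^ 2 - q z * Φ z ^ 2 = Q) :
    ∀ᶠ z in 𝓝[≠] w, (z - w) ^ (2 * n - 2) * spectralFactor w n g h z = Q := by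
  have d1 := deriv_zpow_mul hg hΦ
  have d2 := deriv_zpow_mul (analyticAt_factorDeriv n hg) d1
  filter_upwards [hΦ, d1, d2, hq, hspec, self_mem_nhdsWithin] with z k0 k1 k2 l0 ho hne
  have hne : z - w ≠ 0 := sub_ne_zero.mpr hne
  rw [k0, k1, k2, l0] at ho
  rw [← ho, spectralFactor]
  have m1 : (z - w) ^ (2 * n - 2) = (z - w) ^ n * (z - w) ^ (n - 1 - 1) := by
    rw [← zpow_add₀ hne]; congr 1; ring
  have m2 : (z - w) ^ (2 * n - 2) = ((z - w) ^ (n - 1)) ^ 2 := by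
    rw [sq, ← zpow_add₀ hne]; congr 1; ring
  have m3 : (z - w) ^ (2 * n - 2) = (z - w) ^ (-2 : ℤ) * ((z - w) ^ n) ^ 2 := by
    rw [sq, ← zpow_add₀ hne, ← zpow_add₀ hne]; congr 1; ring
  linear_combination 1 / 2 * g z * factorDeriv w (n - 1) (factorDeriv w n g) z * m1
    - 1 / 4 * factorDeriv w n g z ^ 2 * m2 - h z * g z ^ 2 * m3

/-! ### Orders of Φ and residues of 1/Φ from the quadratic first integral -/

section Spectral

variable {Φ q g h : ℂ → ℂ} {w Q : ℂ} {n : ℤ}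

/-- The first integral vanishes at w to order at least 2n - 2 > 0, and it is the constant Q. -/
lemma spectral_eq_zero_of_two_le (hg : AnalyticAt ℂ g w)
    (hΦ : Φ =ᶠ[𝓝[≠] w] fun z => (z - w) ^ n * g z) (hh : AnalyticAt ℂ h w)
    (hq : q =ᶠ[𝓝[≠] w] fun z => (z - w) ^ (-2 : ℤ) * h z)
    (hspec : ∀ᶠ z in 𝓝[≠] w,
      1 / 2 * Φ z * deriv (deriv Φ) z - 1 / 4 * deriv Φ z ^ 2 - q z * Φ z ^ 2 = Q)
    (hn : 2 ≤ n) : Q = 0 := by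
  have h1 := spectralFactor_eq hg hΦ hq hspec
  -- The exponent is written as k + 1 to record that it is positive, so that the power vanishes at
  -- w.
  obtain ⟨k, hk⟩ : ∃ k : ℕ, 2 * n - 2 = (k + 1 : ℕ) :=
    ⟨(2 * n - 3).toNat, by omega⟩
  have h2 := analyticAt_spectralFactor n hg hh
  have h3 := eq_of_eventuallyEq_nhdsNE (w := w)
    (f := fun z => (z - w) ^ (k + 1) * spectralFactor w n g h z)
    (g := fun _ => Q) (AnalyticAt.continuousAt (𝕜 := ℂ) (by fun_prop)) continuousAt_const (by
      filter_upwards [h1] with z hz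
      rw [← hz, hk, zpow_natCast])
  simpa using h3.symm

/-- For n = 1 the exponent 2n - 2 is 0, so Q is the leading coefficient itself. -/
lemma spectral_eq_of_order_one (hg : AnalyticAt ℂ g w)
    (hΦ : Φ =ᶠ[𝓝[≠] w] fun z => (z - w) ^ (1 : ℤ) * g z) (hh : AnalyticAt ℂ h w)
    (hq : q =ᶠ[𝓝[≠] w] fun z => (z - w) ^ (-2 : ℤ) * h z)
    (hspec : ∀ᶠ z in 𝓝[≠] w,
      1 / 2 * Φ z * deriv (deriv Φ) z - 1 / 4 * deriv Φ z ^ 2 - q z * Φ z ^ 2 = Q) :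
    Q = -g w ^ 2 * (1 / 4 + h w) := by
  have h1 := spectralFactor_eq hg hΦ hq hspec
  have h2 := analyticAt_spectralFactor 1 hg hh
  have h3 := eq_of_eventuallyEq_nhdsNE (w := w) (g := fun _ => Q) h2.continuousAt
    continuousAt_const (by
      filter_upwards [h1] with z hz
      simpa using hz)
  rw [← h3, spectralFactor_self]
  push_cast
  ring

lemma spectralFactor_eq_zero (hg : AnalyticAt ℂ g w)
    (hΦ : Φ =ᶠ[𝓝[≠] w] fun z => (z - w) ^ n * g z) (hh : AnalyticAt ℂ h w)
    (hq : q =ᶠ[𝓝[≠] w] fun z => (z - w) ^ (-2 : ℤ) * h z)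
    (hspec : ∀ᶠ z in 𝓝[≠] w,
      1 / 2 * Φ z * deriv (deriv Φ) z - 1 / 4 * deriv Φ z ^ 2 - q z * Φ z ^ 2 = 0) :
    spectralFactor w n g h =ᶠ[𝓝 w] fun _ => 0 := by
  have h2 := analyticAt_spectralFactor n hg hh
  refine eventuallyEq_nhds_of_nhdsNE h2.continuousAt continuousAt_const ?_
  filter_upwards [spectralFactor_eq hg hΦ hq hspec, self_mem_nhdsWithin] with z hz hne
  exact (mul_eq_zero.mp hz).resolve_left (zpow_ne_zero _ (sub_ne_zero.mpr hne))

/-- When Q = 0 the leading coefficient must vanish, which leaves only two possible orders for Φ. -/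
lemma order_eq_of_spectral_zero (hg : AnalyticAt ℂ g w) (hg0 : g w ≠ 0)
    (hΦ : Φ =ᶠ[𝓝[≠] w] fun z => (z - w) ^ n * g z) (hh : AnalyticAt ℂ h w)
    (hq : q =ᶠ[𝓝[≠] w] fun z => (z - w) ^ (-2 : ℤ) * h z)
    (hspec : ∀ᶠ z in 𝓝[≠] w,
      1 / 2 * Φ z * deriv (deriv Φ) z - 1 / 4 * deriv Φ z ^ 2 - q z * Φ z ^ 2 = 0) :
    (n : ℂ) ^ 2 / 4 - n / 2 = h w := by
  have h1 := (spectralFactor_eq_zero hg hΦ hh hq hspec).eq_of_nhds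
  rw [spectralFactor_self] at h1
  have := (mul_eq_zero.mp h1).resolve_left (pow_ne_zero 2 hg0)
  linear_combination this

/-- The function has a principal part `A / (z - w)² + B / (z - w)³` without residue. -/
def HasResidueFreePart (f : ℂ → ℂ) (w : ℂ) : Prop :=
  ∃ (A B : ℂ) (k : ℂ → ℂ), AnalyticAt ℂ k w ∧
    f =ᶠ[𝓝[≠] w] fun z => A / (z - w) ^ 2 + B / (z - w) ^ 3 + k z

lemma factorDeriv_factorDeriv (w z : ℂ) (n : ℤ) {g : ℂ → ℂ} (hg : AnalyticAt ℂ g z) :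
    factorDeriv w (n - 1) (factorDeriv w n g) z =
      n * (n - 1) * g z + 2 * n * (z - w) * deriv g z + (z - w) ^ 2 * deriv (deriv g) z := by
  have h1 : HasDerivAt (factorDeriv w n g)
      (n * deriv g z + (1 * deriv g z + (z - w) * deriv (deriv g) z)) z :=
    (hg.differentiableAt.hasDerivAt.const_mul (n : ℂ)).fun_add
      (((hasDerivAt_id z).sub_const w).fun_mul hg.deriv.differentiableAt.hasDerivAt)
  rw [factorDeriv, h1.deriv, factorDeriv]
  push_cast
  ring

/-- Here 1/Φ has no pole. -/
lemma hasResidueFreePart_inv_of_nonpos (hg : AnalyticAt ℂ g w) (hg0 : g w ≠ 0)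
    (hΦ : Φ =ᶠ[𝓝[≠] w] fun z => (z - w) ^ n * g z) (hn : n ≤ 0) :
    HasResidueFreePart (fun z => 1 / Φ z) w := by
  obtain ⟨m, rfl⟩ : ∃ m : ℕ, n = -m := ⟨(-n).toNat, by omega⟩
  refine ⟨0, 0, fun z => (z - w) ^ m * (g z)⁻¹,
    AnalyticAt.fun_mul (by fun_prop) (hg.fun_inv hg0), ?_⟩
  filter_upwards [hΦ] with z hz
  rw [hz]
  simp [mul_comm]

/-- For Φ = t²g the residue of 1/Φ is (1/g)'(w). The leading coefficient of the first integral
vanishes automatically, and its next coefficient gives g'(w) = 0. -/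
lemma hasResidueFreePart_inv_of_order_two {r : ℂ → ℂ} (hg : AnalyticAt ℂ g w) (hg0 : g w ≠ 0)
    (hΦ : Φ =ᶠ[𝓝[≠] w] fun z => (z - w) ^ (2 : ℤ) * g z) (hr : AnalyticAt ℂ r w)
    (hq : q =ᶠ[𝓝[≠] w] r)
    (hspec : ∀ᶠ z in 𝓝[≠] w,
      1 / 2 * Φ z * deriv (deriv Φ) z - 1 / 4 * deriv Φ z ^ 2 - q z * Φ z ^ 2 = 0) :
    HasResidueFreePart (fun z => 1 / Φ z) w := by
  have hq' : q =ᶠ[𝓝[≠] w] fun z => (z - w) ^ (-2 : ℤ) * ((z - w) ^ 2 * r z) := by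
    filter_upwards [hq, self_mem_nhdsWithin] with z hz hne
    have hne : z - w ≠ 0 := sub_ne_zero.mpr hne
    rw [hz, zpow_neg]
    norm_cast
    field_simp
  have h1 := spectralFactor_eq_zero hg hΦ (by fun_prop) hq' hspec
  have hd := hg.deriv
  have hdd := hd.deriv
  -- One more factor z - w is cancelled, so evaluation at w reads off the next coefficient.
  have h2 : (fun z => g z * deriv g z + (z - w) * (1 / 2 * g z * deriv (deriv g) z -
      1 / 4 * deriv g z ^ 2 - r z * g z ^ 2)) =ᶠ[𝓝[≠] w] fun _ => 0 := by
    filter_upwards [h1.filter_mono nhdsWithin_le_nhds, self_mem_nhdsWithin,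
      hg.eventually_analyticAt.filter_mono nhdsWithin_le_nhds] with z hz hne hgz
    have hne : z - w ≠ 0 := sub_ne_zero.mpr hne
    rw [spectralFactor, factorDeriv_factorDeriv w z 2 hgz, factorDeriv] at hz
    push_cast at hz
    refine mul_left_cancel₀ hne ?_
    linear_combination hz
  have h3 := eq_of_eventuallyEq_nhdsNE (f := fun z => g z * deriv g z + (z - w) *
    (1 / 2 * g z * deriv (deriv g) z - 1 / 4 * deriv g z ^ 2 - r z * g z ^ 2))
    (AnalyticAt.continuousAt (by fun_prop)) continuousAt_const h2
  have hg1 : deriv g w = 0 := by simpa [hg0] using h3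
  obtain ⟨k, hk, hk0, hvk⟩ := exists_eq_add_mul (hg.fun_inv hg0)
  have hk0' : k w = 0 := by
    rw [hk0, (hg.differentiableAt.hasDerivAt.fun_inv hg0).deriv, hg1]
    simp
  obtain ⟨m, hm, -, hkm⟩ := exists_eq_add_mul hk
  refine ⟨(g w)⁻¹, 0, m, hm, ?_⟩
  filter_upwards [hΦ, self_mem_nhdsWithin] with z hz hne
  have hne : z - w ≠ 0 := sub_ne_zero.mpr hne
  rw [hz, one_div, mul_inv, hvk, hkm, hk0']
  norm_cast
  field_simp
  ring

/-- Differentiating the first order expansion relates the Taylor coefficients of v to those of its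
slope function k. -/
lemma deriv_dslope_eq {v k : ℂ → ℂ} {w : ℂ} (hk : AnalyticAt ℂ k w)
    (h : ∀ z, v z = v w + (z - w) * k z) :
    deriv (deriv v) w = 2 * deriv k w ∧ deriv (deriv (deriv v)) w = 3 * deriv (deriv k) w := by
  have e1 : deriv v =ᶠ[𝓝 w] fun z => k z + (z - w) * deriv k z := by
    filter_upwards [hk.eventually_analyticAt] with z hz
    have h1 := (((hasDerivAt_id z).sub_const w).fun_mul
      hz.differentiableAt.hasDerivAt).const_add (v w)
    rw [show v = fun z => v w + (id z - w) * k z from funext h, h1.deriv]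
    simp
  have e2 : deriv (deriv v) =ᶠ[𝓝 w] fun z => 2 * deriv k z + (z - w) * deriv (deriv k) z := by
    filter_upwards [hk.eventually_analyticAt, e1.deriv] with z hz hd
    have h1 := hz.differentiableAt.hasDerivAt.fun_add (((hasDerivAt_id z).sub_const w).fun_mul
      hz.deriv.differentiableAt.hasDerivAt)
    rw [hd]
    refine h1.deriv.trans ?_
    simp only [id]
    ring
  have h3 := (hk.deriv.differentiableAt.hasDerivAt.const_mul 2).fun_add
    (((hasDerivAt_id w).sub_const w).fun_mul hk.deriv.deriv.differentiableAt.hasDerivAt)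
  refine ⟨by simpa using e2.eq_of_nhds, ?_⟩
  rw [e2.deriv_eq]
  refine h3.deriv.trans ?_
  simp only [id]
  ring

/-- For Φ = t³g the residue of 1/Φ is (1/g)''(w)/2. The first two nontrivial coefficients of the
first integral give 3g' = 2ρg and then, using m(w) = ρ², g g'' = 2g'² at w; this is (1/g)'' = 0. The
condition m(w) = ρ² is the apparentness of the singularity. -/
lemma hasResidueFreePart_inv_of_order_three {m : ℂ → ℂ} {ρ : ℂ} (hg : AnalyticAt ℂ g w)
    (hg0 : g w ≠ 0) (hΦ : Φ =ᶠ[𝓝[≠] w] fun z => (z - w) ^ (3 : ℤ) * g z)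
    (hm : AnalyticAt ℂ m w) (hmρ : m w = ρ ^ 2)
    (hq : q =ᶠ[𝓝[≠] w] fun z => (z - w) ^ (-2 : ℤ) * (3 / 4 + (z - w) * (ρ + (z - w) * m z)))
    (hspec : ∀ᶠ z in 𝓝[≠] w,
      1 / 2 * Φ z * deriv (deriv Φ) z - 1 / 4 * deriv Φ z ^ 2 - q z * Φ z ^ 2 = 0) :
    HasResidueFreePart (fun z => 1 / Φ z) w := by
  have h1 := spectralFactor_eq_zero hg hΦ (by fun_prop) hq hspec
  have hd := hg.deriv
  have hdd := hd.deriv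
  set E : ℂ → ℂ := fun z => 3 / 2 * (g z * deriv g z) + (z - w) * (1 / 2 * (g z * deriv (deriv g) z)
      - 1 / 4 * deriv g z ^ 2) - (ρ + (z - w) * m z) * g z ^ 2 with hE
  have h2 : E =ᶠ[𝓝 w] fun _ => 0 := by
    have hEan : AnalyticAt ℂ E w := by
      simp only [hE]
      fun_prop
    refine eventuallyEq_nhds_of_nhdsNE hEan.continuousAt continuousAt_const ?_
    filter_upwards [h1.filter_mono nhdsWithin_le_nhds, self_mem_nhdsWithin,
      hg.eventually_analyticAt.filter_mono nhdsWithin_le_nhds] with z hz hne hgz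
    have hne : z - w ≠ 0 := sub_ne_zero.mpr hne
    rw [spectralFactor, factorDeriv_factorDeriv w z 3 hgz, factorDeriv] at hz
    push_cast at hz
    refine mul_left_cancel₀ hne ?_
    simp only [hE]
    linear_combination hz
  -- The value of E at w gives the relation between g' and ρ; its derivative below gives the
  -- relation for g''.
  have h3 : 3 / 2 * (g w * deriv g w) - ρ * g w ^ 2 = 0 := by simpa [hE] using h2.eq_of_nhds
  have dg := hg.differentiableAt.hasDerivAt
  have dg' := hd.differentiableAt.hasDerivAt
  have dg'' := hdd.differentiableAt.hasDerivAt
  have dm := hm.differentiableAt.hasDerivAt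
  have dt := (hasDerivAt_id w).sub_const w
  have hEd := (((dg.fun_mul dg').const_mul (3 / 2)).fun_add (dt.fun_mul
    (((dg.fun_mul dg'').const_mul (1 / 2)).fun_sub ((dg'.fun_pow 2).const_mul (1 / 4))))).fun_sub
      (((dt.fun_mul dm).const_add ρ).fun_mul (dg.fun_pow 2))
  have h4 : deriv E w = 0 := by rw [h2.deriv_eq]; simp
  have h5 := hEd.deriv.symm.trans h4
  simp only [id, sub_self, zero_mul, hmρ, add_zero] at h5
  push_cast at h5
  obtain ⟨k, hk, hk0, hvk⟩ := exists_eq_add_mul (hg.fun_inv hg0)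
  obtain ⟨k1, hk1, hk10, hkk1⟩ := exists_eq_add_mul hk
  obtain ⟨k2, hk2, -, hk1k2⟩ := exists_eq_add_mul hk1
  have hv1 : deriv (fun z => (g z)⁻¹) =ᶠ[𝓝 w] fun z => -deriv g z / g z ^ 2 := by
    filter_upwards [hg.eventually_analyticAt, hg.continuousAt.eventually_ne hg0] with z hz hz0
    exact (hz.differentiableAt.hasDerivAt.fun_inv hz0).deriv
  have hv2 : deriv (deriv (fun z => (g z)⁻¹)) w = 0 := by
    rw [hv1.deriv_eq, (dg'.fun_neg.fun_div (dg.fun_pow 2) (pow_ne_zero 2 hg0)).deriv]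
    rw [div_eq_zero_iff]
    left
    push_cast
    have hρ : ρ * g w = 3 / 2 * deriv g w := mul_left_cancel₀ hg0 (by linear_combination -h3)
    have h6 : g w * (g w * deriv (deriv g) w - 2 * deriv g w ^ 2) = 0 := by
      linear_combination g w / 2 * h5 + (g w / 2 * (ρ * g w + 3 / 2 * deriv g w) + g w *
        deriv g w) * hρ
    linear_combination -h6
  have hk1w : k1 w = 0 := by
    have := (deriv_dslope_eq hk hvk).1
    rw [hv2] at this
    rw [hk10]
    linear_combination -this / 2
  refine ⟨k w, (g w)⁻¹, k2, hk2, ?_⟩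
  filter_upwards [hΦ, self_mem_nhdsWithin] with z hz hne
  have hne : z - w ≠ 0 := sub_ne_zero.mpr hne
  rw [hz, one_div, mul_inv, hvk, hkk1, hk1k2, hk1w]
  norm_cast
  field_simp
  ring

end Spectral

/-! ### The potential and its local structure -/

lemma add_mem_singularSet_iff {τ : ℍ} {p z l : ℂ} (hl : l ∈ (periods τ).lattice) :
    z + l ∈ singularSet τ p ↔ z ∈ singularSet τ p := by
  have h : ∀ x : ℂ, x + l ∈ (periods τ).lattice ↔ x ∈ (periods τ).lattice := fun x =>
    ⟨fun h => by simpa using sub_mem h hl, fun h => add_mem h hl⟩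
  change (z + l ∈ _ ∨ z + l - p ∈ _ ∨ z + l + p ∈ _) ↔ (z ∈ _ ∨ z - p ∈ _ ∨ z + p ∈ _)
  rw [show z + l - p = z - p + l by ring, show z + l + p = z + p + l by ring, h, h, h]

lemma algX_add {τ : ℍ} (p z : ℂ) {l : ℂ} (hl : l ∈ (periods τ).lattice) :
    algX τ p (z + l) = algX τ p z := by rw [algX, wp_add τ z hl, algX]

lemma algY_add {τ : ℍ} (p z : ℂ) {l : ℂ} (hl : l ∈ (periods τ).lattice) :
    algY τ p (z + l) = algY τ p z := by rw [algY, algX_add p z hl, deriv_wp_add τ z hl, algY]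

lemma Phi_add {τ : ℍ} {p z l : ℂ} (hp : 2 * p ∉ (periods τ).lattice) (T : ℂ)
    (hl : l ∈ (periods τ).lattice) (hz : z ∉ singularSet τ p) :
    Phi τ p T (z + l) = Phi τ p T z := by
  rw [Phi_eq hp T hz, Phi_eq hp T (fun h => hz ((add_mem_singularSet_iff hl).mp h)),
    algX_add p z hl, algY_add p z hl]

lemma potential_add {τ : ℍ} {p z l : ℂ} (hp : 2 * p ∉ (periods τ).lattice) (T : ℂ)
    (hl : l ∈ (periods τ).lattice) (hz : z ∉ singularSet τ p) :
    potential τ p T (z + l) = potential τ p T z := by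
  rw [potential_eq hp T hz, potential_eq hp T (fun h => hz ((add_mem_singularSet_iff hl).mp h)),
    algX_add p z hl, algY_add p z hl]

lemma isPeriodic_Phi {τ : ℍ} {p : ℂ} (hp : 2 * p ∉ (periods τ).lattice) (T : ℂ) :
    IsPeriodic τ (Phi τ p T) := fun _ hl =>
  (eventually_codiscrete_notMem_singularSet τ p).mono fun _ hz => Phi_add hp T hl hz

lemma isPeriodic_potential {τ : ℍ} {p : ℂ} (hp : 2 * p ∉ (periods τ).lattice) (T : ℂ) :
    IsPeriodic τ (potential τ p T) := fun _ hl =>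
  (eventually_codiscrete_notMem_singularSet τ p).mono fun _ hz => potential_add hp T hl hz

lemma meromorphic_Phi (τ : ℍ) (p T : ℂ) : Meromorphic (Phi τ p T) := by
  have h1 := meromorphic_wp τ
  have h2 := meromorphic_zeta_add τ p
  have h3 := meromorphic_zeta_sub τ p
  have h4 := meromorphic_zeta τ
  unfold Phi
  fun_prop

lemma analyticAt_wp_add (τ : ℍ) {p z : ℂ} (h : z + p ∉ (periods τ).lattice) :
    AnalyticAt ℂ (fun z => wp τ (z + p)) z := AnalyticAt.fun_comp (analyticAt_wp τ h) (by fun_prop)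

lemma analyticAt_wp_sub (τ : ℍ) {p z : ℂ} (h : z - p ∉ (periods τ).lattice) :
    AnalyticAt ℂ (fun z => wp τ (z - p)) z := AnalyticAt.fun_comp (analyticAt_wp τ h) (by fun_prop)

lemma analyticAt_Phi {τ : ℍ} {p z : ℂ} (T : ℂ) (hz : z ∉ singularSet τ p) :
    AnalyticAt ℂ (Phi τ p T) z := by
  obtain ⟨h1, h2, h3⟩ := notMem_singularSet.mp hz
  have a1 := analyticAt_wp τ h1
  have a2 := analyticAt_zeta_sub τ h2
  have a3 := analyticAt_zeta_add τ h3
  have a4 := analyticAt_zeta τ h1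
  unfold Phi
  fun_prop

lemma analyticAt_potential {τ : ℍ} {p z : ℂ} (T : ℂ) (hz : z ∉ singularSet τ p) :
    AnalyticAt ℂ (potential τ p T) z := by
  obtain ⟨h1, h2, h3⟩ := notMem_singularSet.mp hz
  have a1 := analyticAt_wp τ h1
  have a2 := analyticAt_zeta_sub τ h2
  have a3 := analyticAt_zeta_add τ h3
  have a4 := analyticAt_zeta τ h1
  have a5 := analyticAt_wp_sub τ h2
  have a6 := analyticAt_wp_add τ h3
  unfold potential
  fun_prop

lemma exists_eq_at_zero_of_lattice {f : ℂ → ℂ} {τ : ℍ} (hf : IsPeriodic τ f) {l : ℂ}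
    (hl : l ∈ (periods τ).lattice) {h : ℂ → ℂ} (hh : AnalyticAt ℂ h 0)
    (hfh : f =ᶠ[𝓝[≠] 0] fun z => (z - 0) ^ (-2 : ℤ) * h z) :
    ∃ h' : ℂ → ℂ, AnalyticAt ℂ h' l ∧ h' l = h 0 ∧
      f =ᶠ[𝓝[≠] l] fun z => (z - l) ^ (-2 : ℤ) * h' z := by
  refine ⟨fun z => h (z - l), AnalyticAt.fun_comp (g := h) (by simpa using hh) (by fun_prop),
    by simp, ?_⟩
  have h1 := eventually_nhdsNE_add (w := l) (-l) (P := fun z => f z = (z - 0) ^ (-2 : ℤ) * h z)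
    (by rw [add_neg_cancel]; exact hfh)
  filter_upwards [nhdsNE_of_codiscrete (hf (-l) (neg_mem hl)) l, h1] with z h2 h3
  rw [← h2, h3]
  simp [sub_eq_add_neg]

lemma zero_notMem {τ : ℍ} {p : ℂ} (hp : 2 * p ∉ (periods τ).lattice) :
    (0 : ℂ) - p ∉ (periods τ).lattice ∧ (0 : ℂ) + p ∉ (periods τ).lattice := by
  have hp1 := notMem_lattice_of_two_mul hp
  exact ⟨by simpa using neg_notMem_lattice hp1, by simpa using hp1⟩

lemma exists_potential_lattice {τ : ℍ} {p : ℂ} (hp : 2 * p ∉ (periods τ).lattice) (T : ℂ) {l : ℂ}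
    (hl : l ∈ (periods τ).lattice) :
    ∃ h : ℂ → ℂ, AnalyticAt ℂ h l ∧ h l = 2 ∧
      potential τ p T =ᶠ[𝓝[≠] l] fun z => (z - l) ^ (-2 : ℤ) * h z := by
  obtain ⟨R, hR, hwR⟩ := exists_wp_eq τ
  obtain ⟨m1, m2⟩ := zero_notMem hp
  have a0 := analyticAt_zetaReg_zero τ
  have a2 := analyticAt_zeta_sub τ m1
  have a3 := analyticAt_zeta_add τ m2
  have a5 := analyticAt_wp_sub τ m1
  have a6 := analyticAt_wp_add τ m2
  set h : ℂ → ℂ := fun z => 2 - 2 * T * z + z ^ 2 * (2 * R z +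
    3 / 4 * (wp τ (z + p) + wp τ (z - p))
    + T * (zeta τ (z + p) + zeta τ (z - p) - 2 * zetaReg τ z)
    - wpRatio τ p / 4 * (zeta τ (z + p) - zeta τ (z - p)) + paramB τ p T) with hh
  have hh0 : h 0 = 2 := by simp [hh]
  have han : AnalyticAt ℂ h 0 := by
    simp only [hh]
    fun_prop
  rw [← hh0]
  refine exists_eq_at_zero_of_lattice (isPeriodic_potential hp T) hl han ?_
  filter_upwards [self_mem_nhdsWithin] with z hz
  have hz : z ≠ 0 := hz
  simp only [potential, hh, sub_zero]
  rw [← zetaReg_add τ z, hwR z, zpow_neg]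
  norm_cast
  field_simp
  ring

lemma exists_Phi_lattice {τ : ℍ} {p : ℂ} (hp : 2 * p ∉ (periods τ).lattice) (T : ℂ) {l : ℂ}
    (hl : l ∈ (periods τ).lattice) :
    ∃ h : ℂ → ℂ, AnalyticAt ℂ h l ∧ h l = 1 ∧
      Phi τ p T =ᶠ[𝓝[≠] l] fun z => (z - l) ^ (-2 : ℤ) * h z := by
  obtain ⟨R, hR, hwR⟩ := exists_wp_eq τ
  obtain ⟨m1, m2⟩ := zero_notMem hp
  have a0 := analyticAt_zetaReg_zero τ
  have a2 := analyticAt_zeta_sub τ m1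
  have a3 := analyticAt_zeta_add τ m2
  set h : ℂ → ℂ := fun z => 1 + 2 * T * z + z ^ 2 * (R z
    - T * (zeta τ (z + p) + zeta τ (z - p) - 2 * zetaReg τ z)
    - wpRatio τ p / 2 * (zeta τ (z + p) - zeta τ (z - p))
    + (2 * T ^ 2 + wpRatio τ p * zeta τ p - wp τ p)) with hh
  have hh0 : h 0 = 1 := by simp [hh]
  have han : AnalyticAt ℂ h 0 := by
    simp only [hh]
    fun_prop
  rw [← hh0]
  refine exists_eq_at_zero_of_lattice (isPeriodic_Phi hp T) hl han ?_
  filter_upwards [self_mem_nhdsWithin] with z hz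
  have hz : z ≠ 0 := hz
  simp only [Phi, hh, sub_zero]
  rw [← zetaReg_add τ z, hwR z, zpow_neg]
  norm_cast
  field_simp
  ring

lemma order_Phi_lattice {τ : ℍ} {p : ℂ} (hp : 2 * p ∉ (periods τ).lattice) (T : ℂ) {l : ℂ}
    (hl : l ∈ (periods τ).lattice) : meromorphicOrderAt (Phi τ p T) l = (-2 : ℤ) := by
  obtain ⟨h, hh, hh1, hPh⟩ := exists_Phi_lattice hp T hl
  exact (meromorphicOrderAt_eq_int_iff (meromorphic_Phi τ p T l)).mpr ⟨h, hh, by simp [hh1], hPh⟩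

/-- The double pole at 0, present for every T, keeps Φ_e from vanishing identically. -/
lemma order_Phi_ne_top {τ : ℍ} {p : ℂ} (hp : 2 * p ∉ (periods τ).lattice) (T z : ℂ) :
    meromorphicOrderAt (Phi τ p T) z ≠ ⊤ :=
  order_ne_top_of_meromorphic (meromorphic_Phi τ p T) (w := 0)
    (by rw [order_Phi_lattice hp T (zero_mem _)]; exact WithTop.coe_ne_top) z

/-- At the points of `±p + Λ` the potential is `3/4 t⁻² + ρ t⁻¹ + ρ² + O(t)`: the singularity is
apparent. -/
lemma exists_potential_apparent {τ : ℍ} {p w : ℂ} (hp : 2 * p ∉ (periods τ).lattice) (T : ℂ)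
    (hw : w - p ∈ (periods τ).lattice ∨ w + p ∈ (periods τ).lattice) :
    ∃ (ρ : ℂ) (m : ℂ → ℂ), AnalyticAt ℂ m w ∧ m w = ρ ^ 2 ∧ potential τ p T =ᶠ[𝓝[≠] w]
      fun z => (z - w) ^ (-2 : ℤ) * (3 / 4 + (z - w) * (ρ + (z - w) * m z)) := by
  have hp1 := notMem_lattice_of_two_mul hp
  have hb := deriv_wp_ne_zero τ hp
  -- Both classes ±p + Λ are treated together: only ℘(w) = ℘(p) and ℘'(w)² = ℘'(p)² matter.
  obtain ⟨hwl, hwp, hdw⟩ : w ∉ (periods τ).lattice ∧ wp τ w = wp τ p ∧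
      deriv (wp τ) w ^ 2 = deriv (wp τ) p ^ 2 := by
    rcases hw with h | h
    · refine ⟨fun h' => hp1 (by simpa using sub_mem h' h), ?_, ?_⟩
      · rw [show w = p + (w - p) by ring, wp_add τ p h]
      · rw [show w = p + (w - p) by ring, deriv_wp_add τ p h]
    · refine ⟨fun h' => hp1 (by simpa using sub_mem h h'), ?_, ?_⟩
      · rw [show w = -p + (w + p) by ring, wp_add τ _ h, wp_neg]
      · rw [show w = -p + (w + p) by ring, deriv_wp_add τ _ h, deriv_wp_neg, neg_sq]
  set a := wp τ p with ha
  set B := deriv (deriv (wp τ)) p with hB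
  set b := deriv (wp τ) w with hbw
  have hb0 : b ≠ 0 := by
    intro h
    rw [h] at hdw
    exact hb (by simpa using hdw.symm)
  have a1 := analyticAt_wp τ hwl
  obtain ⟨u, hu, huw, hXu⟩ := exists_eq_add_mul a1
  rw [hwp] at hXu
  have hu0 : u w ≠ 0 := by rw [huw]; exact hb0
  obtain ⟨hu1, hu2⟩ := deriv_dslope_eq (v := wp τ) hu (by rw [hwp]; exact hXu)
  have hB' : deriv (deriv (wp τ)) w = B := by
    rw [hB, deriv_deriv_wp τ hwl, deriv_deriv_wp τ hp1, hwp]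
  have hC : deriv (deriv (deriv (wp τ))) w = 12 * a * b := by
    have h1 : deriv (deriv (wp τ)) =ᶠ[𝓝 w] fun z => 6 * wp τ z ^ 2 - (periods τ).g₂ / 2 :=
      (eventually_nhds_notMem_lattice τ hwl).mono fun z hz => deriv_deriv_wp τ hz
    rw [h1.deriv_eq]
    have := (((a1.differentiableAt.hasDerivAt.fun_pow 2).const_mul 6).sub_const
      ((periods τ).g₂ / 2)).deriv
    rw [this, hwp]
    push_cast
    ring
  have hud := hu.deriv
  have hudd := hud.deriv
  set s : ℂ → ℂ := fun z => (u z)⁻¹ with hs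
  have hsan : AnalyticAt ℂ s w := hu.fun_inv hu0
  set v : ℂ → ℂ := fun z => deriv u z * s z with hv
  have hvan : AnalyticAt ℂ v w := by
    simp only [hv]
    fun_prop
  have hvd := hvan.deriv
  obtain ⟨k, hk, hkw, hsk⟩ := exists_eq_add_mul hsan
  have hsd : HasDerivAt s (-deriv u w / u w ^ 2) w := hu.differentiableAt.hasDerivAt.fun_inv hu0
  have hvdw : deriv v w = deriv (deriv u) w / u w - (deriv u w / u w) ^ 2 := by
    rw [(hud.differentiableAt.hasDerivAt.fun_mul hsd).deriv]
    simp only [hs]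
    field_simp
    ring
  -- With t = z - w, X = tu and Y = X'/X = 1/t + v, where v = u'/u. Replacing ℘'(p)²/X² by 2X - B/X
  -- - Y' turns the potential into (3/4)/t² + T/t + B/(4X) plus regular terms. Expanding 1/X = (1/b
  -- + tk)/t gives ρ and m.
  refine ⟨T + B / (4 * b), fun z => 7 / 2 * ((z - w) * u z) + 3 * a - 3 / 4 * deriv v z + T * v z +
    T ^ 2 + B / 4 * k z, by fun_prop, ?_, ?_⟩
  · have hvw : v w = deriv u w / u w := by simp only [hv, hs, div_eq_mul_inv]
    have e1 : deriv u w = B / 2 := by rw [← hB', hu1]; ring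
    have e2 : deriv (deriv u) w = 4 * a * b := by
      have := hC.symm.trans hu2
      linear_combination -this / 3
    simp only [sub_self, zero_mul, mul_zero, zero_add]
    rw [hvdw, hkw, hsd.deriv, hvw, e2, e1, huw, ← hbw]
    field_simp
    ring
  · have hsing : ∀ᶠ z in 𝓝[≠] w, z ∉ singularSet τ p :=
      eventually_codiscrete_iff.mp (eventually_codiscrete_notMem_singularSet τ p) w
    have hXd : (fun z => algX τ p z) = fun z => (z - w) * u z := by
      ext z
      simp only [algX, hXu z, ← ha]
      ring
    have hXz : ∀ z, algX τ p z = (z - w) * u z := fun z => congrFun hXd z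
    have hu' : ∀ᶠ z in 𝓝[≠] w, u z ≠ 0 ∧ AnalyticAt ℂ u z ∧ AnalyticAt ℂ v z :=
      ((hu.continuousAt.eventually_ne hu0).and
        (hu.eventually_analyticAt.and hvan.eventually_analyticAt)).filter_mono nhdsWithin_le_nhds
    have hY : ∀ᶠ z in 𝓝[≠] w, algY τ p z = 1 / (z - w) + v z := by
      filter_upwards [hsing, self_mem_nhdsWithin, hu'] with z hz hne ⟨huz, huz', _⟩
      have hne : z - w ≠ 0 := sub_ne_zero.mpr hne
      have h1 := hasDerivAt_algX hp hz
      have h2 := ((hasDerivAt_id z).sub_const w).fun_mul huz'.differentiableAt.hasDerivAt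
      have h3 := h1.unique (h2.congr_of_eventuallyEq (Eventually.of_forall hXz))
      rw [hXz z] at h3
      simp only [hv, hs]
      refine mul_left_cancel₀ (mul_ne_zero hne huz) (h3.trans ?_)
      simp only [id]
      field_simp
    -- The derivative of Y is computed twice, once algebraically and once from Y = 1/(z - w) + v.
    have hY' : ∀ᶠ z in 𝓝[≠] w, 2 * algX τ p z - B / algX τ p z - deriv (wp τ) p ^ 2 /
        algX τ p z ^ 2 = -1 / (z - w) ^ 2 + deriv v z := by
      filter_upwards [hsing, self_mem_nhdsWithin, hu', eventually_nhdsNE_eventually_nhds_iff.mpr hY]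
        with z hz hne ⟨huz, huz', hvz⟩ hYz
      have hne : z - w ≠ 0 := sub_ne_zero.mpr hne
      have h1 := hasDerivAt_algY hp hz
      have h2 := (((hasDerivAt_id z).sub_const w).fun_inv hne).fun_add
        hvz.differentiableAt.hasDerivAt
      exact h1.unique (h2.congr_of_eventuallyEq (hYz.mono fun y hy => by
        rw [hy, one_div]; rfl))
    filter_upwards [hsing, self_mem_nhdsWithin, hu', hY, hY'] with z hz hne ⟨huz, _, _⟩ hYz hYz'
    have hne : z - w ≠ 0 := sub_ne_zero.mpr hne
    rw [potential_eq hp T hz, hYz, ← hB]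
    have e1 : deriv (wp τ) p ^ 2 / algX τ p z ^ 2 = 2 * algX τ p z - B / algX τ p z -
      (-1 / (z - w) ^ 2 + deriv v z) := by linear_combination -hYz'
    have e2 : B / algX τ p z = B / (z - w) * (b⁻¹ + (z - w) * k z) := by
      have := hsk z
      simp only [hs, huw] at this
      rw [hXz z, ← this]
      field_simp
    have e3 : (z - w) ^ (-2 : ℤ) = 1 / (z - w) ^ 2 := by
      rw [zpow_neg, one_div]
      norm_cast
    rw [mul_div_assoc, e1, e2, hXz z, e3, ← ha]
    field_simp
    ring

lemma exists_potential_local {τ : ℍ} {p : ℂ} (hp : 2 * p ∉ (periods τ).lattice) (T w : ℂ) :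
    ∃ h : ℂ → ℂ, AnalyticAt ℂ h w ∧
      (potential τ p T =ᶠ[𝓝[≠] w] fun z => (z - w) ^ (-2 : ℤ) * h z) ∧
      ((w ∉ singularSet τ p ∧ h w = 0) ∨ (w ∈ (periods τ).lattice ∧ h w = 2) ∨
        ((w - p ∈ (periods τ).lattice ∨ w + p ∈ (periods τ).lattice) ∧ h w = 3 / 4)) := by
  by_cases hw : w ∈ singularSet τ p
  · by_cases hw' : w ∈ (periods τ).lattice
    · obtain ⟨h, h1, h2, h3⟩ := exists_potential_lattice hp T hw'
      exact ⟨h, h1, h3, Or.inr (Or.inl ⟨hw', h2⟩)⟩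
    · have hw'' := hw.resolve_left hw'
      obtain ⟨ρ, m, h1, h2, h3⟩ := exists_potential_apparent hp T hw''
      exact ⟨_, by fun_prop, h3, Or.inr (Or.inr ⟨hw'', by simp⟩)⟩
  · have := analyticAt_potential T hw
    refine ⟨fun z => (z - w) ^ 2 * potential τ p T z, by fun_prop, ?_, Or.inl ⟨hw, by simp⟩⟩
    filter_upwards [self_mem_nhdsWithin] with z hne
    have hne : z - w ≠ 0 := sub_ne_zero.mpr hne
    rw [zpow_neg]
    norm_cast
    field_simp

/-! ### Elliptic solutions of the second symmetric product equation -/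

lemma zetaReg_zero (τ : ℍ) : zetaReg τ 0 = 0 := by
  have h1 := zeta_neg τ 0
  have h2 := zetaReg_add τ 0
  simp only [neg_zero, div_zero, add_zero] at h1 h2
  rw [h2]
  exact self_eq_neg.mp h1

/-- A periodic G = ζ + cz is odd, hence vanishes at half periods outside the lattice. Then G² - ℘ is
elliptic without poles, so constant, and ℘ would take equal values at 1/2 and τ/2. -/
lemma not_isPeriodic_zeta_add_mul (τ : ℍ) (c : ℂ) :
    ¬ IsPeriodic τ (fun z => zeta τ z + c * z) := by
  intro hper
  set G : ℂ → ℂ := fun z => zeta τ z + c * z with hG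
  have hGan : ∀ z, z ∉ (periods τ).lattice → AnalyticAt ℂ G z := fun z hz => by
    have := analyticAt_zeta τ hz
    simp only [hG]
    fun_prop
  have hhalf : ∀ l ∈ (periods τ).lattice, l / 2 ∉ (periods τ).lattice → G (l / 2) = 0 := by
    intro l hl hl2
    have hneg : -(l / 2) ∉ (periods τ).lattice := neg_notMem_lattice hl2
    have hsum : -(l / 2) + l = l / 2 := by ring
    have h1 : ContinuousAt (fun z => G (z + l)) (-(l / 2)) := by
      refine (AnalyticAt.fun_comp (g := G) (f := fun z => z + l) (𝕜 := ℂ) ?_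
        (by fun_prop)).continuousAt
      rw [hsum]
      exact hGan _ hl2
    have h2 := eq_of_eventuallyEq_nhdsNE h1 (hGan _ hneg).continuousAt
      (nhdsNE_of_codiscrete (hper l hl) _)
    rw [hsum] at h2
    have h3 : G (-(l / 2)) = -G (l / 2) := by
      simp only [hG, zeta_neg]
      ring
    rw [h3] at h2
    exact self_eq_neg.mp h2
  have hH : IsPeriodic τ (fun z => G z ^ 2 - wp τ z) :=
    hper.comp₂ (isPeriodic_wp τ) (fun u v => u ^ 2 - v)
  have hHan : ∀ z, z ∉ (periods τ).lattice → AnalyticAt ℂ (fun z => G z ^ 2 - wp τ z) z :=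
    fun z hz => ((hGan z hz).fun_pow 2).fun_sub (analyticAt_wp τ hz)
  have hHm : Meromorphic (fun z => G z ^ 2 - wp τ z) := by
    have h1 := meromorphic_wp τ
    have h2 := meromorphic_zeta τ
    intro z
    have h3 := h1 z
    have h4 := h2 z
    simp only [hG]
    fun_prop
  have hH0 : 0 ≤ meromorphicOrderAt (fun z => G z ^ 2 - wp τ z) 0 := by
    obtain ⟨R, hR, hwR⟩ := exists_wp_eq τ
    have a0 := analyticAt_zetaReg_zero τ
    obtain ⟨k, hk, -, hk'⟩ := exists_eq_add_mul a0
    simp only [zetaReg_zero, sub_zero, zero_add] at hk'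
    have han : AnalyticAt ℂ (fun z => 2 * (k z + c) + (zetaReg τ z + c * z) ^ 2 - R z) 0 := by
      fun_prop
    rw [meromorphicOrderAt_congr (f₂ := fun z => 2 * (k z + c) + (zetaReg τ z + c * z) ^ 2 - R z)]
    · exact han.meromorphicOrderAt_nonneg
    · filter_upwards [self_mem_nhdsWithin] with z hz
      have hz : z ≠ 0 := hz
      simp only [hG]
      rw [← zetaReg_add, hwR, hk']
      field_simp
      ring
  obtain ⟨d, hd⟩ := exists_const_of_order_nonneg hHm hH fun z => by
    by_cases hz : z ∈ (periods τ).lattice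
    · have := hH.order hz 0
      rw [zero_add] at this
      rwa [this]
    · exact (hHan z hz).meromorphicOrderAt_nonneg
  have hval : ∀ l ∈ (periods τ).lattice, l / 2 ∉ (periods τ).lattice → wp τ (l / 2) = -d := by
    intro l hl hl2
    have := eq_of_eventuallyEq_nhdsNE (hHan _ hl2).continuousAt continuousAt_const
      (nhdsNE_of_codiscrete hd _)
    rw [hhalf l hl hl2] at this
    rw [← this]
    ring
  apply (halfPeriodValue_injective τ).1
  change wp τ (1 / 2) = wp τ (τ / 2)
  rw [hval 1 (one_mem τ) (one_half_notMem τ), hval τ (tau_mem τ) (tau_half_notMem τ)]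

/-- An elliptic function with at most a simple pole, at the lattice points, is constant. -/
lemma exists_const_of_simple_pole {τ : ℍ} {F k : ℂ → ℂ} {A : ℂ} (hF : Meromorphic F)
    (hper : IsPeriodic τ F) (hord : ∀ z, z ∉ (periods τ).lattice → 0 ≤ meromorphicOrderAt F z)
    (hk : AnalyticAt ℂ k 0) (hF0 : F =ᶠ[𝓝[≠] 0] fun z => A / z + k z) :
    ∃ c, F =ᶠ[codiscrete ℂ] fun _ => c := by
  have hmz := meromorphic_zeta τ
  have hmid : Meromorphic (fun z : ℂ => z) := fun z => by fun_prop
  -- Subtracting Aζ removes the pole, at the cost of periodicity holding only up to additive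
  -- constants.
  set G : ℂ → ℂ := fun z => F z - A * zeta τ z with hG
  have hGm : Meromorphic G := by simp only [hG]; fun_prop
  have hadd : ∀ l ∈ (periods τ).lattice, ∃ η, (fun z => G (z + l)) =ᶠ[codiscrete ℂ]
      fun z => G z + η := by
    intro l hl
    obtain ⟨η, hη⟩ := exists_zeta_add τ hl
    refine ⟨-A * η, ?_⟩
    filter_upwards [hper l hl, eventually_codiscrete_notMem_lattice τ] with z h1 h2
    simp only [hG, hη z h2]
    linear_combination h1
  have hz0 := analyticAt_zetaReg_zero τ
  have hG0 : G =ᶠ[𝓝[≠] 0] fun z => k z - A * zetaReg τ z := by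
    filter_upwards [hF0] with z hz
    simp only [hG, hz, ← zetaReg_add]
    ring
  have hGord : ∀ z, 0 ≤ meromorphicOrderAt G z := by
    intro z
    by_cases hz : z ∈ (periods τ).lattice
    · obtain ⟨η, hη⟩ := hadd (-z) (neg_mem hz)
      have h1 : G =ᶠ[𝓝[≠] z] fun y => k (y - z) - A * zetaReg τ (y - z) - η := by
        have h0 := eventually_nhdsNE_add (w := z) (-z)
          (P := fun y => G y = k y - A * zetaReg τ y) (by rw [add_neg_cancel]; exact hG0)
        filter_upwards [h0, nhdsNE_of_codiscrete hη z] with y h2 h3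
        rw [sub_eq_add_neg y z, ← h2, h3]
        ring
      have a1 : AnalyticAt ℂ (fun y => k (y - z)) z :=
        AnalyticAt.fun_comp (g := k) (by simpa using hk) (by fun_prop)
      have a2 : AnalyticAt ℂ (fun y => zetaReg τ (y - z)) z :=
        AnalyticAt.fun_comp (g := zetaReg τ) (by simpa using hz0) (by fun_prop)
      rw [meromorphicOrderAt_congr h1]
      exact ((a1.fun_sub (a2.const_smul (c := A))).fun_sub
        analyticAt_const).meromorphicOrderAt_nonneg
    · have := analyticAt_zeta τ hz
      have h2 : AnalyticAt ℂ (fun z => -A * zeta τ z) z := by fun_prop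
      refine (le_min (hord z hz) h2.meromorphicOrderAt_nonneg).trans
        ((meromorphicOrderAt_add (hF z) h2.meromorphicAt).trans_eq ?_)
      refine meromorphicOrderAt_congr (Eventually.of_forall fun y => ?_)
      simp only [hG, Pi.add_apply]
      ring
  obtain ⟨g, hg, hgG⟩ := exists_entire_of_order_nonneg hGm hGord
  -- Differentiation kills the additive constants, so g' is elliptic and entire, hence constant; F
  -- is then Aζ plus an affine function.
  have hg'm : Meromorphic (deriv g) := fun z => (hg.analyticAt z).deriv.meromorphicAt
  have hg'p : IsPeriodic τ (deriv g) := by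
    intro l hl
    obtain ⟨η, hη⟩ := hadd l hl
    have h1 : (fun z => g (z + l)) =ᶠ[codiscrete ℂ] fun z => g z + η := by
      filter_upwards [hη, hgG, eventually_codiscrete_add l hgG] with z h1 h2 h3
      rw [h3, h2, h1]
    filter_upwards [deriv_eventuallyEq_codiscrete h1] with z hz
    rw [deriv_comp_add_const, deriv_add_const] at hz
    exact hz
  obtain ⟨d, hd⟩ := exists_const_of_order_nonneg hg'm hg'p fun z =>
    (hg.analyticAt z).deriv.meromorphicOrderAt_nonneg
  obtain ⟨e, he⟩ := exists_eventuallyEq_const_of_deriv_codiscrete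
    (f := fun z => g z - d * z) (fun z => by have := (hg.analyticAt z).meromorphicAt; fun_prop) (by
      filter_upwards [hd] with z hz
      have := ((hg z).hasDerivAt.fun_sub ((hasDerivAt_id z).const_mul d)).deriv
      simp only [id, mul_one] at this
      rw [this, hz, sub_self])
  have hFe : F =ᶠ[codiscrete ℂ] fun z => A * zeta τ z + d * z + e := by
    filter_upwards [he, hgG] with z h1 h2
    rw [h2] at h1
    simp only [hG] at h1
    linear_combination h1
  by_cases hA : A = 0
  · refine exists_const_of_order_nonneg hF hper fun z => ?_
    rw [meromorphicOrderAt_congr_codiscrete hFe z]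
    exact AnalyticAt.meromorphicOrderAt_nonneg (by simp only [hA, zero_mul]; fun_prop)
  · refine absurd ?_ (not_isPeriodic_zeta_add_mul τ (d / A))
    refine (hper.comp (fun u => (u - e) / A)).congr ?_
    filter_upwards [hFe] with z hz
    rw [hz]
    field_simp
    ring

/-- Differentiating the quadratic first integral of the second symmetric product equation. -/
lemma symSq_of_spectral {f q : ℂ → ℂ} {z Q : ℂ} (hf : AnalyticAt ℂ f z) (hq : AnalyticAt ℂ q z)
    (hfz : f z ≠ 0)
    (h : ∀ᶠ y in 𝓝 z, 1 / 2 * f y * deriv (deriv f) y - 1 / 4 * deriv f y ^ 2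
      - q y * f y ^ 2 = Q) :
    deriv (deriv (deriv f)) z - 4 * q z * deriv f z - 2 * deriv q z * f z = 0 := by
  have d0 := hf.differentiableAt.hasDerivAt
  have d1 := hf.deriv.differentiableAt.hasDerivAt
  have d2 := hf.deriv.deriv.differentiableAt.hasDerivAt
  have dq := hq.differentiableAt.hasDerivAt
  have h1 := ((((d0.const_mul (1 / 2)).fun_mul d2).fun_sub
    ((d1.fun_pow 2).const_mul (1 / 4))).fun_sub (dq.fun_mul (d0.fun_pow 2)))
  have h2 := h1.unique ((hasDerivAt_const z Q).congr_of_eventuallyEq h)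
  refine mul_left_cancel₀ hfz ?_
  push_cast at h2
  linear_combination 2 * h2

lemma isEllipticSymSqSolution_Phi {τ : ℍ} {p : ℂ} (hp : 2 * p ∉ (periods τ).lattice) (T : ℂ) :
    IsEllipticSymSqSolution τ p T (Phi τ p T) := by
  refine ⟨meromorphic_Phi τ p T, isPeriodic_Phi hp T, ?_⟩
  filter_upwards [eventually_codiscrete_notMem_singularSet τ p,
    eventually_codiscrete_ne_zero (meromorphic_Phi τ p T) (order_Phi_ne_top hp T)] with z hz hne
  exact symSq_of_spectral (analyticAt_Phi T hz) (analyticAt_potential T hz) hne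
    ((eventually_nhds_notMem_singularSet hz).mono fun y hy => Phi_spectral hp T hy)

lemma Phi_not_eventuallyEq_zero {τ : ℍ} {p : ℂ} (hp : 2 * p ∉ (periods τ).lattice) (T : ℂ) :
    ¬ Phi τ p T =ᶠ[codiscrete ℂ] 0 := by
  intro h
  refine order_Phi_ne_top hp T 0 ?_
  rw [meromorphicOrderAt_eq_top_iff]
  exact nhdsNE_of_codiscrete h 0

lemma IsEllipticSymSqSolution.sub_mul {τ : ℍ} {p T : ℂ} {Ψ Φ : ℂ → ℂ}
    (h1 : IsEllipticSymSqSolution τ p T Ψ) (h2 : IsEllipticSymSqSolution τ p T Φ) (c : ℂ) :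
    IsEllipticSymSqSolution τ p T (fun z => Ψ z - c * Φ z) := by
  refine ⟨?_, IsPeriodic.comp₂ h1.2.1 h2.2.1 (fun u v => u - c * v), ?_⟩
  · have a := h1.1
    have b := h2.1
    fun_prop
  filter_upwards [h1.2.2, h2.2.2,
    eventually_codiscrete_eventually_nhds (eventually_codiscrete_analyticAt h1.1),
    eventually_codiscrete_eventually_nhds (eventually_codiscrete_analyticAt h2.1)]
    with z e1 e2 a1 a2
  have d1 : deriv (fun z => Ψ z - c * Φ z) =ᶠ[𝓝 z] fun z => deriv Ψ z - c * deriv Φ z := by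
    filter_upwards [a1, a2] with y b1 b2
    exact (b1.differentiableAt.hasDerivAt.fun_sub
      (b2.differentiableAt.hasDerivAt.const_mul c)).deriv
  have d2 : deriv (deriv (fun z => Ψ z - c * Φ z)) =ᶠ[𝓝 z]
      fun z => deriv (deriv Ψ) z - c * deriv (deriv Φ) z := by
    filter_upwards [a1, a2, d1.eventuallyEq_nhds] with y b1 b2 e
    rw [e.deriv_eq]
    exact (b1.deriv.differentiableAt.hasDerivAt.fun_sub
      (b2.deriv.differentiableAt.hasDerivAt.const_mul c)).deriv
  have d3 : deriv (deriv (deriv (fun z => Ψ z - c * Φ z))) z =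
      deriv (deriv (deriv Ψ)) z - c * deriv (deriv (deriv Φ)) z := by
    rw [d2.deriv_eq]
    exact (a1.self_of_nhds.deriv.deriv.differentiableAt.hasDerivAt.fun_sub
      (a2.self_of_nhds.deriv.deriv.differentiableAt.hasDerivAt.const_mul c)).deriv
  rw [d3, d1.self_of_nhds]
  linear_combination e1 - c * e2

/-- The possible orders of an elliptic solution. -/
lemma IsEllipticSymSqSolution.order_cases {τ : ℍ} {p T : ℂ} (hp : 2 * p ∉ (periods τ).lattice)
    {Ψ : ℂ → ℂ} (h : IsEllipticSymSqSolution τ p T Ψ) {w : ℂ} {n : ℤ}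
    (hn : meromorphicOrderAt Ψ w = n) :
    (w ∉ singularSet τ p ∧ 0 ≤ n) ∨ (w ∈ (periods τ).lattice ∧ (n = 1 ∨ n = 4 ∨ n = -2)) ∨
      ((w - p ∈ (periods τ).lattice ∨ w + p ∈ (periods τ).lattice) ∧ -1 ≤ n) := by
  obtain ⟨g, hg, hg0, hΨg⟩ := (meromorphicOrderAt_eq_int_iff (h.1 w)).mp hn
  obtain ⟨k, hk, hqk, hcases⟩ := exists_potential_local hp T w
  have key := indicial_equation hg hg0 hΨg hk hqk (eventually_codiscrete_iff.mp h.2.2 w)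
  have hint : ∀ m : ℤ, (m : ℂ) = 4 * k w → (n - 1) * (n ^ 2 - 2 * n - m) = 0 := by
    intro m hm
    rw [← hm] at key
    exact_mod_cast key
  -- Four times the leading coefficient is 0, 8 or 3, so the exponents are 0, 1, 2 at regular
  -- points, -2, 1, 4 at lattice points and -1, 1, 3 at ±p.
  rcases hcases with ⟨hw, h0⟩ | ⟨hw, h0⟩ | ⟨hw, h0⟩
  · refine Or.inl ⟨hw, ?_⟩
    have := hint 0 (by rw [h0]; norm_num)
    rcases mul_eq_zero.mp this with h | h <;> nlinarith
  · refine Or.inr (Or.inl ⟨hw, ?_⟩)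
    have := hint 8 (by rw [h0]; norm_num)
    rcases mul_eq_zero.mp this with h | h
    · left; omega
    · have : (n - 4) * (n + 2) = 0 := by linear_combination h
      rcases mul_eq_zero.mp this with h | h
      · right; left; omega
      · right; right; omega
  · refine Or.inr (Or.inr ⟨hw, ?_⟩)
    have := hint 3 (by rw [h0]; norm_num)
    rcases mul_eq_zero.mp this with h | h <;> nlinarith

lemma zero_mem_lattice (τ : ℍ) : (0 : ℂ) ∈ (periods τ).lattice := zero_mem _

/-- Without exponent -2, E vanishes at lattice points. Multiplication by X removes its possible
simple poles at ±p and leaves at most a simple pole at 0, so XE is constant. A nonzero constant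
would require E to have order 2 at 0, which is not an exponent. -/
lemma IsEllipticSymSqSolution.eq_zero {τ : ℍ} {p T : ℂ} (hp : 2 * p ∉ (periods τ).lattice)
    {E : ℂ → ℂ} (h : IsEllipticSymSqSolution τ p T E)
    (h0 : meromorphicOrderAt E 0 ≠ (-2 : ℤ)) : E =ᶠ[codiscrete ℂ] fun _ => 0 := by
  have hp1 := notMem_lattice_of_two_mul hp
  have hsing0 : ∀ {w}, w ∈ (periods τ).lattice →
      ¬ (w - p ∈ (periods τ).lattice ∨ w + p ∈ (periods τ).lattice) := by
    rintro w hw (h' | h')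
    · exact hp1 (by simpa using sub_mem hw h')
    · exact hp1 (by simpa using sub_mem h' hw)
  have hn0 : ∀ n : ℤ, meromorphicOrderAt E 0 = n → n = 1 ∨ n = 4 := by
    intro n hn
    rcases h.order_cases hp hn with ⟨h1, -⟩ | ⟨-, h1 | h1 | h1⟩ | ⟨h1, -⟩
    · exact absurd (Or.inl (zero_mem_lattice τ)) h1
    · exact Or.inl h1
    · exact Or.inr h1
    · exact absurd (by rw [hn, h1]) h0
    · exact absurd h1 (hsing0 (zero_mem_lattice τ))
  obtain ⟨g, hg, hEg⟩ : ∃ g : ℂ → ℂ, AnalyticAt ℂ g 0 ∧ E =ᶠ[𝓝[≠] 0] fun z => z * g z := by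
    by_cases ht : meromorphicOrderAt E 0 = ⊤
    · refine ⟨fun _ => 0, by fun_prop, ?_⟩
      filter_upwards [meromorphicOrderAt_eq_top_iff.mp ht] with z hz
      rw [hz, mul_zero]
    · obtain ⟨n, hn⟩ := WithTop.ne_top_iff_exists.mp ht
      obtain ⟨g, hg, -, hEg⟩ := (meromorphicOrderAt_eq_int_iff (h.1 0)).mp hn.symm
      rcases hn0 n hn.symm with rfl | rfl
      · refine ⟨g, hg, ?_⟩
        filter_upwards [hEg] with z hz
        rw [hz, sub_zero, zpow_one, smul_eq_mul]
      · refine ⟨fun z => z ^ 3 * g z, by fun_prop, ?_⟩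
        filter_upwards [hEg] with z hz
        rw [hz, sub_zero, smul_eq_mul, show (4 : ℤ) = ((4 : ℕ) : ℤ) by norm_num, zpow_natCast]
        ring
  have hX := meromorphic_wp τ
  have hXm : Meromorphic (algX τ p) := by unfold algX; fun_prop
  have hEm := h.1
  set F : ℂ → ℂ := fun z => algX τ p z * E z with hF
  have hFm : Meromorphic F := by simp only [hF]; fun_prop
  have hFp : IsPeriodic τ F := (isPeriodic_wp τ).comp₂ h.2.1 (fun u v => (u - wp τ p) * v)
  have hFord : ∀ z, meromorphicOrderAt F z = meromorphicOrderAt (algX τ p) z +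
      meromorphicOrderAt E z := fun z => meromorphicOrderAt_mul (hXm z) (hEm z)
  have hF0 : ∀ z, z ∉ (periods τ).lattice → 0 ≤ meromorphicOrderAt F z := by
    intro z hz
    have hXan : AnalyticAt ℂ (algX τ p) z := by
      have := analyticAt_wp τ hz
      unfold algX
      fun_prop
    rw [hFord]
    by_cases ht : meromorphicOrderAt E z = ⊤
    · simp [ht]
    obtain ⟨n, hn⟩ := WithTop.ne_top_iff_exists.mp ht
    rcases h.order_cases hp hn.symm with ⟨h1, h2⟩ | ⟨h1, -⟩ | ⟨h1, h2⟩
    · rw [← hn]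
      exact add_nonneg hXan.meromorphicOrderAt_nonneg (by exact_mod_cast h2)
    · exact absurd h1 hz
    · have hXz : algX τ p z = 0 := by
        unfold algX
        rcases h1 with h1 | h1
        · rw [show z = p + (z - p) by ring, wp_add τ p h1, sub_self]
        · rw [show z = -p + (z + p) by ring, wp_add τ _ h1, wp_neg, sub_self]
      obtain ⟨u, hu, -, hXu⟩ := exists_eq_add_mul hXan
      rw [hXz] at hXu
      have e1 : meromorphicOrderAt F z = meromorphicOrderAt (fun y => u y * ((y - z) * E y)) z := by
        refine meromorphicOrderAt_congr (Eventually.of_forall fun y => ?_)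
        simp only [hF, hXu]
        ring
      obtain ⟨g', hg', -, hEg'⟩ := (meromorphicOrderAt_eq_int_iff (h.1 z)).mp hn.symm
      rw [← hFord, e1, meromorphicOrderAt_congr
        (f₂ := fun y => u y * ((y - z) ^ (n + 1).toNat * g' y))]
      · exact AnalyticAt.meromorphicOrderAt_nonneg (by fun_prop)
      · filter_upwards [hEg', self_mem_nhdsWithin] with y hy hne
        have hne : y - z ≠ 0 := sub_ne_zero.mpr hne
        rw [hy, smul_eq_mul, ← zpow_natCast, Int.toNat_of_nonneg (by omega), zpow_add₀ hne,
          zpow_one]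
        ring
  obtain ⟨R, hR, hwR⟩ := exists_wp_eq τ
  obtain ⟨k, hk, -, hgk⟩ := exists_eq_add_mul hg
  obtain ⟨c, hc⟩ := exists_const_of_simple_pole (A := g 0)
    (k := fun z => k z + (R z - wp τ p) * (z * g z)) hFm hFp hF0 (by fun_prop) (by
      filter_upwards [hEg, self_mem_nhdsWithin] with z hz hne
      have hne : z ≠ 0 := hne
      have := hgk z
      rw [sub_zero] at this
      simp only [hF, hz, algX, hwR z]
      have e : (1 / z ^ 2 + R z - wp τ p) * (z * g z) = g z / z + (R z - wp τ p) * (z * g z) := by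
        field_simp
        ring
      rw [e, this]
      field_simp
      ring)
  have hXne := eventually_codiscrete_ne_zero hXm (order_wp_sub_const_ne_top τ (wp τ p))
  have hc0 : c = 0 := by
    by_contra hc0
    have h1 : meromorphicOrderAt F 0 = 0 := by
      rw [meromorphicOrderAt_congr_codiscrete hc, meromorphicOrderAt_const, if_neg hc0]
    rw [hFord, show meromorphicOrderAt (algX τ p) 0 = -2 from
      order_wp_sub_const τ (zero_mem_lattice τ) (wp τ p)] at h1
    by_cases ht : meromorphicOrderAt E 0 = ⊤
    · simp [ht] at h1
    obtain ⟨n, hn⟩ := WithTop.ne_top_iff_exists.mp ht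
    rw [← hn] at h1
    have h2 : -2 + n = 0 := WithTop.coe_injective h1
    rcases hn0 n hn.symm with h | h <;> omega
  filter_upwards [hc, hXne] with z h1 h2
  rw [hc0] at h1
  exact (mul_eq_zero.mp h1).resolve_left h2

/-- The factor is the coefficient of z⁻² of Ψ at 0, since Φ_e has leading coefficient 1; the
difference then falls under `eq_zero`. -/
lemma exists_eq_mul_Phi {τ : ℍ} {p T : ℂ} (hp : 2 * p ∉ (periods τ).lattice)
    {Ψ : ℂ → ℂ} (h : IsEllipticSymSqSolution τ p T Ψ) :
    ∃ c : ℂ, Ψ =ᶠ[codiscrete ℂ] fun z => c * Phi τ p T z := by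
  by_cases h0 : meromorphicOrderAt Ψ 0 = (-2 : ℤ)
  · obtain ⟨g, hg, -, hΨg⟩ := (meromorphicOrderAt_eq_int_iff (h.1 0)).mp h0
    obtain ⟨k, hk, hk1, hΦk⟩ := exists_Phi_lattice hp T (zero_mem_lattice τ)
    refine ⟨g 0, ?_⟩
    have h1 := h.sub_mul (isEllipticSymSqSolution_Phi hp T) (g 0)
    have h2 := h1.eq_zero hp (by
      intro hn
      obtain ⟨u, hu, hu0, hEu⟩ := (meromorphicOrderAt_eq_int_iff (h1.1 0)).mp hn
      have : u 0 = g 0 - g 0 * k 0 := by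
        refine eq_of_eventuallyEq_nhdsNE (f := u) (g := fun z => g z - g 0 * k z)
          hu.continuousAt (hg.continuousAt.sub (hk.continuousAt.const_mul _)) ?_
        filter_upwards [hEu, hΨg, hΦk, self_mem_nhdsWithin] with z e1 e2 e3 hne
        have hne : z ≠ 0 := hne
        rw [e2, e3] at e1
        simp only [sub_zero, smul_eq_mul] at e1
        refine mul_left_cancel₀ (zpow_ne_zero (-2) hne) ?_
        rw [← e1]
        ring
      rw [hk1, mul_one, sub_self] at this
      exact hu0 this)
    filter_upwards [h2] with z hz
    linear_combination hz
  · refine ⟨0, ?_⟩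
    filter_upwards [h.eq_zero hp h0] with z hz
    rw [hz, zero_mul]

/-! ### Primitives of meromorphic functions -/

/-- Removing singularities at all points of U simultaneously: the diagonal z ↦ k z z agrees near w
with the single function k w. -/
lemma exists_analytic_of_local {g : ℂ → ℂ} {U : Set ℂ}
    (h : ∀ w ∈ U, ∃ k : ℂ → ℂ, AnalyticAt ℂ k w ∧ g =ᶠ[𝓝[≠] w] k) (hU : IsOpen U) :
    ∃ G : ℂ → ℂ, ∀ w ∈ U, AnalyticAt ℂ G w ∧ G =ᶠ[𝓝[≠] w] g := by
  choose! k hk hgk using h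
  refine ⟨fun z => k z z, fun w hw => ?_⟩
  have h1 : (fun z => k z z) =ᶠ[𝓝 w] k w := by
    have h2 : ∀ᶠ z in 𝓝[≠] w, k z z = k w z := by
      filter_upwards [eventually_nhdsNE_eventually_nhds_iff.mpr (hgk w hw),
        (hU.eventually_mem hw).filter_mono nhdsWithin_le_nhds,
        (hk w hw).eventually_analyticAt.filter_mono nhdsWithin_le_nhds] with z e1 e2 e3
      refine eq_of_eventuallyEq_nhdsNE (hk z e2).continuousAt e3.continuousAt ?_
      filter_upwards [hgk z e2, e1.filter_mono nhdsWithin_le_nhds] with y f1 f2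
      rw [← f1, f2]
    filter_upwards [eventually_nhdsWithin_iff.mp h2] with z hz
    by_cases hzw : z = w
    · rw [hzw]
    · exact hz hzw
  exact ⟨(hk w hw).congr h1.symm,
    (h1.filter_mono nhdsWithin_le_nhds).trans (hgk w hw).symm⟩

/-- On a bounded convex open set, a meromorphic function is the sum of finitely many principal
parts and a derivative. -/
lemma exists_primitive_sub_sum {f : ℂ → ℂ} (hf : Meromorphic f) {U : Set ℂ} (hU : IsOpen U)
    (hconv : Convex ℝ U) (hb : Bornology.IsBounded U) (P : ℂ → ℂ → ℂ)
    (hP : ∀ w z, z ≠ w → AnalyticAt ℂ (P w) z)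
    (hfP : ∀ w ∈ U, ∃ k : ℂ → ℂ, AnalyticAt ℂ k w ∧ f =ᶠ[𝓝[≠] w] fun z => P w z + k z) :
    ∃ (s : Finset ℂ) (h : ℂ → ℂ), (∀ w ∈ U, AnalyticAt ℂ h w) ∧
      (∀ w, w ∈ s ↔ w ∈ U ∧ ¬ AnalyticAt ℂ f w) ∧
      ∀ w ∈ U, ∀ᶠ z in 𝓝[≠] w, HasDerivAt h (f z - ∑ w ∈ s, P w z) z := by
  classical
  -- The non-analytic points are discrete and U has compact closure, so only finitely many lie in U.
  have hfin : {w | w ∈ U ∧ ¬ AnalyticAt ℂ f w}.Finite := by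
    have hc : {z | AnalyticAt ℂ f z} ∈ codiscreteWithin (closure U) :=
      codiscreteWithin_mono (Set.subset_univ _) (eventually_codiscrete_analyticAt hf)
    refine (hb.isCompact_closure.finite_sdiff_of_mem_codiscreteWithin hc).subset ?_
    rintro w ⟨h1, h2⟩
    exact ⟨subset_closure h1, h2⟩
  have hs : ∀ w, w ∈ hfin.toFinset ↔ w ∈ U ∧ ¬ AnalyticAt ℂ f w := fun w => by simp
  set s := hfin.toFinset with hs_def
  obtain ⟨G, hG⟩ := exists_analytic_of_local (U := U) (g := fun z => f z - ∑ w ∈ s, P w z) (by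
    intro w hw
    by_cases hws : w ∈ s
    · obtain ⟨k, hk, hfk⟩ := hfP w hw
      refine ⟨fun z => k z - ∑ w' ∈ s.erase w, P w' z, hk.fun_sub
        (Finset.analyticAt_fun_sum _ fun w' hw' => hP w' w (Finset.ne_of_mem_erase hw').symm), ?_⟩
      filter_upwards [hfk] with z hz
      rw [hz, ← Finset.add_sum_erase _ _ hws]
      ring
    · have hfw : AnalyticAt ℂ f w := by
        by_contra h
        exact hws ((hs w).mpr ⟨hw, h⟩)
      refine ⟨_, hfw.fun_sub (Finset.analyticAt_fun_sum _ fun w' hw' => hP w' w ?_),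
        EventuallyEq.rfl⟩
      rintro rfl
      exact hws hw') hU
  obtain ⟨h, hh⟩ := hconv.exists_forall_hasDerivWithinAt (𝕜 := ℂ) (f := G)
    (fun w hw => (hG w hw).1.differentiableAt.differentiableWithinAt)
  have hh' : ∀ w ∈ U, HasDerivAt h (G w) w := fun w hw =>
    (hh w hw).hasDerivAt (hU.mem_nhds hw)
  refine ⟨s, h, fun w hw => ?_, hs, fun w hw => ?_⟩
  · exact DifferentiableOn.analyticAt (s := U)
      (fun z hz => (hh' z hz).differentiableAt.differentiableWithinAt) (hU.mem_nhds hw)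
  · filter_upwards [(hG w hw).2,
      (hU.eventually_mem hw).filter_mono nhdsWithin_le_nhds] with z h1 h2
    rw [← h1]
    exact hh' z h2

lemma hasDerivAt_prod_zpow (s : Finset ℂ) (m : ℂ → ℤ) {z : ℂ} (hz : z ∉ s) :
    HasDerivAt (fun z => ∏ w ∈ s, (z - w) ^ m w)
      ((∑ w ∈ s, (m w : ℂ) / (z - w)) * ∏ w ∈ s, (z - w) ^ m w) z := by
  classical
  induction s using Finset.induction_on with
  | empty => simpa using hasDerivAt_const z (1 : ℂ)
  | insert a s ha ih =>
    have hza : z - a ≠ 0 := sub_ne_zero.mpr fun h => hz (h ▸ Finset.mem_insert_self a s)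
    have h1 := (hasDerivAt_zpow (m a) (z - a) (Or.inl hza)).comp_sub_const z a
    have h2 := ih fun h => hz (Finset.mem_insert_of_mem h)
    simp only [Finset.prod_insert ha, Finset.sum_insert ha]
    refine (h1.fun_mul h2).congr_deriv ?_
    rw [zpow_sub_one₀ hza]
    field_simp

/-- A function with integer residues `m` is a logarithmic derivative on bounded convex sets. -/
lemma exists_log_primitive {f : ℂ → ℂ} (hf : Meromorphic f) {U : Set ℂ} (hU : IsOpen U)
    (hconv : Convex ℝ U) (hb : Bornology.IsBounded U) (m : ℂ → ℤ)
    (hfm : ∀ w ∈ U, ∃ k : ℂ → ℂ, AnalyticAt ℂ k w ∧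
      f =ᶠ[𝓝[≠] w] fun z => (m w : ℂ) / (z - w) + k z) :
    ∃ F : ℂ → ℂ, (∀ w ∈ U, ∃ (n : ℤ) (g : ℂ → ℂ), AnalyticAt ℂ g w ∧ g w ≠ 0 ∧
        (∀ z, F z = (z - w) ^ n * g z) ∧ (AnalyticAt ℂ f w → n = 0) ∧ (0 ≤ m w → 0 ≤ n)) ∧
      ∀ w ∈ U, ∀ᶠ z in 𝓝[≠] w, HasDerivAt F (f z * F z) z := by
  classical
  obtain ⟨s, h, hh, hs, hd⟩ := exists_primitive_sub_sum hf hU hconv hb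
    (fun w z => (m w : ℂ) / (z - w)) (fun w z hz => by
      have : z - w ≠ 0 := sub_ne_zero.mpr hz
      fun_prop (disch := assumption)) hfm
  refine ⟨fun z => (∏ w ∈ s, (z - w) ^ m w) * Complex.exp (h z), fun w hw => ?_, fun w hw => ?_⟩
  · have hprod : ∀ t : Finset ℂ, w ∉ t →
        AnalyticAt ℂ (fun z => (∏ w ∈ t, (z - w) ^ m w) * Complex.exp (h z)) w ∧
        (∏ w' ∈ t, (w - w') ^ m w') * Complex.exp (h w) ≠ 0 := by
      intro t ht
      have hne : ∀ w' ∈ t, w - w' ≠ 0 := fun w' hw' h => ht (by rwa [sub_eq_zero.mp h])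
      have := hh w hw
      refine ⟨(Finset.analyticAt_fun_prod _ fun w' hw' => ?_).fun_mul this.cexp', ?_⟩
      · have h1 : AnalyticAt ℂ (fun z : ℂ => z - w') w := by fun_prop
        exact h1.fun_zpow (hne w' hw')
      · exact mul_ne_zero (Finset.prod_ne_zero_iff.mpr fun w' hw' => zpow_ne_zero _ (hne w' hw'))
          (Complex.exp_ne_zero _)
    by_cases hws : w ∈ s
    · obtain ⟨h1, h2⟩ := hprod (s.erase w) (Finset.notMem_erase w s)
      refine ⟨m w, _, h1, h2, fun z => ?_, fun h3 => absurd h3 ((hs w).mp hws).2, id⟩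
      simp only
      rw [← Finset.mul_prod_erase _ _ hws, mul_assoc]
    · obtain ⟨h1, h2⟩ := hprod s hws
      exact ⟨0, _, h1, h2, fun z => by rw [zpow_zero, one_mul], fun _ => rfl, fun _ => le_rfl⟩
  · have hs' : ∀ᶠ z in 𝓝[≠] w, z ∉ s :=
      eventually_codiscrete_iff.mp s.finite_toSet.compl_mem_codiscrete w
    filter_upwards [hd w hw, hs'] with z h1 h2
    refine ((hasDerivAt_prod_zpow s m h2).fun_mul h1.cexp).congr_deriv ?_
    ring

/-- A function without residues has a meromorphic primitive on bounded convex sets. -/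
lemma exists_primitive {f : ℂ → ℂ} (hf : Meromorphic f) {U : Set ℂ} (hU : IsOpen U)
    (hconv : Convex ℝ U) (hb : Bornology.IsBounded U) (hres : ∀ w ∈ U, HasResidueFreePart f w) :
    ∃ F : ℂ → ℂ, (∀ w ∈ U, MeromorphicAt F w ∧ (AnalyticAt ℂ f w → AnalyticAt ℂ F w)) ∧
      ∀ w ∈ U, ∀ᶠ z in 𝓝[≠] w, HasDerivAt F (f z) z := by
  choose! A B k hk hfk using hres
  obtain ⟨s, h, hh, hs, hd⟩ := exists_primitive_sub_sum hf hU hconv hb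
    (fun w z => A w / (z - w) ^ 2 + B w / (z - w) ^ 3) (fun w z hz => by
      have h1 : z - w ≠ 0 := sub_ne_zero.mpr hz
      have h2 : (z - w) ^ 2 ≠ 0 := pow_ne_zero _ h1
      have h3 : (z - w) ^ 3 ≠ 0 := pow_ne_zero _ h1
      fun_prop (disch := assumption)) (fun w hw => ⟨k w, hk w hw, hfk w hw⟩)
  refine ⟨fun z => h z - ∑ w ∈ s, (A w / (z - w) + B w / 2 / (z - w) ^ 2), fun w hw => ⟨?_, ?_⟩,
    fun w hw => ?_⟩
  · have h1 : MeromorphicAt h w := (hh w hw).meromorphicAt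
    have h2 : MeromorphicAt (fun z => ∑ w ∈ s, (A w / (z - w) + B w / 2 / (z - w) ^ 2)) w :=
      MeromorphicAt.fun_sum fun w' => by fun_prop
    exact h1.fun_sub h2
  · intro hfw
    refine (hh w hw).fun_sub (Finset.analyticAt_fun_sum _ fun w' hw' => ?_)
    have h1 : w - w' ≠ 0 := sub_ne_zero.mpr (by
      rintro rfl
      exact ((hs _).mp hw').2 hfw)
    have h2 : (w - w') ^ 2 ≠ 0 := pow_ne_zero _ h1
    fun_prop (disch := assumption)
  · have hs' : ∀ᶠ z in 𝓝[≠] w, z ∉ s :=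
      eventually_codiscrete_iff.mp s.finite_toSet.compl_mem_codiscrete w
    filter_upwards [hd w hw, hs'] with z h1 h2
    refine (h1.fun_sub (HasDerivAt.fun_sum (u := s)
      (A' := fun w => -(A w / (z - w) ^ 2) - B w / (z - w) ^ 3) fun w' hw' => ?_)).congr_deriv ?_
    · have hne : z - w' ≠ 0 := sub_ne_zero.mpr (by rintro rfl; exact h2 hw')
      have e0 := (hasDerivAt_id z).sub_const w'
      have e1 := ((e0.fun_inv hne).const_mul (A w')).fun_add
        (((e0.fun_pow 2).fun_inv (pow_ne_zero _ hne)).const_mul (B w' / 2))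
      simp only [id] at e1
      refine (e1.congr_of_eventuallyEq (Eventually.of_forall fun y => ?_)).congr_deriv ?_
      · simp only [div_eq_mul_inv]
      · push_cast
        field_simp
        ring
    · rw [sub_sub, ← Finset.sum_add_distrib]
      simp only [Finset.sum_sub_distrib, Finset.sum_neg_distrib, Finset.sum_add_distrib]
      ring

/-- Gluing functions on an exhaustion by balls. -/
lemma exists_glue (c : ℂ) (F : ℕ → ℂ → ℂ) (h : ∀ (m n : ℕ) (w : ℂ), w ∈ Metric.ball c m →
    w ∈ Metric.ball c n → F m =ᶠ[𝓝[≠] w] F n) :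
    ∃ G : ℂ → ℂ, ∀ (n : ℕ) (w : ℂ), w ∈ Metric.ball c n → G =ᶠ[𝓝[≠] w] F n := by
  -- The index grows with z; the added 1 puts z, and points near it, strictly inside the open ball.
  -- Near w only finitely many indices occur, so finitely many agreements suffice.
  refine ⟨fun z => F (⌈dist z c⌉₊ + 1) z, fun n w hw => ?_⟩
  obtain ⟨M, hM⟩ := exists_nat_gt (dist w c + 2)
  have h1 : ∀ᶠ z in 𝓝[≠] w, ∀ k ∈ Finset.range (M + 2), w ∈ Metric.ball c k → F k z = F n z := by
    rw [eventually_all_finset]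
    intro k _
    by_cases hk : w ∈ Metric.ball c k
    · exact (h k n w hk hw).mono fun z hz _ => hz
    · exact Eventually.of_forall fun z hz => absurd hz hk
  filter_upwards [h1, nhdsWithin_le_nhds (Metric.ball_mem_nhds w one_pos)] with z h2 h3
  have h3 : dist z w < 1 := h3
  have h4 := dist_triangle w z c
  have h5 := dist_triangle z w c
  rw [dist_comm w z] at h4
  refine h2 _ ?_ ?_
  · rw [Finset.mem_range]
    have : ⌈dist z c⌉₊ ≤ M := Nat.ceil_le.mpr (by linarith)
    omega
  · rw [Metric.mem_ball]
    push_cast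
    have := Nat.le_ceil (dist z c)
    linarith

lemma eventuallyEq_of_preconnected {f g : ℂ → ℂ} {U : Set ℂ} (hU : IsPreconnected U)
    (hf : MeromorphicOn f U) (hg : MeromorphicOn g U) {a w : ℂ} (ha : a ∈ U) (hw : w ∈ U)
    (h : f =ᶠ[𝓝[≠] a] g) : f =ᶠ[𝓝[≠] w] g := by
  by_contra hz
  have hz' : meromorphicOrderAt (f - g) w ≠ ⊤ := by
    rw [Ne, meromorphicOrderAt_eq_top_iff]
    intro h'
    exact hz (h'.mono fun y hy => sub_eq_zero.mp hy)
  refine (hf.sub hg).meromorphicOrderAt_ne_top_of_isPreconnected hU hw ha hz'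
    (meromorphicOrderAt_eq_top_iff.mpr ?_)
  filter_upwards [h] with y hy
  simp [hy]

lemma ball_inter_ball_mem {c w : ℂ} {m n : ℕ} (hm : w ∈ Metric.ball c m)
    (hn : w ∈ Metric.ball c n) : w ∈ Metric.ball c (min (m : ℝ) n) :=
  Metric.mem_ball.mpr (lt_min hm hn)

/-- A meromorphic function with integer residues is a logarithmic derivative. -/
lemma exists_global_log_primitive {f : ℂ → ℂ} (hf : Meromorphic f) (m : ℂ → ℤ)
    (hfm : ∀ w, ∃ k : ℂ → ℂ, AnalyticAt ℂ k w ∧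
      f =ᶠ[𝓝[≠] w] fun z => (m w : ℂ) / (z - w) + k z) :
    ∃ F : ℂ → ℂ, Meromorphic F ∧ (∀ z, meromorphicOrderAt F z ≠ ⊤) ∧
      ∀ᶠ z in codiscrete ℂ, HasDerivAt F (f z * F z) z := by
  obtain ⟨c, hc⟩ : ∃ c, AnalyticAt ℂ f c :=
    ((eventually_codiscrete_iff.mp (eventually_codiscrete_analyticAt hf)) 0).exists
  choose F hF hFd using fun n : ℕ => exists_log_primitive hf (Metric.isOpen_ball (x := c) (ε := n))
    (convex_ball c n) Metric.isBounded_ball m (fun w _ => hfm w)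
  have hmer : ∀ n : ℕ, ∀ w ∈ Metric.ball c (n : ℝ), MeromorphicAt (F n) w ∧
      meromorphicOrderAt (F n) w ≠ ⊤ := by
    intro n w hw
    obtain ⟨k, g, hg, hg0, hFg, -, -⟩ := hF n w hw
    have h1 : MeromorphicAt (F n) w := by
      rw [funext hFg]
      have := hg.meromorphicAt
      fun_prop
    refine ⟨h1, ?_⟩
    rw [(meromorphicOrderAt_eq_int_iff h1 (n := k)).mpr ⟨g, hg, hg0, Eventually.of_forall hFg⟩]
    exact WithTop.coe_ne_top
  have hat : ∀ n : ℕ, 0 < n → AnalyticAt ℂ (F n) c ∧ F n c ≠ 0 := by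
    intro n hn
    obtain ⟨k, g, hg, hg0, hFg, hk, -⟩ := hF n c (Metric.mem_ball_self (by exact_mod_cast hn))
    have hFn : F n = g := by
      ext z
      rw [hFg z, hk hc, zpow_zero, one_mul]
    rw [hFn]
    exact ⟨hg, hg0⟩
  -- Local solutions are unique up to a factor, and normalizing to the value 1 at the regular point
  -- c makes them agree.
  have hloc : ∀ m n : ℕ, 0 < m → 0 < n →
      (fun z => F m z / F m c) =ᶠ[𝓝[≠] c] fun z => F n z / F n c := by
    intro m n hm hn
    obtain ⟨a1, a2⟩ := hat m hm
    obtain ⟨b1, b2⟩ := hat n hn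
    have hm' : c ∈ Metric.ball c (m : ℝ) := Metric.mem_ball_self (by exact_mod_cast hm)
    have hn' : c ∈ Metric.ball c (n : ℝ) := Metric.mem_ball_self (by exact_mod_cast hn)
    have hq : AnalyticAt ℂ (fun z => F m z / F n z) c := a1.fun_div b1 b2
    obtain ⟨k, hk⟩ := exists_eventuallyEq_const_of_deriv hq.meromorphicAt (by
      filter_upwards [hFd m c hm', hFd n c hn',
        (b1.continuousAt.eventually_ne b2).filter_mono nhdsWithin_le_nhds] with z h1 h2 h3
      rw [(h1.fun_div h2 h3).deriv]
      field_simp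
      ring)
    have hkc := eq_of_eventuallyEq_nhdsNE hq.continuousAt continuousAt_const hk
    filter_upwards [hk, (b1.continuousAt.eventually_ne b2).filter_mono nhdsWithin_le_nhds]
      with z h1 h2
    rw [← hkc] at h1
    field_simp at h1 ⊢
    linear_combination h1
  have hpos : ∀ (n : ℕ) (w : ℂ), w ∈ Metric.ball c (n : ℝ) → 0 < n := fun n w hw => by
    have : (0 : ℝ) < n := dist_nonneg.trans_lt hw
    exact_mod_cast this
  obtain ⟨G, hG⟩ := exists_glue c (fun n z => F n z / F n c) (by
    intro m n w hm hn
    refine eventuallyEq_of_preconnected (U := Metric.ball c (min (m : ℝ) n)) (a := c)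
      (convex_ball _ _).isPreconnected ?_ ?_ ?_ (ball_inter_ball_mem hm hn)
      (hloc m n (hpos m w hm) (hpos n w hn))
    · intro z hz
      have := (hmer m z (Metric.ball_subset_ball (min_le_left _ _) hz)).1
      fun_prop
    · intro z hz
      have := (hmer n z (Metric.ball_subset_ball (min_le_right _ _) hz)).1
      fun_prop
    · exact Metric.mem_ball_self (lt_min (by exact_mod_cast hpos m w hm)
        (by exact_mod_cast hpos n w hn)))
  have hex : ∀ w : ℂ, ∃ n : ℕ, w ∈ Metric.ball c (n : ℝ) := fun w => exists_nat_gt (dist w c)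
  refine ⟨G, fun w => ?_, fun w => ?_, ?_⟩
  · obtain ⟨n, hn⟩ := hex w
    have h1 := (hmer n w hn).1
    have h2 : MeromorphicAt (fun z => F n z / F n c) w := by fun_prop
    exact h2.congr (hG n w hn).symm
  · obtain ⟨n, hn⟩ := hex w
    have h1 := hmer n w hn
    rw [meromorphicOrderAt_congr (hG n w hn)]
    simp only [div_eq_mul_inv]
    have hc0 : (F n c)⁻¹ ≠ 0 := inv_ne_zero (hat n (hpos n w hn)).2
    have h2 : meromorphicOrderAt (fun _ : ℂ => (F n c)⁻¹) w = 0 := by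
      rw [meromorphicOrderAt_const, if_neg hc0]
    have := meromorphicOrderAt_mul h1.1 (MeromorphicAt.const (F n c)⁻¹ w)
    rw [h2, add_zero] at this
    exact this ▸ h1.2
  · rw [eventually_codiscrete_iff]
    intro w
    obtain ⟨n, hn⟩ := hex w
    filter_upwards [hFd n w hn, eventually_nhdsNE_eventually_nhds_iff.mpr (hG n w hn)] with z h1 h2
    refine ((h1.div_const (F n c)).congr_of_eventuallyEq h2).congr_deriv ?_
    rw [h2.self_of_nhds]
    ring

/-- A meromorphic function without residues has a meromorphic primitive. -/
lemma exists_global_primitive {f : ℂ → ℂ} (hf : Meromorphic f)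
    (hres : ∀ w, HasResidueFreePart f w) :
    ∃ F : ℂ → ℂ, Meromorphic F ∧ ∀ᶠ z in codiscrete ℂ, HasDerivAt F (f z) z := by
  obtain ⟨c, hc⟩ : ∃ c, AnalyticAt ℂ f c :=
    ((eventually_codiscrete_iff.mp (eventually_codiscrete_analyticAt hf)) 0).exists
  choose F hF hFd using fun n : ℕ => exists_primitive hf (Metric.isOpen_ball (x := c) (ε := n))
    (convex_ball c n) Metric.isBounded_ball (fun w _ => hres w)
  have hloc : ∀ m n : ℕ, 0 < m → 0 < n →
      (fun z => F m z - F m c) =ᶠ[𝓝[≠] c] fun z => F n z - F n c := by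
    intro m n hm hn
    have hm' : c ∈ Metric.ball c (m : ℝ) := Metric.mem_ball_self (by exact_mod_cast hm)
    have hn' : c ∈ Metric.ball c (n : ℝ) := Metric.mem_ball_self (by exact_mod_cast hn)
    have a1 := (hF m c hm').2 hc
    have b1 := (hF n c hn').2 hc
    have hq : AnalyticAt ℂ (fun z => F m z - F n z) c := a1.fun_sub b1
    obtain ⟨k, hk⟩ := exists_eventuallyEq_const_of_deriv hq.meromorphicAt (by
      filter_upwards [hFd m c hm', hFd n c hn'] with z h1 h2
      rw [(h1.fun_sub h2).deriv, sub_self])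
    have hkc := eq_of_eventuallyEq_nhdsNE hq.continuousAt continuousAt_const hk
    filter_upwards [hk] with z h1
    rw [← hkc] at h1
    linear_combination h1
  have hpos : ∀ (n : ℕ) (w : ℂ), w ∈ Metric.ball c (n : ℝ) → 0 < n := fun n w hw => by
    have : (0 : ℝ) < n := dist_nonneg.trans_lt hw
    exact_mod_cast this
  obtain ⟨G, hG⟩ := exists_glue c (fun n z => F n z - F n c) (by
    intro m n w hm hn
    refine eventuallyEq_of_preconnected (U := Metric.ball c (min (m : ℝ) n)) (a := c)
      (convex_ball _ _).isPreconnected ?_ ?_ ?_ (ball_inter_ball_mem hm hn)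
      (hloc m n (hpos m w hm) (hpos n w hn))
    · intro z hz
      have := (hF m z (Metric.ball_subset_ball (min_le_left _ _) hz)).1
      fun_prop
    · intro z hz
      have := (hF n z (Metric.ball_subset_ball (min_le_right _ _) hz)).1
      fun_prop
    · exact Metric.mem_ball_self (lt_min (by exact_mod_cast hpos m w hm)
        (by exact_mod_cast hpos n w hn)))
  have hex : ∀ w : ℂ, ∃ n : ℕ, w ∈ Metric.ball c (n : ℝ) := fun w => exists_nat_gt (dist w c)
  refine ⟨G, fun w => ?_, ?_⟩
  · obtain ⟨n, hn⟩ := hex w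
    have h1 := (hF n w hn).1
    have h2 : MeromorphicAt (fun z => F n z - F n c) w := by fun_prop
    exact h2.congr (hG n w hn).symm
  · rw [eventually_codiscrete_iff]
    intro w
    obtain ⟨n, hn⟩ := hex w
    filter_upwards [hFd n w hn, eventually_nhdsNE_eventually_nhds_iff.mpr (hG n w hn)] with z h1 h2
    exact (h1.sub_const (F n c)).congr_of_eventuallyEq h2

/-! ### Residues of `φ` and Baker–Akhiezer functions -/

lemma exists_Phi_factor {τ : ℍ} {p : ℂ} (hp : 2 * p ∉ (periods τ).lattice) (T w : ℂ) :
    ∃ (n : ℤ) (g : ℂ → ℂ), AnalyticAt ℂ g w ∧ g w ≠ 0 ∧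
      (Phi τ p T =ᶠ[𝓝[≠] w] fun z => (z - w) ^ n * g z) ∧ meromorphicOrderAt (Phi τ p T) w = n := by
  obtain ⟨n, hn⟩ := WithTop.ne_top_iff_exists.mp (order_Phi_ne_top hp T w)
  obtain ⟨g, hg, hg0, h⟩ := (meromorphicOrderAt_eq_int_iff (meromorphic_Phi τ p T w)).mp hn.symm
  exact ⟨n, g, hg, hg0, h, hn.symm⟩

lemma Phi_spectral_nhdsNE {τ : ℍ} {p : ℂ} (hp : 2 * p ∉ (periods τ).lattice) (T w : ℂ) :
    ∀ᶠ z in 𝓝[≠] w,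
      1 / 2 * Phi τ p T z * deriv (deriv (Phi τ p T)) z - 1 / 4 * deriv (Phi τ p T) z ^ 2
        - potential τ p T z * Phi τ p T z ^ 2 = spectralQ τ p T :=
  (eventually_codiscrete_iff.mp (eventually_codiscrete_notMem_singularSet τ p) w).mono
    fun _ hz => Phi_spectral hp T hz

/-- The part Φ'/(2Φ) contributes residue n/2, while iC/Φ is regular if Φ does not vanish at w and is
absent if C = 0. -/
lemma phi_residue_of_factor {τ : ℍ} {p T C w : ℂ} {n : ℤ} {g : ℂ → ℂ} (hg : AnalyticAt ℂ g w)
    (hg0 : g w ≠ 0) (hΦ : Phi τ p T =ᶠ[𝓝[≠] w] fun z => (z - w) ^ n * g z)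
    (h : C = 0 ∨ n ≤ 0) :
    ∃ k : ℂ → ℂ, AnalyticAt ℂ k w ∧
      phi τ p T C =ᶠ[𝓝[≠] w] fun z => (n / 2 : ℂ) / (z - w) + k z := by
  have hd := deriv_zpow_mul hg hΦ
  have hg' := hg.deriv
  -- For n > 0 the truncated exponent is meaningless, but then C = 0 and the term disappears.
  refine ⟨fun z => deriv g z / (2 * g z) + Complex.I * C * (z - w) ^ (-n).toNat / g z,
    by fun_prop (disch := simpa using hg0), ?_⟩
  filter_upwards [hΦ, hd, self_mem_nhdsWithin,
    (hg.continuousAt.eventually_ne hg0).filter_mono nhdsWithin_le_nhds] with z h1 h2 hne hgz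
  have hne : z - w ≠ 0 := sub_ne_zero.mpr hne
  have hpow := zpow_ne_zero n hne
  have e : Complex.I * C * (z - w) ^ (-n).toNat / g z =
      Complex.I * C / ((z - w) ^ n * g z) := by
    rcases h with h | h
    · simp [h]
    · rw [← zpow_natCast, Int.toNat_of_nonneg (by omega), zpow_neg]
      field_simp
  rw [phi, h1, h2, e, factorDeriv, zpow_sub_one₀ hne]
  field_simp
  ring

/-- At a simple zero iC/Φ has a simple pole as well, contributing iC/g(w) to the residue. -/
lemma phi_residue_of_factor_one {τ : ℍ} {p T C w : ℂ} {g : ℂ → ℂ} (hg : AnalyticAt ℂ g w)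
    (hg0 : g w ≠ 0) (hΦ : Phi τ p T =ᶠ[𝓝[≠] w] fun z => (z - w) ^ (1 : ℤ) * g z) :
    ∃ k : ℂ → ℂ, AnalyticAt ℂ k w ∧
      phi τ p T C =ᶠ[𝓝[≠] w] fun z => (1 / 2 + Complex.I * C / g w) / (z - w) + k z := by
  have hd := deriv_zpow_mul hg hΦ
  have hg' := hg.deriv
  obtain ⟨u, hu, -, hgu⟩ := exists_eq_add_mul (hg.fun_inv hg0)
  refine ⟨fun z => deriv g z / (2 * g z) + Complex.I * C * u z,
    by fun_prop (disch := simpa using hg0), ?_⟩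
  filter_upwards [hΦ, hd, self_mem_nhdsWithin,
    (hg.continuousAt.eventually_ne hg0).filter_mono nhdsWithin_le_nhds] with z h1 h2 hne hgz
  have hne : z - w ≠ 0 := sub_ne_zero.mpr hne
  have e : u z = ((g z)⁻¹ - (g w)⁻¹) / (z - w) := by
    rw [hgu z]
    field_simp
    ring
  rw [phi, h1, h2, e, factorDeriv, zpow_sub_one₀ hne, zpow_one]
  push_cast
  field_simp
  ring

/-- If C ≠ 0, zeros of Φ are simple, and with h the leading coefficient of q, Q = -g²(1/4 + h) gives
(2iC/g)² = 1 + 4h, which is 1, 9 or 4. If C = 0, the order of Φ off `S` is 0 or 2. Residue 0 or 1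
makes exp ∫φ holomorphic; half-integral residues make exp ∫2φ meromorphic. -/
lemma exists_phi_residue {τ : ℍ} {p : ℂ} (hp : 2 * p ∉ (periods τ).lattice) {T C : ℂ}
    (hC : C ^ 2 = spectralQ τ p T) (w : ℂ) :
    ∃ (a : ℂ) (k : ℂ → ℂ), AnalyticAt ℂ k w ∧
      (phi τ p T C =ᶠ[𝓝[≠] w] fun z => a / (z - w) + k z) ∧
      (w ∉ singularSet τ p → a = 0 ∨ a = 1) ∧
      (spectralQ τ p T ≠ 0 → ∃ m : ℤ, 2 * a = m) := by
  obtain ⟨n, g, hg, hg0, hΦ, hn⟩ := exists_Phi_factor hp T w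
  obtain ⟨h, hh, hq, hcases⟩ := exists_potential_local hp T w
  have hspec := Phi_spectral_nhdsNE hp T w
  have hn0 : w ∉ singularSet τ p → 0 ≤ n := by
    intro hw
    have := (analyticAt_Phi T hw).meromorphicOrderAt_nonneg
    rw [hn] at this
    exact_mod_cast this
  have hκ : w ∉ singularSet τ p → h w = 0 := by
    intro hw
    rcases hcases with ⟨-, h1⟩ | ⟨h1, -⟩ | ⟨h1, -⟩
    · exact h1
    · exact absurd (Or.inl h1) hw
    · exact absurd (Or.inr h1) hw
  have hmain : C = 0 ∨ (C ≠ 0 ∧ n ≤ 0) ∨ n = 1 := by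
    by_cases hC0 : C = 0
    · exact Or.inl hC0
    · by_cases h2 : 2 ≤ n
      · have := spectral_eq_zero_of_two_le hg hΦ hh hq hspec h2
        rw [this] at hC
        exact absurd (by simpa using hC) hC0
      · rcases le_or_gt n 0 with h3 | h3
        · exact Or.inr (Or.inl ⟨hC0, h3⟩)
        · exact Or.inr (Or.inr (by omega))
  rcases hmain with hC0 | ⟨hC0, hn'⟩ | rfl
  · have hQ : spectralQ τ p T = 0 := by rw [← hC, hC0]; ring
    obtain ⟨k, hk, hφ⟩ := phi_residue_of_factor (C := C) hg hg0 hΦ (Or.inl hC0)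
    refine ⟨_, k, hk, hφ, fun hw => ?_, fun h => absurd hQ h⟩
    rw [hQ] at hspec
    have h1 := order_eq_of_spectral_zero hg hg0 hΦ hh hq hspec
    rw [hκ hw] at h1
    have h2 : (n : ℂ) / 2 * ((n : ℂ) / 2 - 1) = 0 := by linear_combination h1
    rcases mul_eq_zero.mp h2 with h3 | h3
    · exact Or.inl h3
    · exact Or.inr (by linear_combination h3)
  · obtain ⟨k, hk, hφ⟩ := phi_residue_of_factor (C := C) hg hg0 hΦ (Or.inr hn')
    refine ⟨_, k, hk, hφ, fun hw => Or.inl ?_, fun _ => ⟨n, by ring⟩⟩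
    rw [le_antisymm hn' (hn0 hw)]
    simp
  · obtain ⟨k, hk, hφ⟩ := phi_residue_of_factor_one (C := C) hg hg0 hΦ
    have hQ := spectral_eq_of_order_one hg hΦ hh hq hspec
    set u := Complex.I * C / g w with hu
    have hu2 : (2 * u) ^ 2 = 1 + 4 * h w := by
      have : (2 * u) ^ 2 = -4 * C ^ 2 / g w ^ 2 := by
        rw [hu, mul_pow, div_pow, mul_pow, Complex.I_sq]
        ring
      rw [this, hC, hQ]
      field_simp
    have hsq : ∀ r : ℂ, (2 * u) ^ 2 = r ^ 2 → 2 * u = r ∨ 2 * u = -r := fun r =>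
      sq_eq_sq_iff_eq_or_eq_neg.mp
    refine ⟨_, k, hk, hφ, fun hw => ?_, fun _ => ?_⟩
    · rcases hsq 1 (by rw [hu2, hκ hw]; norm_num) with h1 | h1
      · exact Or.inr (by linear_combination h1 / 2)
      · exact Or.inl (by linear_combination h1 / 2)
    · have : ∃ r : ℤ, (2 * u) ^ 2 = (r : ℂ) ^ 2 := by
        rcases hcases with ⟨-, h1⟩ | ⟨-, h1⟩ | ⟨-, h1⟩
        · exact ⟨1, by rw [hu2, h1]; norm_num⟩
        · exact ⟨3, by rw [hu2, h1]; norm_num⟩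
        · exact ⟨2, by rw [hu2, h1]; norm_num⟩
      obtain ⟨r, hr⟩ := this
      rcases hsq r hr with h1 | h1
      · exact ⟨1 + r, by push_cast; linear_combination h1⟩
      · exact ⟨1 - r, by push_cast; linear_combination h1⟩

lemma meromorphic_phi (τ : ℍ) (p T C : ℂ) : Meromorphic (phi τ p T C) := by
  have h1 := meromorphic_Phi τ p T
  have h2 := h1.deriv
  unfold phi
  fun_prop

lemma isPeriodic_phi {τ : ℍ} {p : ℂ} (hp : 2 * p ∉ (periods τ).lattice) (T C : ℂ) :
    IsPeriodic τ (phi τ p T C) :=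
  (isPeriodic_Phi hp T).comp₂ (isPeriodic_Phi hp T).deriv
    (fun u v => (Complex.I * C + v / 2) / u)

lemma Phi_eventually_ne {τ : ℍ} {p : ℂ} (hp : 2 * p ∉ (periods τ).lattice) (T w : ℂ) :
    ∀ᶠ z in 𝓝[≠] w, Phi τ p T z ≠ 0 :=
  eventually_codiscrete_iff.mp
    (eventually_codiscrete_ne_zero (meromorphic_Phi τ p T) (order_Phi_ne_top hp T)) w

/-- The Riccati equation `φ' + φ² = q`. -/
lemma hasDerivAt_phi {τ : ℍ} {p : ℂ} (hp : 2 * p ∉ (periods τ).lattice) {T C z : ℂ}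
    (hC : C ^ 2 = spectralQ τ p T) (hz : z ∉ singularSet τ p) (hΦ : Phi τ p T z ≠ 0) :
    HasDerivAt (phi τ p T C) (potential τ p T z - phi τ p T C z ^ 2) z := by
  have a := analyticAt_Phi T hz
  have hs := Phi_spectral hp T hz
  refine (((a.deriv.differentiableAt.hasDerivAt.div_const 2).const_add (Complex.I * C)).fun_div
    a.differentiableAt.hasDerivAt hΦ).congr_deriv ?_
  simp only [phi]
  field_simp
  linear_combination 4 * hs - 4 * hC + 4 * C ^ 2 * Complex.I_sq

/-- `F` is a local Baker–Akhiezer function near `w`: holomorphic, not identically zero, with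
`F' = φ F`. -/
def IsBakerAkhiezerAt (τ : ℍ) (p T C : ℂ) (F : ℂ → ℂ) (w : ℂ) : Prop :=
  AnalyticAt ℂ F w ∧ ∀ᶠ z in 𝓝[≠] w, F z ≠ 0 ∧ HasDerivAt F (phi τ p T C z * F z) z

/-- The Riccati equation gives F'' = (φ' + φ²)F = qF off the zeros of Φ, and both sides are
continuous. -/
lemma IsBakerAkhiezerAt.deriv_deriv {τ : ℍ} {p : ℂ} (hp : 2 * p ∉ (periods τ).lattice) {T C : ℂ}
    (hC : C ^ 2 = spectralQ τ p T) {F : ℂ → ℂ} {w : ℂ} (hF : IsBakerAkhiezerAt τ p T C F w)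
    (hw : w ∉ singularSet τ p) :
    ∀ᶠ z in 𝓝 w, deriv (deriv F) z = potential τ p T z * F z := by
  have a1 := hF.1.deriv.deriv
  have a2 := (analyticAt_potential T hw).fun_mul hF.1
  refine eventuallyEq_nhds_of_nhdsNE a1.continuousAt a2.continuousAt ?_
  filter_upwards [eventually_nhdsNE_eventually_nhds_iff.mpr hF.2, Phi_eventually_ne hp T w,
    (eventually_nhds_notMem_singularSet hw).filter_mono nhdsWithin_le_nhds] with z h1 h2 h3
  have e : deriv F =ᶠ[𝓝 z] fun z => phi τ p T C z * F z := h1.mono fun y hy => hy.2.deriv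
  rw [e.deriv_eq, ((hasDerivAt_phi hp hC h3 h2).fun_mul h1.self_of_nhds.2).deriv]
  ring

/-- Baker–Akhiezer functions exist on bounded convex sets without singular points. -/
lemma exists_bakerAkhiezer {τ : ℍ} {p : ℂ} (hp : 2 * p ∉ (periods τ).lattice) {T C : ℂ}
    (hC : C ^ 2 = spectralQ τ p T) {U : Set ℂ} (hU : IsOpen U)
    (hconv : Convex ℝ U) (hb : Bornology.IsBounded U) (hUS : U ⊆ (singularSet τ p)ᶜ) :
    ∃ F : ℂ → ℂ, ∀ w ∈ U, IsBakerAkhiezerAt τ p T C F w := by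
  have hm : ∀ w ∈ U, ∃ m : ℤ, 0 ≤ m ∧ ∃ k : ℂ → ℂ, AnalyticAt ℂ k w ∧
      phi τ p T C =ᶠ[𝓝[≠] w] fun z => (m : ℂ) / (z - w) + k z := by
    intro w hw
    obtain ⟨a, k, hk, hφ, ha, -⟩ := exists_phi_residue hp hC w
    rcases ha (hUS hw) with rfl | rfl
    · exact ⟨0, le_rfl, k, hk, by simpa using hφ⟩
    · exact ⟨1, zero_le_one, k, hk, by simpa using hφ⟩
  choose! m hm0 hm using hm
  obtain ⟨F, hF, hFd⟩ := exists_log_primitive (meromorphic_phi τ p T C) hU hconv hb m hm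
  refine ⟨F, fun w hw => ?_⟩
  obtain ⟨n, g, hg, hg0, hFg, -, hn⟩ := hF w hw
  have hn := hn (hm0 w hw)
  refine ⟨?_, ?_⟩
  · have : F = fun z => (z - w) ^ n.toNat * g z := by
      ext z
      rw [hFg z, ← zpow_natCast, Int.toNat_of_nonneg hn]
    rw [this]
    fun_prop
  · filter_upwards [hFd w hw, self_mem_nhdsWithin,
      (hg.continuousAt.eventually_ne hg0).filter_mono nhdsWithin_le_nhds] with z h1 hne h2
    exact ⟨by rw [hFg z]; exact mul_ne_zero (zpow_ne_zero _ (sub_ne_zero.mpr hne)) h2, h1⟩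

/-- Solutions of `y' = f y` are proportional. -/
lemma exists_eq_mul_of_log_deriv {f y₁ y₂ : ℂ → ℂ} {w : ℂ} (h1 : MeromorphicAt y₁ w)
    (h2 : MeromorphicAt y₂ w) (hd1 : ∀ᶠ z in 𝓝[≠] w, HasDerivAt y₁ (f z * y₁ z) z)
    (hd2 : ∀ᶠ z in 𝓝[≠] w, HasDerivAt y₂ (f z * y₂ z) z) (h0 : ∀ᶠ z in 𝓝[≠] w, y₂ z ≠ 0) :
    ∃ k : ℂ, y₁ =ᶠ[𝓝[≠] w] fun z => k * y₂ z := by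
  obtain ⟨k, hk⟩ := exists_eventuallyEq_const_of_deriv (f := fun z => y₁ z / y₂ z)
    (by fun_prop) (by
      filter_upwards [hd1, hd2, h0] with z e1 e2 e3
      rw [(e1.fun_div e2 e3).deriv]
      field_simp
      ring)
  refine ⟨k, ?_⟩
  filter_upwards [hk, h0] with z e1 e2
  rw [← e1, div_mul_cancel₀ _ e2]

lemma hasDerivAt_Phi_log {τ : ℍ} {p : ℂ} (hp : 2 * p ∉ (periods τ).lattice) (T w : ℂ) :
    ∀ᶠ z in 𝓝[≠] w, HasDerivAt (Phi τ p T)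
      (deriv (Phi τ p T) z / Phi τ p T z * Phi τ p T z) z := by
  filter_upwards [Phi_eventually_ne hp T w, eventually_codiscrete_iff.mp
    (eventually_codiscrete_notMem_singularSet τ p) w] with z h1 h2
  rw [div_mul_cancel₀ _ h1]
  exact (analyticAt_Phi T h2).differentiableAt.hasDerivAt

/-! ### Complete reducibility when `Q(T) ≠ 0` -/

lemma IsBakerAkhiezerAt.const_mul {τ : ℍ} {p T C : ℂ} {F : ℂ → ℂ} {w : ℂ}
    (h : IsBakerAkhiezerAt τ p T C F w) {k : ℂ} (hk : k ≠ 0) :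
    IsBakerAkhiezerAt τ p T C (fun z => k * F z) w := by
  refine ⟨analyticAt_const.fun_mul h.1, h.2.mono fun z hz => ⟨mul_ne_zero hk hz.1, ?_⟩⟩
  exact (hz.2.const_mul k).congr_deriv (by ring)

lemma IsBakerAkhiezerAt.exists_eq_mul {τ : ℍ} {p T C : ℂ} {F G : ℂ → ℂ} {w : ℂ}
    (hF : IsBakerAkhiezerAt τ p T C F w) (hG : IsBakerAkhiezerAt τ p T C G w) :
    ∃ k : ℂ, k ≠ 0 ∧ F =ᶠ[𝓝 w] fun z => k * G z := by
  obtain ⟨k, hk⟩ := exists_eq_mul_of_log_deriv hF.1.meromorphicAt hG.1.meromorphicAt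
    (hF.2.mono fun z hz => hz.2) (hG.2.mono fun z hz => hz.2) (hG.2.mono fun z hz => hz.1)
  refine ⟨k, ?_, eventuallyEq_nhds_of_nhdsNE hF.1.continuousAt
    (analyticAt_const.fun_mul hG.1).continuousAt hk⟩
  rintro rfl
  obtain ⟨z, h1, h2⟩ := (hF.2.and hk).exists
  exact h1.1 (h2.trans (zero_mul _))

lemma IsBakerAkhiezerAt.comp_add {τ : ℍ} {p : ℂ} (hp : 2 * p ∉ (periods τ).lattice) {T C : ℂ}
    {F : ℂ → ℂ} {w l : ℂ} (hl : l ∈ (periods τ).lattice)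
    (h : IsBakerAkhiezerAt τ p T C F (w + l)) :
    IsBakerAkhiezerAt τ p T C (fun z => F (z + l)) w := by
  refine ⟨AnalyticAt.fun_comp (g := F) h.1 (by fun_prop), ?_⟩
  filter_upwards [eventually_nhdsNE_add l h.2, nhdsNE_of_codiscrete (isPeriodic_phi hp T C l hl) w]
    with z h1 h2
  refine ⟨h1.1, ?_⟩
  rw [← h2]
  exact h1.2.comp_add_const z l

/-- A thin convex neighbourhood of a segment without singular points. -/
lemma exists_convex_nhd_segment {τ : ℍ} {p a b : ℂ} (h : segment ℝ a b ⊆ (singularSet τ p)ᶜ) :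
    ∃ U : Set ℂ, IsOpen U ∧ Convex ℝ U ∧ Bornology.IsBounded U ∧ segment ℝ a b ⊆ U ∧
      U ⊆ (singularSet τ p)ᶜ := by
  have hc : IsCompact (segment ℝ a b) := by
    rw [← convexHull_pair]
    exact (Set.toFinite {a, b}).isCompact_convexHull (𝕜 := ℝ)
  obtain ⟨δ, hδ, hsub⟩ := hc.exists_thickening_subset_open (isOpen_compl_singularSet τ p) h
  exact ⟨_, Metric.isOpen_thickening, (convex_segment a b).thickening δ, hc.isBounded.thickening,
    Metric.self_subset_thickening hδ _, hsub⟩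

lemma IsBasePoint.segment_subset {τ : ℍ} {p z₀ : ℂ} (h : IsBasePoint τ p z₀) {ω : ℂ}
    (hω : ω = 1 ∨ ω = τ) : segment ℝ z₀ (z₀ + ω) ⊆ (singularSet τ p)ᶜ := by
  rw [segment_eq_image']
  rintro _ ⟨t, -, rfl⟩
  rcases hω with rfl | rfl
  · simpa using (h t).1
  · simpa using (h t).2

/-- Continuation of a Baker–Akhiezer function along a period segment. -/
lemma IsBakerAkhiezerAt.exists_continuation {τ : ℍ} {p : ℂ} (hp : 2 * p ∉ (periods τ).lattice)
    {T C : ℂ} (hC : C ^ 2 = spectralQ τ p T) {y : ℂ → ℂ} {z₀ ω : ℂ}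
    (hω : ω ∈ (periods τ).lattice) (hseg : segment ℝ z₀ (z₀ + ω) ⊆ (singularSet τ p)ᶜ)
    (hy : IsBakerAkhiezerAt τ p T C y z₀) :
    ∃ (F : ℂ → ℂ) (lam : ℂ), (∀ w ∈ segment ℝ z₀ (z₀ + ω), IsBakerAkhiezerAt τ p T C F w) ∧
      F =ᶠ[𝓝 z₀] y ∧ lam ≠ 0 ∧ (fun z => F (z + ω)) =ᶠ[𝓝 z₀] fun z => lam * y z := by
  obtain ⟨U, hU, hconv, hb, hsU, hUS⟩ := exists_convex_nhd_segment hseg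
  obtain ⟨F, hF⟩ := exists_bakerAkhiezer hp hC hU hconv hb hUS
  obtain ⟨k, hk, hyF⟩ := hy.exists_eq_mul (hF z₀ (hsU (left_mem_segment ℝ _ _)))
  have h1 := ((hF _ (hsU (right_mem_segment ℝ _ _))).const_mul hk).comp_add hp hω
  obtain ⟨lam, hlam, h2⟩ := h1.exists_eq_mul hy
  exact ⟨fun z => k * F z, lam, fun w hw => (hF w (hsU hw)).const_mul hk, hyF.symm, hlam, h2⟩

lemma phi_neg_add (τ : ℍ) (p T C z : ℂ) :
    phi τ p T C z + phi τ p T (-C) z = deriv (Phi τ p T) z / Phi τ p T z := by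
  simp only [phi]
  rw [← add_div]
  congr 1
  ring

/-- The product of the Baker–Akhiezer functions of `(T, C)` and `(T, -C)` is a multiple of `Φ`. -/
lemma IsBakerAkhiezerAt.mul_eq_Phi {τ : ℍ} {p : ℂ} (hp : 2 * p ∉ (periods τ).lattice)
    {T C : ℂ} {F G : ℂ → ℂ} {w : ℂ} (hF : IsBakerAkhiezerAt τ p T C F w)
    (hG : IsBakerAkhiezerAt τ p T (-C) G w) :
    ∃ k : ℂ, k ≠ 0 ∧ (fun z => F z * G z) =ᶠ[𝓝[≠] w] fun z => k * Phi τ p T z := by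
  obtain ⟨k, hk⟩ := exists_eq_mul_of_log_deriv (f := fun z => deriv (Phi τ p T) z / Phi τ p T z)
    (hF.1.fun_mul hG.1).meromorphicAt (meromorphic_Phi τ p T w) (by
      filter_upwards [hF.2, hG.2] with z h1 h2
      refine (h1.2.fun_mul h2.2).congr_deriv ?_
      rw [← phi_neg_add τ p T C z]
      ring) (hasDerivAt_Phi_log hp T w) (Phi_eventually_ne hp T w)
  refine ⟨k, ?_, hk⟩
  rintro rfl
  obtain ⟨z, h1, h2, h3⟩ := (hF.2.and (hG.2.and hk)).exists
  exact mul_ne_zero h1.1 h2.1 (h3.trans (zero_mul _))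

/-- The multipliers of the Baker–Akhiezer functions of `(T, C)` and `(T, -C)` are inverse to
each other. -/
lemma multiplier_mul_eq_one {τ : ℍ} {p : ℂ} (hp : 2 * p ∉ (periods τ).lattice)
    {T C : ℂ} {y y' F F' : ℂ → ℂ} {z₀ ω lam lam' : ℂ} (hω : ω ∈ (periods τ).lattice)
    (hF : ∀ w ∈ segment ℝ z₀ (z₀ + ω), IsBakerAkhiezerAt τ p T C F w)
    (hF' : ∀ w ∈ segment ℝ z₀ (z₀ + ω), IsBakerAkhiezerAt τ p T (-C) F' w)
    (hy : F =ᶠ[𝓝 z₀] y) (hy' : F' =ᶠ[𝓝 z₀] y')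
    (hlam : (fun z => F (z + ω)) =ᶠ[𝓝 z₀] fun z => lam * y z)
    (hlam' : (fun z => F' (z + ω)) =ᶠ[𝓝 z₀] fun z => lam' * y' z) : lam * lam' = 1 := by
  have ha := left_mem_segment ℝ z₀ (z₀ + ω)
  have hb := right_mem_segment ℝ z₀ (z₀ + ω)
  obtain ⟨k, hk, h1⟩ := (hF _ ha).mul_eq_Phi hp (hF' _ ha)
  -- The relation FF' = kΦ continues along the segment with the same k; comparing its ends through
  -- the periodicity of Φ gives λλ' = 1.
  have h2 := eventuallyEq_of_preconnected (convex_segment z₀ (z₀ + ω)).isPreconnected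
    (fun w hw => ((hF w hw).1.fun_mul (hF' w hw).1).meromorphicAt)
    (fun w _ => by have := meromorphic_Phi τ p T w; fun_prop) ha hb h1
  obtain ⟨z, e1, e2, e3, e4, e5, e6, e7, e8, e9⟩ := (h1.and <| (eventually_nhdsNE_add ω h2).and <|
    (hy.filter_mono nhdsWithin_le_nhds).and <| (hy'.filter_mono nhdsWithin_le_nhds).and <|
    (hlam.filter_mono nhdsWithin_le_nhds).and <| (hlam'.filter_mono nhdsWithin_le_nhds).and <|
    (nhdsNE_of_codiscrete (isPeriodic_Phi hp T ω hω) z₀).and <|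
    (hF _ ha).2.and (hF' _ ha).2).exists
  beta_reduce at e1 e2 e5 e6 e7
  rw [e5, e6, e7, ← e1, ← e3, ← e4] at e2
  refine mul_right_cancel₀ (mul_ne_zero e8.1 e9.1) ?_
  linear_combination e2

lemma exists_exp_eq {a : ℂ} (ha : a ≠ 0) :
    ∃ s : ℂ, Complex.exp (2 * Real.pi * Complex.I * s) = a := by
  refine ⟨Complex.log a / (2 * Real.pi * Complex.I), ?_⟩
  rw [mul_div_cancel₀ _ Complex.two_pi_I_ne_zero, Complex.exp_log ha]

/-- For `C ≠ 0` the Baker–Akhiezer functions of `(T, C)` and `(T, -C)` are independent. -/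
lemma IsBakerAkhiezerAt.independent {τ : ℍ} {p : ℂ} (hp : 2 * p ∉ (periods τ).lattice)
    {T C : ℂ} (hC : C ≠ 0) {F G : ℂ → ℂ} {w a b : ℂ} (hF : IsBakerAkhiezerAt τ p T C F w)
    (hG : IsBakerAkhiezerAt τ p T (-C) G w) (h : ∀ᶠ z in 𝓝 w, a * F z + b * G z = 0) :
    a = 0 ∧ b = 0 := by
  obtain ⟨z, h1, h2, h3, h4⟩ := (hF.2.and <| hG.2.and <| (Phi_eventually_ne hp T w).and <|
    (eventually_eventually_nhds.mpr h).filter_mono nhdsWithin_le_nhds).exists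
  have h5 := ((h1.2.const_mul a).fun_add (h2.2.const_mul b)).unique
    ((hasDerivAt_const z (0 : ℂ)).congr_of_eventuallyEq h4)
  have h6 := h4.self_of_nhds
  have h7 : phi τ p T C z - phi τ p T (-C) z = 2 * Complex.I * C / Phi τ p T z := by
    simp only [phi]
    rw [← sub_div]
    congr 1
    ring
  have h8 : phi τ p T C z - phi τ p T (-C) z ≠ 0 := by
    rw [h7]
    exact div_ne_zero (mul_ne_zero (mul_ne_zero two_ne_zero Complex.I_ne_zero) hC) h3
  constructor
  · have : a * F z * (phi τ p T C z - phi τ p T (-C) z) = 0 := by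
      linear_combination h5 - phi τ p T (-C) z * h6
    simpa [h8, h1.1] using this
  · have : b * G z * (phi τ p T C z - phi τ p T (-C) z) = 0 := by
      linear_combination phi τ p T C z * h6 - h5
    simpa [h8, h2.1] using this

lemma isContinuation_of_bakerAkhiezer {τ : ℍ} {p T C a b : ℂ} {F y : ℂ → ℂ}
    (hF : ∀ w ∈ segment ℝ a b, IsBakerAkhiezerAt τ p T C F w) (hy : F =ᶠ[𝓝 a] y) :
    IsContinuation a b y F := ⟨F, fun w hw => (hF w hw).1, hy, EventuallyEq.rfl⟩

/-- Along a period segment the pair of Baker–Akhiezer functions has monodromy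
`diag(λ, λ⁻¹)`. -/
lemma exists_monodromy_of_bakerAkhiezer {τ : ℍ} {p : ℂ} (hp : 2 * p ∉ (periods τ).lattice)
    {T C : ℂ} (hC : C ^ 2 = spectralQ τ p T) {y y' : ℂ → ℂ} {z₀ ω : ℂ}
    (hω : ω ∈ (periods τ).lattice) (hseg : segment ℝ z₀ (z₀ + ω) ⊆ (singularSet τ p)ᶜ)
    (hy : IsBakerAkhiezerAt τ p T C y z₀) (hy' : IsBakerAkhiezerAt τ p T (-C) y' z₀) :
    ∃ lam : ℂ, lam ≠ 0 ∧ IsMonodromyMatrix z₀ ω ![y, y'] !![lam, 0; 0, lam⁻¹] := by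
  obtain ⟨F, lam, hF, hFy, hlam, hmon⟩ := hy.exists_continuation hp hC hω hseg
  obtain ⟨F', lam', hF', hFy', -, hmon'⟩ :=
    hy'.exists_continuation hp (by rw [neg_sq, hC]) hω hseg
  have h1 := multiplier_mul_eq_one hp hω hF hF' hFy hFy' hmon hmon'
  refine ⟨lam, hlam, ![F, F'], fun i => ?_, ?_⟩
  · fin_cases i
    · exact isContinuation_of_bakerAkhiezer hF hFy
    · exact isContinuation_of_bakerAkhiezer hF' hFy'
  · filter_upwards [hmon, hmon'] with z e1 e2
    rw [← eq_inv_of_mul_eq_one_right h1]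
    ext i
    fin_cases i
    · simpa [Matrix.mulVec, dotProduct, Fin.sum_univ_two] using e1
    · simpa [Matrix.mulVec, dotProduct, Fin.sum_univ_two] using e2

lemma completelyReducible_of_ne_zero {τ : ℍ} {p : ℂ} (hp : 2 * p ∉ (periods τ).lattice)
    {T z₀ : ℂ} (hz₀ : IsBasePoint τ p z₀) (hQ : spectralQ τ p T ≠ 0) :
    CompletelyReducible τ p T z₀ := by
  obtain ⟨C, hC⟩ := IsAlgClosed.exists_pow_nat_eq (spectralQ τ p T) two_pos
  have hC0 : C ≠ 0 := by
    rintro rfl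
    exact hQ (by rw [← hC]; ring)
  have hC' : (-C) ^ 2 = spectralQ τ p T := by rw [neg_sq, hC]
  have hs1 := hz₀.segment_subset (ω := 1) (Or.inl rfl)
  have hs2 := hz₀.segment_subset (ω := τ) (Or.inr rfl)
  have hz₀S : z₀ ∉ singularSet τ p := hs1 (left_mem_segment ℝ _ _)
  obtain ⟨U, hU, hconv, hb, hsU, hUS⟩ := exists_convex_nhd_segment hs1
  obtain ⟨F, hF⟩ := exists_bakerAkhiezer hp hC hU hconv hb hUS
  obtain ⟨G, hG⟩ := exists_bakerAkhiezer hp hC' hU hconv hb hUS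
  have hF := hF z₀ (hsU (left_mem_segment ℝ _ _))
  have hG := hG z₀ (hsU (left_mem_segment ℝ _ _))
  obtain ⟨l1, hl1, hm1⟩ := exists_monodromy_of_bakerAkhiezer hp hC (one_mem τ) hs1 hF hG
  obtain ⟨l2, hl2, hm2⟩ := exists_monodromy_of_bakerAkhiezer hp hC (tau_mem τ) hs2 hF hG
  -- The inverse appears because the first diagonal entry of M₁ is e^{-2πis}.
  obtain ⟨s, hs⟩ := exists_exp_eq (inv_ne_zero hl1)
  obtain ⟨r, hr⟩ := exists_exp_eq hl2
  refine ⟨![F, G], r, s, ⟨fun i => ?_, fun i => ?_, fun c hc => ?_⟩, ?_, ?_⟩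
  · fin_cases i
    · exact hF.1
    · exact hG.1
  · fin_cases i
    · exact hF.deriv_deriv hp hC hz₀S
    · exact hG.deriv_deriv hp hC' hz₀S
  · obtain ⟨h0, h1⟩ := hF.independent hp hC0 hG (a := c 0) (b := c 1)
      (hc.mono fun z hz => by simpa [Fin.sum_univ_two] using hz)
    ext i
    fin_cases i
    · exact h0
    · exact h1
  · rw [Complex.exp_neg, hs, inv_inv]
    exact hm1
  · rw [Complex.exp_neg, hr]
    exact hm2

/-! ### Failure of complete reducibility when `Q(T) = 0` -/

/-- For Q = 0 the order of Φ is -2 on the lattice, -1 or 3 at ±p, and 0 or 2 elsewhere; only the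
orders 2 and 3 need an argument. -/
lemma hasResidueFreePart_inv_Phi {τ : ℍ} {p : ℂ} (hp : 2 * p ∉ (periods τ).lattice) {T : ℂ}
    (hQ : spectralQ τ p T = 0) (w : ℂ) : HasResidueFreePart (fun z => 1 / Phi τ p T z) w := by
  obtain ⟨n, g, hg, hg0, hΦ, hn⟩ := exists_Phi_factor hp T w
  have hspec := Phi_spectral_nhdsNE hp T w
  rw [hQ] at hspec
  by_cases hw : w ∈ singularSet τ p
  · by_cases hw' : w ∈ (periods τ).lattice
    · rw [order_Phi_lattice hp T hw'] at hn
      have : n = -2 := (WithTop.coe_injective hn).symm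
      exact hasResidueFreePart_inv_of_nonpos hg hg0 hΦ (by omega)
    · obtain ⟨ρ, m, hm, hmρ, hq⟩ := exists_potential_apparent hp T (hw.resolve_left hw')
      have h1 := order_eq_of_spectral_zero (h := fun z => 3 / 4 + (z - w) * (ρ + (z - w) * m z))
        hg hg0 hΦ (by fun_prop) hq hspec
      simp only [sub_self, zero_mul, add_zero] at h1
      have h2 : ((n : ℂ) - 3) * ((n : ℂ) + 1) = 0 := by linear_combination 4 * h1
      have h3 : (n - 3) * (n + 1) = 0 := by exact_mod_cast h2
      rcases mul_eq_zero.mp h3 with h | h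
      · obtain rfl : n = 3 := by omega
        exact hasResidueFreePart_inv_of_order_three hg hg0 hΦ hm hmρ hq hspec
      · exact hasResidueFreePart_inv_of_nonpos hg hg0 hΦ (by omega)
  · have han := analyticAt_potential T hw
    obtain ⟨h, hh, hq, hcases⟩ := exists_potential_local hp T w
    have hκ : h w = 0 := by
      rcases hcases with ⟨-, h1⟩ | ⟨h1, -⟩ | ⟨h1, -⟩
      · exact h1
      · exact absurd (Or.inl h1) hw
      · exact absurd (Or.inr h1) hw
    have h1 := order_eq_of_spectral_zero hg hg0 hΦ hh hq hspec
    rw [hκ] at h1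
    have h2 : (n : ℂ) * ((n : ℂ) - 2) = 0 := by linear_combination 4 * h1
    have h3 : n * (n - 2) = 0 := by exact_mod_cast h2
    rcases mul_eq_zero.mp h3 with h | h
    · exact hasResidueFreePart_inv_of_nonpos hg hg0 hΦ (by omega)
    · obtain rfl : n = 2 := by omega
      exact hasResidueFreePart_inv_of_order_two hg hg0 hΦ han EventuallyEq.rfl hspec

/-- If χ were periodic, χΦ would be an elliptic solution and hence cΦ, making χ constant although χ'
= 1/Φ is nonzero. -/
lemma not_isPeriodic_primitive {τ : ℍ} {p : ℂ} (hp : 2 * p ∉ (periods τ).lattice) {T : ℂ}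
    (hQ : spectralQ τ p T = 0) {χ : ℂ → ℂ} (hχ : Meromorphic χ)
    (hd : ∀ᶠ z in codiscrete ℂ, HasDerivAt χ (1 / Phi τ p T z) z) : ¬ IsPeriodic τ χ := by
  intro hper
  have hne := eventually_codiscrete_ne_zero (meromorphic_Phi τ p T) (order_Phi_ne_top hp T)
  have hsol : IsEllipticSymSqSolution τ p T (fun z => χ z * Phi τ p T z) := by
    refine ⟨hχ.fun_mul (meromorphic_Phi τ p T),
      IsPeriodic.comp₂ hper (isPeriodic_Phi hp T) (fun u v => u * v), ?_⟩
    filter_upwards [eventually_codiscrete_eventually_nhds hd,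
      eventually_codiscrete_eventually_nhds hne,
      eventually_codiscrete_eventually_nhds (eventually_codiscrete_notMem_singularSet τ p),
      (isEllipticSymSqSolution_Phi hp T).2.2] with z h1 h2 h3 h4
    have d1 : deriv (fun z => χ z * Phi τ p T z) =ᶠ[𝓝 z]
        fun z => 1 + χ z * deriv (Phi τ p T) z := by
      filter_upwards [h1, h2, h3] with y e1 e2 e3
      rw [(e1.fun_mul (analyticAt_Phi T e3).differentiableAt.hasDerivAt).deriv,
        one_div_mul_cancel e2]
    have d2 : deriv (deriv (fun z => χ z * Phi τ p T z)) =ᶠ[𝓝 z] fun z =>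
        1 / Phi τ p T z * deriv (Phi τ p T) z + χ z * deriv (deriv (Phi τ p T)) z := by
      filter_upwards [h1, h3, d1.eventuallyEq_nhds] with y e1 e3 e
      rw [e.deriv_eq]
      exact ((e1.fun_mul (analyticAt_Phi T e3).deriv.differentiableAt.hasDerivAt).const_add 1).deriv
    have a := analyticAt_Phi T h3.self_of_nhds
    have hz := h2.self_of_nhds
    have h5 := ((((hasDerivAt_const z (1 : ℂ)).fun_div a.differentiableAt.hasDerivAt hz).fun_mul
      a.deriv.differentiableAt.hasDerivAt).fun_add
      (h1.self_of_nhds.fun_mul a.deriv.deriv.differentiableAt.hasDerivAt)).deriv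
    have hs := Phi_spectral hp T h3.self_of_nhds
    rw [hQ] at hs
    rw [d2.deriv_eq, h5, d1.self_of_nhds]
    field_simp
    -- The equation for χΦ leaves, besides χ times the equation for Φ, a multiple of the first
    -- integral; this is where Q = 0 enters.
    linear_combination 4 * hs + χ z * Phi τ p T z ^ 2 * h4
  obtain ⟨c, hc⟩ := exists_eq_mul_Phi hp hsol
  obtain ⟨z, h1, h2, h3⟩ := ((eventually_codiscrete_iff.mp hd 0).and <|
    (eventually_codiscrete_iff.mp hne 0).and <| eventually_codiscrete_iff.mp
    (eventually_codiscrete_eventually_nhds (hc.and hne)) 0).exists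
  have h4 : χ =ᶠ[𝓝 z] fun _ => c := by
    filter_upwards [h3] with y hy
    exact mul_right_cancel₀ hy.2 hy.1
  have h5 := h1.unique ((hasDerivAt_const z c).congr_of_eventuallyEq h4)
  exact one_div_ne_zero h2 h5

lemma exists_primitive_add {τ : ℍ} {p : ℂ} (hp : 2 * p ∉ (periods τ).lattice) {T : ℂ}
    {χ : ℂ → ℂ} (hχ : Meromorphic χ)
    (hd : ∀ᶠ z in codiscrete ℂ, HasDerivAt χ (1 / Phi τ p T z) z) {l : ℂ}
    (hl : l ∈ (periods τ).lattice) :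
    ∃ c, (fun z => χ (z + l)) =ᶠ[codiscrete ℂ] fun z => χ z + c := by
  have hχl : Meromorphic fun z => χ (z + l) :=
    Meromorphic.meromorphic_fun_comp_add_const_iff_meromorphic.mpr hχ
  obtain ⟨c, hc⟩ := exists_eventuallyEq_const_of_deriv_codiscrete
    (f := fun z => χ (z + l) - χ z) (hχl.fun_sub hχ) (by
      filter_upwards [hd, eventually_codiscrete_add l hd, isPeriodic_Phi hp T l hl] with z h1 h2 h3
      have h2 := h2.comp_add_const z l
      rw [h3] at h2
      rw [(h2.fun_sub h1).deriv, sub_self])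
  exact ⟨c, hc.mono fun z hz => by linear_combination hz⟩

/-- Reduction of order: the solutions near a regular point, when `C = 0`. -/
lemma exists_solution_eq {τ : ℍ} {p : ℂ} (hp : 2 * p ∉ (periods τ).lattice) {T : ℂ}
    (hQ : spectralQ τ p T = 0) {χ F y : ℂ → ℂ} {w : ℂ} (hw : w ∉ singularSet τ p)
    (hχ : Meromorphic χ) (hd : ∀ᶠ z in codiscrete ℂ, HasDerivAt χ (1 / Phi τ p T z) z)
    (hF : IsBakerAkhiezerAt τ p T 0 F w) (hy : AnalyticAt ℂ y w)
    (hode : ∀ᶠ z in 𝓝 w, deriv (deriv y) z = potential τ p T z * y z) :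
    ∃ a b : ℂ, y =ᶠ[𝓝[≠] w] fun z => F z * (a * χ z + b) := by
  have hF2 := hF.deriv_deriv hp (by rw [hQ]; ring) hw
  have hFy := hF.1
  have hy' := hy.deriv
  have hF' := hF.1.deriv
  have hχw := hχ w
  -- W is the constant Wronskian. As C = 0, F² = kΦ, so (y/F)' = W/F² = (W/k)χ'.
  obtain ⟨W, hW⟩ := exists_eventuallyEq_const_of_deriv
    (f := fun z => deriv y z * F z - y z * deriv F z)
    ((hy'.fun_mul hF.1).fun_sub (hy.fun_mul hF')).meromorphicAt (by
      filter_upwards [hF2.filter_mono nhdsWithin_le_nhds, hode.filter_mono nhdsWithin_le_nhds,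
        hy.eventually_analyticAt.filter_mono nhdsWithin_le_nhds,
        hF.1.eventually_analyticAt.filter_mono nhdsWithin_le_nhds] with z h1 h2 h3 h4
      rw [((h3.deriv.differentiableAt.hasDerivAt.fun_mul h4.differentiableAt.hasDerivAt).fun_sub
        (h3.differentiableAt.hasDerivAt.fun_mul h4.deriv.differentiableAt.hasDerivAt)).deriv,
        h1, h2]
      ring)
  obtain ⟨k, hk, hkΦ⟩ := hF.mul_eq_Phi hp (by rw [neg_zero]; exact hF)
  obtain ⟨b, hb⟩ := exists_eventuallyEq_const_of_deriv (w := w)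
    (f := fun z => y z / F z - W / k * χ z) (by
      have h1 := hy.meromorphicAt
      have h2 := hF.1.meromorphicAt
      fun_prop) (by
      filter_upwards [hW, hkΦ, eventually_codiscrete_iff.mp hd w, hF.2, Phi_eventually_ne hp T w,
        hy.eventually_analyticAt.filter_mono nhdsWithin_le_nhds,
        hF.1.eventually_analyticAt.filter_mono nhdsWithin_le_nhds] with z h1 h2 h3 h4 h5 h6 h7
      rw [((h6.differentiableAt.hasDerivAt.fun_div h7.differentiableAt.hasDerivAt h4.1).fun_sub
        (h3.const_mul (W / k))).deriv, h1, sq, h2]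
      field_simp
      ring)
  refine ⟨W / k, b, ?_⟩
  filter_upwards [hb, hF.2] with z h1 h2
  rw [← h1]
  field_simp [h2.1]
  ring

/-- Continuation sends F(aχ + b) to λF(aχ + ac + b). If this equals μF(aχ + b), then λ = μ because χ
is not constant, and λac = 0. -/
lemma isMonodromy_add_eq_zero {τ : ℍ} {p : ℂ} (hp : 2 * p ∉ (periods τ).lattice) {T : ℂ}
    (hQ : spectralQ τ p T = 0) {χ F y Y : ℂ → ℂ} {z₀ ω a b c μ : ℂ}
    (hω : ω ∈ (periods τ).lattice) (hseg : segment ℝ z₀ (z₀ + ω) ⊆ (singularSet τ p)ᶜ)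
    (hχ : Meromorphic χ) (hd : ∀ᶠ z in codiscrete ℂ, HasDerivAt χ (1 / Phi τ p T z) z)
    (hF : IsBakerAkhiezerAt τ p T 0 F z₀) (ha : a ≠ 0)
    (hy : y =ᶠ[𝓝[≠] z₀] fun z => F z * (a * χ z + b))
    (hc : (fun z => χ (z + ω)) =ᶠ[codiscrete ℂ] fun z => χ z + c)
    (hY : IsContinuation z₀ (z₀ + ω) y Y) (hmon : ∀ᶠ z in 𝓝 z₀, Y (z + ω) = μ * y z) : c = 0 := by
  obtain ⟨H, lam, hH, hHF, hlam, hHlam⟩ :=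
    hF.exists_continuation hp (by rw [hQ]; ring) hω hseg
  obtain ⟨G, hG, hGy, hGY⟩ := hY
  have h1 : G =ᶠ[𝓝[≠] z₀] fun z => H z * (a * χ z + b) := by
    filter_upwards [hGy.filter_mono nhdsWithin_le_nhds, hy,
      hHF.filter_mono nhdsWithin_le_nhds] with z e1 e2 e3
    rw [e1, e2, e3]
  have h2 := eventuallyEq_of_preconnected (convex_segment z₀ (z₀ + ω)).isPreconnected
    (fun w hw => (hG w hw).meromorphicAt) (fun w hw => by
      have e1 := (hH w hw).1.meromorphicAt
      have e2 := hχ w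
      fun_prop) (left_mem_segment ℝ _ _) (right_mem_segment ℝ _ _) h1
  have h3 : ∀ᶠ z in 𝓝[≠] z₀, (lam - μ) * a * χ z + (lam * (a * c + b) - μ * b) = 0 := by
    filter_upwards [eventually_nhdsNE_add ω h2,
      eventually_nhdsNE_add ω (hGY.filter_mono nhdsWithin_le_nhds),
      hmon.filter_mono nhdsWithin_le_nhds, hHlam.filter_mono nhdsWithin_le_nhds, hF.2, hy,
      nhdsNE_of_codiscrete hc z₀] with z e1 e2 e3 e4 e5 e6 e7
    rw [e2, e3, e4, e6, e7] at e1
    refine mul_left_cancel₀ e5.1 ?_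
    linear_combination -e1
  obtain ⟨z, e1, e2, e3⟩ := ((eventually_nhdsNE_eventually_nhds_iff.mpr h3).and <|
    (eventually_codiscrete_iff.mp hd z₀).and (Phi_eventually_ne hp T z₀)).exists
  have e4 := ((e2.const_mul ((lam - μ) * a)).add_const (lam * (a * c + b) - μ * b)).unique
    ((hasDerivAt_const z (0 : ℂ)).congr_of_eventuallyEq e1)
  have e5 : lam - μ = 0 := by
    simpa [ha, e3] using e4
  have e6 := e1.self_of_nhds
  have e7 : lam * a * c = 0 := by linear_combination e6 - (a * χ z + b) * e5
  simpa [hlam, ha] using e7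

lemma mulVec_diag (y : Fin 2 → ℂ → ℂ) (a b z : ℂ) (i : Fin 2) :
    (!![a, 0; 0, b] *ᵥ (fun i => y i z)) i = ![a, b] i * y i z := by
  fin_cases i <;> simp [Matrix.mulVec, dotProduct, Fin.sum_univ_two]

/-- Some member of a diagonalizing basis involves χ, since not both can be multiples of F. Its being
an eigenvector for both periods makes χ periodic. -/
lemma not_completelyReducible {τ : ℍ} {p : ℂ} (hp : 2 * p ∉ (periods τ).lattice)
    {T z₀ : ℂ} (hz₀ : IsBasePoint τ p z₀) (hQ : spectralQ τ p T = 0) :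
    ¬ CompletelyReducible τ p T z₀ := by
  rintro ⟨y, r, s, ⟨hyan, hode, hind⟩, ⟨Y, hY, hYm⟩, ⟨Z, hZ, hZm⟩⟩
  obtain ⟨χ, hχ, hd⟩ := exists_global_primitive
    (f := fun z => 1 / Phi τ p T z) (by have := meromorphic_Phi τ p T; fun_prop)
    (hasResidueFreePart_inv_Phi hp hQ)
  have hs1 := hz₀.segment_subset (ω := 1) (Or.inl rfl)
  have hs2 := hz₀.segment_subset (ω := τ) (Or.inr rfl)
  have hz₀S : z₀ ∉ singularSet τ p := hs1 (left_mem_segment ℝ _ _)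
  obtain ⟨U, hU, hconv, hb, hsU, hUS⟩ := exists_convex_nhd_segment hs1
  obtain ⟨F, hF⟩ := exists_bakerAkhiezer hp (T := T) (C := 0) (by rw [hQ]; ring) hU hconv hb hUS
  have hF := hF z₀ (hsU (left_mem_segment ℝ _ _))
  choose a b hab using fun i => exists_solution_eq hp hQ hz₀S hχ hd hF (hyan i) (hode i)
  obtain ⟨i, hi⟩ : ∃ i, a i ≠ 0 := by
    by_contra! h0
    have hrel : ∀ᶠ z in 𝓝 z₀, ∑ i, ![b 1, -b 0] i * y i z = 0 := by
      have h1 : AnalyticAt ℂ (fun z => b 1 * y 0 z - b 0 * y 1 z) z₀ := by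
        have := hyan 0
        have := hyan 1
        fun_prop
      have h2 := eventuallyEq_nhds_of_nhdsNE h1.continuousAt continuousAt_const
        (g := fun _ => (0 : ℂ)) (by
          filter_upwards [hab 0, hab 1] with z e1 e2
          rw [e1, e2, h0 0, h0 1]
          ring)
      filter_upwards [h2] with z hz
      simp only [Fin.sum_univ_two, Matrix.cons_val_zero, Matrix.cons_val_one]
      linear_combination hz
    have hb0 := hind _ hrel
    have hb1 : b 1 = 0 := by simpa using congrFun hb0 0
    have hy1 : ∀ᶠ z in 𝓝 z₀, ∑ i, (![0, 1] : Fin 2 → ℂ) i * y i z = 0 := by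
      have h2 := eventuallyEq_nhds_of_nhdsNE (hyan 1).continuousAt continuousAt_const
        (g := fun _ => (0 : ℂ)) (by
          filter_upwards [hab 1] with z e2
          rw [e2, h0 1, hb1]
          ring)
      filter_upwards [h2] with z hz
      simp [Fin.sum_univ_two, hz]
    have := congrFun (hind _ hy1) 1
    simp at this
  obtain ⟨c1, hc1⟩ := exists_primitive_add hp hχ hd (one_mem τ)
  obtain ⟨c2, hc2⟩ := exists_primitive_add hp hχ hd (tau_mem τ)
  have h1 : c1 = 0 := isMonodromy_add_eq_zero hp hQ (one_mem τ) hs1 hχ hd hF hi (hab i) hc1 (hY i)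
    (hYm.mono fun z hz => (congrFun hz i).trans (mulVec_diag y _ _ z i))
  have h2 : c2 = 0 := isMonodromy_add_eq_zero hp hQ (tau_mem τ) hs2 hχ hd hF hi (hab i) hc2 (hZ i)
    (hZm.mono fun z hz => (congrFun hz i).trans (mulVec_diag y _ _ z i))
  refine not_isPeriodic_primitive hp hQ hχ hd (isPeriodic_of_generators ?_ ?_)
  · simpa [h1] using hc1
  · simpa [h2] using hc2

/-! ### Monodromy data -/

/-- A codiscrete set contains a segment in any given direction. -/
lemma exists_segment_of_codiscrete {P : ℂ → Prop} (hP : ∀ᶠ z in codiscrete ℂ, P z) {ω : ℂ}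
    (hω : ω ≠ 0) : ∃ a : ℂ, ∀ t : ℝ, P (a + t * ω) := by
  have hcount : {z | ¬ P z}.Countable := by
    have h1 : {z | ¬ P z}ᶜ ∈ codiscrete ℂ := by
      filter_upwards [hP] with z hz h
      exact h hz
    exact (HereditarilyLindelofSpace.isLindelof _).countable_of_isDiscrete
      (compl_mem_codiscrete_iff.mp h1).2
  -- The bad points are countable, so some line parallel to ω avoids them all; Im(z/ω) labels these
  -- lines.
  obtain ⟨y, hy⟩ : ∃ y : ℝ, y ∉ (fun z : ℂ => (z / ω).im) '' {z | ¬ P z} := by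
    by_contra! h
    exact Cardinal.not_countable_real ((hcount.image _).mono fun y _ => h y)
  refine ⟨y * Complex.I * ω, fun t => ?_⟩
  by_contra h
  refine hy ⟨_, h, ?_⟩
  have : (y * Complex.I * ω + t * ω) / ω = y * Complex.I + t := by field_simp
  simp [this]

lemma contDiffOn_extend_segment (a b : ℂ) : ContDiffOn ℝ 1 (Path.segment a b).extend I := by
  have h : ContDiff ℝ 1 (fun t : ℝ => AffineMap.lineMap a b t) := by
    simp only [AffineMap.lineMap_apply_module]
    fun_prop
  exact h.contDiffOn.congr fun t ht => by rw [Path.extend_apply _ ht, Path.segment_apply]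

lemma exists_admissiblePath {τ : ℍ} {p : ℂ} (hp : 2 * p ∉ (periods τ).lattice) (T : ℂ) {ω : ℂ}
    (hω : ω ≠ 0) : ∃ (a : ℂ) (γ : Path a (a + ω)), IsAdmissiblePath τ p T γ := by
  obtain ⟨a, ha⟩ := exists_segment_of_codiscrete
    ((eventually_codiscrete_notMem_singularSet τ p).and
      (eventually_codiscrete_ne_zero (meromorphic_Phi τ p T) (order_Phi_ne_top hp T))) hω
  refine ⟨a, Path.segment a (a + ω), contDiffOn_extend_segment _ _, fun t => ?_⟩
  have : Path.segment a (a + ω) t = a + (t : ℝ) * ω := by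
    rw [Path.segment_apply, AffineMap.lineMap_apply_module']
    simp [add_comm]
  rw [this]
  exact ha t

lemma exists_isMonodromyData {τ : ℍ} {p : ℂ} (hp : 2 * p ∉ (periods τ).lattice) (T C : ℂ) :
    ∃ r s : ℂ, IsMonodromyData τ p T C r s := by
  obtain ⟨z₁, γ₁, h1⟩ := exists_admissiblePath hp T one_ne_zero
  obtain ⟨z₂, γ₂, h2⟩ := exists_admissiblePath hp T (ne_zero τ)
  obtain ⟨s, hs⟩ := exists_exp_eq (a := (multiplier τ p T C γ₁)⁻¹)
    (inv_ne_zero (Complex.exp_ne_zero _))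
  obtain ⟨r, hr⟩ := exists_exp_eq (a := multiplier τ p T C γ₂) (Complex.exp_ne_zero _)
  refine ⟨r, s, z₁, z₂, γ₁, γ₂, h1, h2, ?_, hr.symm⟩
  rw [Complex.exp_neg, hs, inv_inv]

/-! ### Squared multipliers as period factors of a global solution of F' = 2φF -/

/-- A meromorphic solution of `F' = f F` has a representative which is holomorphic and does not
vanish where `f` is holomorphic. -/
lemma exists_regular_of_log_deriv {f F : ℂ → ℂ} (hF : Meromorphic F)
    (hord : ∀ z, meromorphicOrderAt F z ≠ ⊤)
    (hd : ∀ᶠ z in codiscrete ℂ, HasDerivAt F (f z * F z) z) :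
    ∃ G : ℂ → ℂ, G =ᶠ[codiscrete ℂ] F ∧ ∀ w, AnalyticAt ℂ f w →
      G w ≠ 0 ∧ AnalyticAt ℂ G w ∧ HasDerivAt G (f w * G w) w := by
  obtain ⟨G, hG, hGF⟩ := exists_meromorphicNF hF
  refine ⟨G, hGF, fun w hf => ?_⟩
  obtain ⟨n, hn⟩ := WithTop.ne_top_iff_exists.mp (hord w)
  rw [← meromorphicOrderAt_congr_codiscrete hGF] at hn
  obtain ⟨g, hg, hg0, hGg⟩ := (meromorphicOrderAt_eq_int_iff (hG w).meromorphicAt).mp hn.symm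
  have hdG : ∀ᶠ z in 𝓝[≠] w, HasDerivAt G (f z * G z) z := by
    rw [eventually_codiscrete_iff] at hd
    filter_upwards [hd w, eventually_nhdsNE_eventually_nhds_iff.mpr (nhdsNE_of_codiscrete hGF w)]
      with z h1 h2
    have h3 := h1.congr_of_eventuallyEq h2
    rwa [← h2.self_of_nhds] at h3
  -- F'/F has residue n at w, but it equals f, which is analytic there.
  have hn0 : n = 0 := by
    have h1 := deriv_zpow_mul hg hGg
    have h2 : factorDeriv w n g w = (w - w) * (f w * g w) := by
      refine eq_of_eventuallyEq_nhdsNE (g := fun z => (z - w) * (f z * g z))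
        (analyticAt_factorDeriv n hg).continuousAt
        (AnalyticAt.continuousAt (𝕜 := ℂ) (by fun_prop)) ?_
      filter_upwards [h1, hGg, hdG, self_mem_nhdsWithin] with z e1 e2 e3 hne
      have hne : z - w ≠ 0 := sub_ne_zero.mpr hne
      rw [e3.deriv, e2, smul_eq_mul, zpow_sub_one₀ hne] at e1
      refine mul_left_cancel₀ (zpow_ne_zero n hne) ?_
      field_simp at e1
      linear_combination -(z - w) ^ n * e1
    rw [factorDeriv_self, sub_self, zero_mul] at h2
    simpa [hg0] using h2
  rw [hn0] at hn
  have h0 : meromorphicOrderAt G w = 0 := hn.symm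
  have han := (hG w).meromorphicOrderAt_nonneg_iff_analyticAt.mp h0.ge
  refine ⟨(hG w).meromorphicOrderAt_eq_zero_iff.mp h0, han, ?_⟩
  have := eq_of_eventuallyEq_nhdsNE han.deriv.continuousAt (hf.fun_mul han).continuousAt
    (hdG.mono fun z hz => hz.deriv)
  rw [← this]
  exact han.differentiableAt.hasDerivAt

/-- Integrating `F' = f F` along a `C¹` path. -/
lemma eq_mul_exp_curveIntegral {f F : ℂ → ℂ} {a b : ℂ} (γ : Path a b)
    (hγ : ContDiffOn ℝ 1 γ.extend I) (hf : ∀ t, ContinuousAt f (γ t))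
    (hF : ∀ t, HasDerivAt F (f (γ t) * F (γ t)) (γ t)) :
    F b = F a * Complex.exp
      (curveIntegral (fun z => ContinuousLinearMap.toSpanSingleton ℂ (f z)) γ) := by
  have huniq : UniqueDiffOn ℝ I := uniqueDiffOn_Icc zero_lt_one
  have hγd := hγ.continuousOn_derivWithin huniq le_rfl
  have hγI : ∀ {t : ℝ} (ht : t ∈ I), γ.extend t = γ ⟨t, ht⟩ := fun ht => γ.extend_apply ht
  set u : ℝ → ℂ := fun t => f (γ.extend t) * derivWithin γ.extend I t with hu
  have huc : ContinuousOn u I := by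
    refine ContinuousOn.mul (fun t ht => ?_) hγd
    have h1 : ContinuousAt f (γ.extend t) := by rw [hγI ht]; exact hf _
    exact (h1.comp γ.continuous_extend.continuousAt).continuousWithinAt
  -- The integrand is extended continuously to the whole line so that its primitive is
  -- differentiable at the endpoints too.
  set v : ℝ → ℂ := Set.IccExtend zero_le_one (Set.domRestrict (Set.Icc 0 1) u) with hv
  have hvc : Continuous v := (ContinuousOn.domRestrict huc).Icc_extend'
  have hvu : ∀ t ∈ I, v t = u t := fun t ht => Set.IccExtend_of_mem _ _ ht
  have hint : curveIntegral (fun z => ContinuousLinearMap.toSpanSingleton ℂ (f z)) γ =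
      ∫ t in (0 : ℝ)..1, v t := by
    rw [curveIntegral_def]
    refine intervalIntegral.integral_congr fun t ht => ?_
    rw [Set.uIcc_of_le zero_le_one] at ht
    rw [curveIntegralFun_def, hvu t ht]
    simp only [hu, ContinuousLinearMap.toSpanSingleton_apply, smul_eq_mul]
    ring
  set J : ℝ → ℂ := fun t => ∫ x in (0 : ℝ)..t, v x with hJ
  have hJd : ∀ t, HasDerivAt J (v t) t := fun t => (hvc.integral_hasStrictDerivAt 0 t).hasDerivAt
  -- F(γ(t))·exp(-∫₀ᵗ) has derivative zero, hence the same value at both ends.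
  have hH : ∀ t ∈ I, HasDerivWithinAt (fun t => F (γ.extend t) * Complex.exp (-J t)) 0 I t := by
    intro t ht
    have h1 : HasDerivWithinAt γ.extend (derivWithin γ.extend I t) I t :=
      ((hγ.differentiableOn one_ne_zero) t ht).hasDerivWithinAt
    have h2 : HasDerivAt F (f (γ.extend t) * F (γ.extend t)) (γ.extend t) := by
      rw [hγI ht]
      exact hF _
    have h3 := (h2.comp_hasDerivWithinAt t h1).fun_mul (hJd t).fun_neg.cexp.hasDerivWithinAt
    refine h3.congr_deriv ?_
    rw [hvu t ht]
    simp only [hu, Function.comp]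
    ring
  have hconst := constant_of_derivWithin_zero (a := 0) (b := 1)
    (fun t ht => (hH t ht).differentiableWithinAt)
    (fun t ht => (hH t (Set.Ico_subset_Icc_self ht)).derivWithin
      (huniq t (Set.Ico_subset_Icc_self ht))) 1 (Set.right_mem_Icc.mpr zero_le_one)
  simp only [Path.extend_one, Path.extend_zero] at hconst
  have hJ0 : J 0 = 0 := by simp [hJ]
  rw [hJ0, neg_zero, Complex.exp_zero, mul_one] at hconst
  rw [hint, ← hconst, mul_assoc, ← Complex.exp_add]
  change F b = F b * Complex.exp (-J 1 + J 1)
  rw [neg_add_cancel, Complex.exp_zero, mul_one]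

/-- The square of the multiplier is the factor of a global solution of `F' = 2 φ F`. -/
lemma multiplier_sq {τ : ℍ} {p T C : ℂ} {F : ℂ → ℂ} (hF : Meromorphic F)
    (hord : ∀ z, meromorphicOrderAt F z ≠ ⊤)
    (hd : ∀ᶠ z in codiscrete ℂ, HasDerivAt F (2 * phi τ p T C z * F z) z) {a ω k : ℂ}
    (hk : (fun z => F (z + ω)) =ᶠ[codiscrete ℂ] fun z => k * F z) (γ : Path a (a + ω))
    (hγ : IsAdmissiblePath τ p T γ) : multiplier τ p T C γ ^ 2 = k := by
  have hφ : ∀ t, AnalyticAt ℂ (phi τ p T C) (γ t) := fun t => by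
    obtain ⟨h1, h2⟩ := hγ.2 t
    have a1 := analyticAt_Phi T h1
    have a2 := a1.deriv
    unfold phi
    fun_prop (disch := assumption)
  obtain ⟨G, hGF, hG⟩ := exists_regular_of_log_deriv (f := fun z => 2 * phi τ p T C z) hF hord hd
  have hG' := fun t => hG (γ t) (by have := hφ t; fun_prop)
  have h1 := eq_mul_exp_curveIntegral (f := fun z => 2 * phi τ p T C z) γ hγ.1
    (fun t => ((hφ t).continuousAt.const_mul 2)) (fun t => (hG' t).2.2)
  have h2 : curveIntegral (fun z => ContinuousLinearMap.toSpanSingleton ℂ (2 * phi τ p T C z)) γ =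
      2 * curveIntegral (fun z => ContinuousLinearMap.toSpanSingleton ℂ (phi τ p T C z)) γ := by
    rw [curveIntegral_def, curveIntegral_def, ← intervalIntegral.integral_const_mul]
    refine intervalIntegral.integral_congr fun t _ => ?_
    simp only [curveIntegralFun_def, ContinuousLinearMap.toSpanSingleton_apply, smul_eq_mul]
    ring
  have ha := hG' 0
  have hb := hG' 1
  rw [γ.source] at ha
  rw [γ.target] at hb
  have h3 : G (a + ω) = k * G a := by
    have hc : ContinuousAt (fun z => G (z + ω)) a :=
      ContinuousAt.comp (f := fun z => z + ω) hb.2.1.continuousAt (by fun_prop)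
    refine eq_of_eventuallyEq_nhdsNE (g := fun z => k * G z) hc
      (ha.2.1.continuousAt.const_mul k) (nhdsNE_of_codiscrete ?_ a)
    filter_upwards [hk, hGF, eventually_codiscrete_add ω hGF] with z e1 e2 e3
    rw [e3, e2, e1]
  rw [h3, h2, mul_comm k] at h1
  have h4 := mul_left_cancel₀ ha.1 h1
  rw [multiplier, h4, ← Complex.exp_nat_mul]
  push_cast
  rfl

/-- Translation by ω preserves the equation because φ is periodic, so F(z + ω)/F(z) has zero
derivative. -/
lemma exists_global_multiplier {τ : ℍ} {p : ℂ} (hp : 2 * p ∉ (periods τ).lattice) {T C : ℂ}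
    {F : ℂ → ℂ} (hF : Meromorphic F) (hord : ∀ z, meromorphicOrderAt F z ≠ ⊤)
    (hd : ∀ᶠ z in codiscrete ℂ, HasDerivAt F (2 * phi τ p T C z * F z) z) {ω : ℂ}
    (hω : ω ∈ (periods τ).lattice) :
    ∃ k : ℂ, (fun z => F (z + ω)) =ᶠ[codiscrete ℂ] fun z => k * F z := by
  have hFω : Meromorphic fun z => F (z + ω) :=
    Meromorphic.meromorphic_fun_comp_add_const_iff_meromorphic.mpr hF
  have hne := eventually_codiscrete_ne_zero hF hord
  obtain ⟨k, hk⟩ := exists_eventuallyEq_const_of_deriv_codiscrete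
    (f := fun z => F (z + ω) / F z) (hFω.fun_div hF) (by
      filter_upwards [hd, eventually_codiscrete_add ω hd, isPeriodic_phi hp T C ω hω, hne]
        with z h1 h2 h3 h4
      have h2 := h2.comp_add_const z ω
      rw [h3] at h2
      rw [(h2.fun_div h1 h4).deriv]
      field_simp
      ring)
  refine ⟨k, ?_⟩
  filter_upwards [hk, hne] with z h1 h2
  rw [← h1, div_mul_cancel₀ _ h2]

/-- A periodic solution of `F' = 2 φ F` is an elliptic solution of the second symmetric product
equation. -/
lemma isEllipticSymSqSolution_of_log_deriv {τ : ℍ} {p : ℂ} (hp : 2 * p ∉ (periods τ).lattice)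
    {T C : ℂ} (hC : C ^ 2 = spectralQ τ p T) {F : ℂ → ℂ} (hF : Meromorphic F)
    (hd : ∀ᶠ z in codiscrete ℂ, HasDerivAt F (2 * phi τ p T C z * F z) z)
    (hper : IsPeriodic τ F) : IsEllipticSymSqSolution τ p T F := by
  refine ⟨hF, hper, ?_⟩
  have hne := eventually_codiscrete_ne_zero (meromorphic_Phi τ p T) (order_Phi_ne_top hp T)
  filter_upwards [eventually_codiscrete_eventually_nhds hd,
    eventually_codiscrete_eventually_nhds hne,
    eventually_codiscrete_eventually_nhds (eventually_codiscrete_notMem_singularSet τ p)]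
    with z h1 h2 h3
  have d1 : deriv F =ᶠ[𝓝 z] fun z => 2 * phi τ p T C z * F z := h1.mono fun y hy => hy.deriv
  have hφ : ∀ᶠ y in 𝓝 z, HasDerivAt (phi τ p T C) (potential τ p T y - phi τ p T C y ^ 2) y := by
    filter_upwards [h2, h3] with y e2 e3
    exact hasDerivAt_phi hp hC e3 e2
  have d2 : deriv (deriv F) =ᶠ[𝓝 z]
      fun z => 2 * (potential τ p T z + phi τ p T C z ^ 2) * F z := by
    filter_upwards [h1, hφ, d1.eventuallyEq_nhds] with y e1 e2 e
    rw [e.deriv_eq, ((e2.const_mul 2).fun_mul e1).deriv]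
    ring
  have d3 := ((((analyticAt_potential T h3.self_of_nhds).differentiableAt.hasDerivAt.fun_add
    (hφ.self_of_nhds.fun_pow 2)).const_mul 2).fun_mul h1.self_of_nhds).deriv
  rw [d2.deriv_eq, d3, d1.self_of_nhds]
  push_cast
  ring

/-- Squares are used because φ may have half-integral residues when Q ≠ 0: exp ∫2φ is then a global
meromorphic function and its period factors do not depend on the paths. -/
lemma multiplier_sq_eq_one_iff {τ : ℍ} {p : ℂ} (hp : 2 * p ∉ (periods τ).lattice) {T C : ℂ}
    (hC : C ^ 2 = spectralQ τ p T) {z₁ z₂ : ℂ} {γ₁ : Path z₁ (z₁ + 1)}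
    {γ₂ : Path z₂ (z₂ + (τ : ℂ))} (h1 : IsAdmissiblePath τ p T γ₁)
    (h2 : IsAdmissiblePath τ p T γ₂) :
    (multiplier τ p T C γ₁ ^ 2 = 1 ∧ multiplier τ p T C γ₂ ^ 2 = 1) ↔ spectralQ τ p T = 0 := by
  have hne := eventually_codiscrete_ne_zero (meromorphic_Phi τ p T) (order_Phi_ne_top hp T)
  constructor
  · rintro ⟨hm1, hm2⟩
    by_contra hQ
    have hres : ∀ w, ∃ m : ℤ, ∃ k : ℂ → ℂ, AnalyticAt ℂ k w ∧
        (fun z => 2 * phi τ p T C z) =ᶠ[𝓝[≠] w] fun z => (m : ℂ) / (z - w) + k z := by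
      intro w
      obtain ⟨a, k, hk, hφ, -, ha⟩ := exists_phi_residue hp hC w
      obtain ⟨m, hm⟩ := ha hQ
      refine ⟨m, fun z => 2 * k z, by fun_prop, ?_⟩
      filter_upwards [hφ] with z hz
      rw [hz, ← hm]
      ring
    choose m hm using hres
    obtain ⟨F, hF, hord, hd⟩ := exists_global_log_primitive
      (f := fun z => 2 * phi τ p T C z) (by have := meromorphic_phi τ p T C; fun_prop) m hm
    obtain ⟨k1, hk1⟩ := exists_global_multiplier hp hF hord hd (one_mem τ)
    obtain ⟨k2, hk2⟩ := exists_global_multiplier hp hF hord hd (tau_mem τ)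
    have e1 := multiplier_sq hF hord hd hk1 γ₁ h1
    have e2 := multiplier_sq hF hord hd hk2 γ₂ h2
    rw [hm1] at e1
    rw [hm2] at e2
    have hper : IsPeriodic τ F := isPeriodic_of_generators
      (by simpa only [← e1, one_mul] using hk1) (by simpa only [← e2, one_mul] using hk2)
    obtain ⟨c, hc⟩ := exists_eq_mul_Phi hp (isEllipticSymSqSolution_of_log_deriv hp hC hF hd hper)
    obtain ⟨z, e1, e2, e3, e4, e5⟩ := ((eventually_codiscrete_iff.mp hd 0).and <|
      (eventually_codiscrete_iff.mp hne 0).and <|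
      (eventually_codiscrete_iff.mp (eventually_codiscrete_ne_zero hF hord) 0).and <|
      (eventually_codiscrete_iff.mp (eventually_codiscrete_notMem_singularSet τ p) 0).and <|
      eventually_codiscrete_iff.mp (eventually_codiscrete_eventually_nhds hc) 0).exists
    have e6 := e1.unique (((analyticAt_Phi T e4).differentiableAt.hasDerivAt.const_mul
      c).congr_of_eventuallyEq e5)
    have e7 := e5.self_of_nhds
    rw [e7] at e6 e3
    have hc0 : c ≠ 0 := left_ne_zero_of_mul e3
    -- F = cΦ and F' = 2φF together give Φ' = 2iC + Φ'.
    have hC0 : C = 0 := by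
      simp only [phi] at e6
      field_simp at e6
      have : Complex.I * C = 0 := by linear_combination e6 / 2
      simpa using this
    exact hQ (by rw [← hC, hC0]; ring)
  · intro hQ
    rw [hQ] at hC
    have hC0 : C = 0 := by simpa using hC
    have hd : ∀ᶠ z in codiscrete ℂ, HasDerivAt (Phi τ p T)
        (2 * phi τ p T C z * Phi τ p T z) z := by
      filter_upwards [hne, eventually_codiscrete_notMem_singularSet τ p] with z e1 e2
      refine (analyticAt_Phi T e2).differentiableAt.hasDerivAt.congr_deriv ?_
      rw [phi, hC0]
      field_simp
      ring
    have hk : ∀ ω ∈ (periods τ).lattice,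
        (fun z => Phi τ p T (z + ω)) =ᶠ[codiscrete ℂ] fun z => 1 * Phi τ p T z := fun ω hω => by
      simpa only [one_mul] using isPeriodic_Phi hp T ω hω
    have hm := meromorphic_Phi τ p T
    have hord := order_Phi_ne_top hp T
    exact ⟨multiplier_sq hm hord hd (hk 1 (one_mem τ)) γ₁ h1,
      multiplier_sq hm hord hd (hk τ (tau_mem τ)) γ₂ h2⟩

lemma exp_sq_eq_one_iff (r : ℂ) :
    Complex.exp (2 * Real.pi * Complex.I * r) ^ 2 = 1 ↔ ∃ m : ℤ, r = m / 2 := by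
  rw [← Complex.exp_nat_mul, Complex.exp_eq_one_iff]
  refine exists_congr fun m => ?_
  have h := Complex.two_pi_I_ne_zero
  constructor
  · intro h1
    refine mul_left_cancel₀ h ?_
    push_cast at h1
    linear_combination h1 / 2
  · rintro rfl
    push_cast
    ring

lemma IsMonodromyData.isHalfIntegral_iff {τ : ℍ} {p : ℂ} (hp : 2 * p ∉ (periods τ).lattice)
    {T C : ℂ} (hC : C ^ 2 = spectralQ τ p T) {r s : ℂ} (h : IsMonodromyData τ p T C r s) :
    IsHalfIntegral r s ↔ spectralQ τ p T = 0 := by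
  obtain ⟨z₁, z₂, γ₁, γ₂, h1, h2, e1, e2⟩ := h
  rw [← multiplier_sq_eq_one_iff hp hC h1 h2, e1, e2, Complex.exp_neg, inv_pow, inv_eq_one,
    exp_sq_eq_one_iff, exp_sq_eq_one_iff]
  constructor
  · rintro ⟨m, n, hm, hn⟩
    exact ⟨⟨n, hn⟩, ⟨m, hm⟩⟩
  · rintro ⟨⟨n, hn⟩, ⟨m, hm⟩⟩
    exact ⟨m, n, hm, hn⟩

lemma completelyReducible_iff {τ : ℍ} {p : ℂ} (hp : 2 * p ∉ (periods τ).lattice)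
    {T z₀ : ℂ} (hz₀ : IsBasePoint τ p z₀) :
    CompletelyReducible τ p T z₀ ↔ spectralQ τ p T ≠ 0 :=
  ⟨fun h hQ => not_completelyReducible hp hz₀ hQ h, completelyReducible_of_ne_zero hp hz₀⟩

end LameType

end

theorem theorem4p5 (τ : UpperHalfPlane) (p : ℂ)
    (hp : 2 * p ∉ (LameType.periods τ).lattice) (T : ℂ) :
    -- `Φ_e` is, up to a factor, the unique nontrivial elliptic solution
    (LameType.IsEllipticSymSqSolution τ p T (LameType.Phi τ p T) ∧
      (¬ LameType.Phi τ p T =ᶠ[Filter.codiscrete ℂ] 0) ∧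
      ∀ Ψ : ℂ → ℂ, LameType.IsEllipticSymSqSolution τ p T Ψ →
        ∃ c : ℂ, Ψ =ᶠ[Filter.codiscrete ℂ] fun z => c * LameType.Phi τ p T z) ∧
    -- the spectral polynomial as a differential expression in `Φ_e`
    (∀ z : ℂ, z ∉ LameType.singularSet τ p →
      1 / 2 * LameType.Phi τ p T z * deriv (deriv (LameType.Phi τ p T)) z
        - 1 / 4 * deriv (LameType.Phi τ p T) z ^ 2
        - LameType.potential τ p T z * LameType.Phi τ p T z ^ 2 = LameType.spectralQ τ p T) ∧
    -- complete reducibility in terms of the spectral polynomial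
    (∀ z₀ : ℂ, LameType.IsBasePoint τ p z₀ →
      (LameType.CompletelyReducible τ p T z₀ ↔ LameType.spectralQ τ p T ≠ 0)) ∧
    -- complete reducibility in terms of the monodromy data of a point of the spectral curve
    (∀ C : ℂ, C ^ 2 = LameType.spectralQ τ p T →
      (∃ r s : ℂ, LameType.IsMonodromyData τ p T C r s) ∧
      ∀ r s : ℂ, LameType.IsMonodromyData τ p T C r s →
        (LameType.spectralQ τ p T ≠ 0 ↔ ¬ LameType.IsHalfIntegral r s) ∧
        ∀ z₀ : ℂ, LameType.IsBasePoint τ p z₀ →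
          (LameType.CompletelyReducible τ p T z₀ ↔ ¬ LameType.IsHalfIntegral r s)) := by
  refine ⟨⟨LameType.isEllipticSymSqSolution_Phi hp T, LameType.Phi_not_eventuallyEq_zero hp T,
    fun Ψ hΨ => LameType.exists_eq_mul_Phi hp hΨ⟩, fun z hz => LameType.Phi_spectral hp T hz,
    fun z₀ hz₀ => LameType.completelyReducible_iff hp hz₀, fun C hC =>
    ⟨LameType.exists_isMonodromyData hp T C, fun r s h => ⟨?_, fun z₀ hz₀ => ?_⟩⟩⟩
  · rw [h.isHalfIntegral_iff hp hC]
  · rw [LameType.completelyReducible_iff hp hz₀, h.isHalfIntegral_iff hp hC]
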